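/- Fix a finite alphabet $\Sigma$ and a countably infinite set of variables. A vset-automaton (VA) is a finite automaton $A=(Q,q_0,F,\delta)$ whose transitions are labelled by $\epsilon$, by letters of $\Sigma$, or by variable operations $v\vdash$ (open $v$) and $\dashv v$ (close $v$); $\mathsf{Vars}(A)$ is the set of variables occurring in $\delta$. A run on a document $\mathbf d\in\Sigma^*$ leads from $q_0$ to some state while reading $\mathbf d$; it is accepting if it ends in $F$, and valid if every variable is opened at most once, closed at most once, and is opened iff it is closed, the opening preceding the closing. An accepting valid run defines the mapping that sends each variable it opens to the span $[i,j\rangle$ of $\mathbf d$ between its opening and its closing, and $[\![A]\!](\mathbf d)$ is the set of all these mappings. $A$ is functional if every accepting run (on every document) is valid and opens and closes every variable of $\mathsf{Vars}(A)$. $A$ is disjunctive functional if it consists of finitely many functional VAs with pairwise disjoint state sets (its functional components) and a new initial state with $\epsilon$-transitions to their initial states, the accepting states being those of the components. The join $[\![A_1\bowtie A_2]\!](\mathbf d)$ is the set of all $\mu_1\cup\mu_2$ with $\mu_i\in[\![A_i]\!](\mathbf d)$ such that $\mu_1,\mu_2$ agree on their common variables. Then: 1. There is an algorithm that, given two disjunctive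 functional VAs $A_1$ and $A_2$, constructs in time polynomial in their size a disjunctive functional VA $A$ with $[\![A]\!](\mathbf d)=[\![A_1\bowtie A_2]\!](\mathbf d)$ for all $\mathbf d$. Moreover, whenever $B_1,\dots,B_m$ are functional components of $A_1$ and $B'_1,\dots,B'_n$ are functional components of $A_2$, the VA $A$ has functional components $(B_{ij})_{i\le m,\,j\le n}$ such that $B_{ij}$ is equivalent to $B_i\bowtie B'_j$. 2. There is an algorithm that, given two disjunctive functional VAs $A_1$ and $A_2$ and a document $\mathbf d$, outputs the mappings of $[\![A_1\bowtie A_2]\!](\mathbf d)$ one by one and without duplicates with polynomial delay: the time before the first output, between any two consecutive outputs, and after the last output until termination is bounded by a polynomial in the combined size of $A_1$, $A_2$ and $\mathbf d$. -/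

import Mathlib

/-! ### Schemaless document spanners

The alphabet is `Fin k`, documents are words over it, and the countably infinite set of
variables is `ℕ`. -/

/-- A span `[start, finish⟩`, a pair of indices with `1 ≤ start ≤ finish`. -/
@[ext] structure Span where
  start : ℕ
  finish : ℕ
  one_le_start : 1 ≤ start
  start_le_finish : start ≤ finish

/-- A mapping: a partial function from variables to spans; its domain is the set of variables
with a value other than `none`. (All mappings extracted by automata have finite domain.) -/
abbrev Mapping : Type := ℕ → Option Span

/-- Two mappings are compatible if they agree on every common variable. -/
def Mapping.Compatible (μ₁ μ₂ : Mapping) : Prop :=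
  ∀ x s₁ s₂, μ₁ x = some s₁ → μ₂ x = some s₂ → s₁ = s₂

/-- The union of two mappings (used for compatible ones only). -/
def Mapping.union (μ₁ μ₂ : Mapping) : Mapping := fun x => (μ₁ x).or (μ₂ x)

/-- A schemaless spanner maps every document to a set of mappings. -/
abbrev Spanner (k : ℕ) : Type := List (Fin k) → Set Mapping

/-- The natural join of two schemaless spanners. -/
def Spanner.join {k : ℕ} (P₁ P₂ : Spanner k) : Spanner k := fun d =>
  {μ | ∃ μ₁ ∈ P₁ d, ∃ μ₂ ∈ P₂ d, μ₁.Compatible μ₂ ∧ μ = μ₁.union μ₂}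

/-! ### Variable-set automata -/

/-- Transition labels: `ε`, a letter, the opening `v⊢` or the closing `⊣v` of a variable. -/
inductive Label (k : ℕ) : Type where
  | eps : Label k
  | letter (a : Fin k) : Label k
  | opn (v : ℕ) : Label k
  | cls (v : ℕ) : Label k
  deriving DecidableEq

/-- A vset-automaton (VA). States are named by natural numbers; finite sets are presented by
lists, of which only the membership relation matters. -/
structure VA (k : ℕ) : Type where
  states : List ℕ
  init : ℕ
  accept : List ℕ
  trans : List (ℕ × Label k × ℕ)
  init_mem : init ∈ states
  accept_mem : ∀ q ∈ accept, q ∈ states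
  src_mem : ∀ t ∈ trans, t.1 ∈ states
  dst_mem : ∀ t ∈ trans, t.2.2 ∈ states

namespace VA

variable {k : ℕ}

/-- `Vars(A)`: the variables mentioned in some transition. -/
def vars (A : VA k) : Set ℕ :=
  {v | ∃ p q, (p, Label.opn v, q) ∈ A.trans ∨ (p, Label.cls v, q) ∈ A.trans}

/-- `A.Steps d p i ρ q j`: there is a sequence of transitions of `A` on the document `d` from
the configuration `(p, i)` to the configuration `(q, j)`; `ρ` lists, step by step, the label
of the step and the index that is reached by it. The letter at index `i` is `d[i - 1]`. -/
inductive Steps (A : VA k) (d : List (Fin k)) :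
    ℕ → ℕ → List (Label k × ℕ) → ℕ → ℕ → Prop where
  | refl (q i : ℕ) : Steps A d q i [] q i
  | eps {p q r i j : ℕ} {ρ : List (Label k × ℕ)} :
      (p, Label.eps, q) ∈ A.trans → Steps A d q i ρ r j →
      Steps A d p i ((Label.eps, i) :: ρ) r j
  | letter {p q r i j : ℕ} {ρ : List (Label k × ℕ)} {a : Fin k} :
      (p, Label.letter a, q) ∈ A.trans → d[i - 1]? = some a → Steps A d q (i + 1) ρ r j →
      Steps A d p i ((Label.letter a, i + 1) :: ρ) r j
  | opn {p q r i j v : ℕ} {ρ : List (Label k × ℕ)} :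
      (p, Label.opn v, q) ∈ A.trans → Steps A d q i ρ r j →
      Steps A d p i ((Label.opn v, i) :: ρ) r j
  | cls {p q r i j v : ℕ} {ρ : List (Label k × ℕ)} :
      (p, Label.cls v, q) ∈ A.trans → Steps A d q i ρ r j →
      Steps A d p i ((Label.cls v, i) :: ρ) r j

/-- Accepting runs on `d`: from `(q₀, 1)` to `(q, |d| + 1)` with `q` accepting. -/
def AcceptingRun (A : VA k) (d : List (Fin k)) (ρ : List (Label k × ℕ)) : Prop :=
  ∃ q ∈ A.accept, A.Steps d A.init 1 ρ q (d.length + 1)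

/-- Valid runs: every variable is opened at most once and closed at most once, each opening is
followed by a closing, and each closing is preceded by an opening. -/
def ValidRun (ρ : List (Label k × ℕ)) : Prop :=
  ∀ v : ℕ,
    (ρ.map Prod.fst).count (Label.opn v) ≤ 1 ∧
    (ρ.map Prod.fst).count (Label.cls v) ≤ 1 ∧
    (∀ i : ℕ, (ρ.map Prod.fst)[i]? = some (Label.opn v) →
      ∃ j : ℕ, i ≤ j ∧ (ρ.map Prod.fst)[j]? = some (Label.cls v)) ∧
    (∀ j : ℕ, (ρ.map Prod.fst)[j]? = some (Label.cls v) →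
      ∃ i : ℕ, i ≤ j ∧ (ρ.map Prod.fst)[i]? = some (Label.opn v))

/-- `μ` is the mapping `μ_ρ` of the run `ρ`: `v` is sent to `[i, j⟩` where `v` is opened at
index `i` and closed at index `j`. -/
def IsRunMapping (ρ : List (Label k × ℕ)) (μ : Mapping) : Prop :=
  ∀ v s, μ v = some s ↔ (Label.opn v, s.start) ∈ ρ ∧ (Label.cls v, s.finish) ∈ ρ

/-- The schemaless spanner represented by `A`. -/
def eval (A : VA k) : Spanner k := fun d =>
  {μ | ∃ ρ, A.AcceptingRun d ρ ∧ ValidRun ρ ∧ IsRunMapping ρ μ}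

/-- Functional VAs: every accepting run is valid and includes all variables of the VA. -/
def Functional (A : VA k) : Prop :=
  ∀ d ρ, A.AcceptingRun d ρ →
    ValidRun ρ ∧ ∀ v ∈ A.vars, Label.opn v ∈ ρ.map Prod.fst ∧ Label.cls v ∈ ρ.map Prod.fst

/-- `A` is the disjunction of the functional VAs in the list `C`, its functional components:
the state sets of the components are pairwise disjoint, the states of `A` are those of the
components and a new initial state, its accepting states are those of the components, and its
transitions are those of the components and epsilon transitions from the new initial state to
the initial states of the components. -/
structure HasComponents (A : VA k) (C : List (VA k)) : Prop where
  functional : ∀ B ∈ C, B.Functional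
  disjoint : C.Pairwise fun B B' => List.Disjoint B.states B'.states
  init_new : ∀ B ∈ C, A.init ∉ B.states
  states_iff : ∀ q, q ∈ A.states ↔ q = A.init ∨ ∃ B ∈ C, q ∈ B.states
  accept_iff : ∀ q, q ∈ A.accept ↔ ∃ B ∈ C, q ∈ B.accept
  trans_iff : ∀ t, t ∈ A.trans ↔
    (∃ B ∈ C, t ∈ B.trans) ∨ ∃ B ∈ C, t = (A.init, Label.eps, B.init)

/-- Disjunctive functional VAs. -/
def DisjunctiveFunctional (A : VA k) : Prop := ∃ C, A.HasComponents C

end VA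

/-! ### A machine model with time and output

Values are binary trees (S-expressions). Programs are those of a structured language in the
style of the WHILE language on trees: they transform one value, are built from the tree
operations by pairing, composition, branching and loops, and may write values to an output
stream. Every operation is charged the sizes of the trees it handles, so time is polynomially
related to that of multitape Turing machines. -/

/-- Binary trees. -/
inductive Val : Type where
  | nil : Val
  | cons (a b : Val) : Val
  deriving DecidableEq

namespace Val

/-- The number of nodes, leaves included. -/
def size : Val → ℕ
  | nil => 1
  | cons a b => a.size + b.size + 1

/-- Left subtree (`nil` for a leaf). -/
def hd : Val → Val
  | nil => nil
  | cons a _ => a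

/-- Right subtree (`nil` for a leaf). -/
def tl : Val → Val
  | nil => nil
  | cons _ b => b

/-- Truth values: `false` is `nil`. -/
def ofBool : Bool → Val
  | false => nil
  | true => cons nil nil

/-- Lists, given the encoding of their entries. -/
def ofList {α : Type} (f : α → Val) : List α → Val
  | [] => nil
  | a :: l => cons (f a) (ofList f l)

/-- Natural numbers, in binary, least significant bit first. -/
def ofNat (n : ℕ) : Val := ofList ofBool n.bits

/-- Documents. -/
def ofDoc {k : ℕ} (d : List (Fin k)) : Val := ofList (fun a => ofNat a.val) d

/-- Transition labels: a tag and an argument. -/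
def ofLabel {k : ℕ} : Label k → Val
  | Label.eps => cons (ofNat 0) nil
  | Label.letter a => cons (ofNat 1) (ofNat a.val)
  | Label.opn v => cons (ofNat 2) (ofNat v)
  | Label.cls v => cons (ofNat 3) (ofNat v)

/-- Transitions. -/
def ofTrans {k : ℕ} (t : ℕ × Label k × ℕ) : Val :=
  cons (ofNat t.1) (cons (ofLabel t.2.1) (ofNat t.2.2))

/-- Vset-automata. -/
def ofVA {k : ℕ} (A : VA k) : Val :=
  cons (ofList ofNat A.states)
    (cons (ofNat A.init) (cons (ofList ofNat A.accept) (ofList ofTrans A.trans)))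

/-- One entry `x ↦ [i, j⟩` of a mapping. -/
def ofEntry (e : ℕ × Span) : Val :=
  cons (ofNat e.1) (cons (ofNat e.2.start) (ofNat e.2.finish))

/-- The value `y` is a table of the mapping `μ`: a list, in any order and without repeated
variables, of the entries of `μ`. -/
def IsTableOf (y : Val) (μ : Mapping) : Prop :=
  ∃ l : List (ℕ × Span), (l.map Prod.fst).Nodup ∧
    (∀ x s, μ x = some s ↔ (x, s) ∈ l) ∧ y = ofList ofEntry l

end Val

/-- Programs. -/
inductive Prog : Type where
  /-- `x ↦ x` -/
  | skip : Prog
  /-- `x ↦ nil` -/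
  | nil : Prog
  /-- `x ↦ hd x` -/
  | hd : Prog
  /-- `x ↦ tl x` -/
  | tl : Prog
  /-- `x ↦` whether the two subtrees of `x` are equal -/
  | eq : Prog
  /-- write `x` to the output stream and keep it -/
  | emit : Prog
  /-- `x ↦ cons (f x) (g x)`, with `f` executed first -/
  | pair (f g : Prog) : Prog
  /-- first `f`, then `g` on the result -/
  | seq (f g : Prog) : Prog
  /-- if `c x ≠ nil` then `f x` else `g x` -/
  | ite (c f g : Prog) : Prog
  /-- while `c x ≠ nil` do `x := f x` -/
  | loop (c f : Prog) : Prog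

/-- What is observed of an execution: time that passes, and values that are output. -/
inductive Event : Type where
  | tick (n : ℕ) : Event
  | out (y : Val) : Event

/-- The total time of a sequence of events. -/
def Event.time : List Event → ℕ
  | [] => 0
  | Event.tick n :: w => n + Event.time w
  | Event.out _ :: w => Event.time w

/-- The values that are output, in their order. -/
def Event.outputs : List Event → List Val
  | [] => []
  | Event.tick _ :: w => Event.outputs w
  | Event.out y :: w => y :: Event.outputs w

/-- The delay is at most `b`: between any two consecutive outputs, before the first output and
after the last one, at most `b` time units pass. That is, every contiguous part of the
execution without output takes at most `b` time units. -/
def Event.DelayAtMost (b : ℕ) (w : List Event) : Prop :=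
  ∀ u, u <:+: w → Event.outputs u = [] → Event.time u ≤ b

/-- `Prog.Run P x w y`: the program `P` started on `x` halts with result `y`, and its execution
is the sequence of events `w`. -/
inductive Prog.Run : Prog → Val → List Event → Val → Prop where
  | skip (x : Val) : Run Prog.skip x [Event.tick x.size] x
  | nil (x : Val) : Run Prog.nil x [Event.tick x.size] Val.nil
  | hd (x : Val) : Run Prog.hd x [Event.tick x.size] x.hd
  | tl (x : Val) : Run Prog.tl x [Event.tick x.size] x.tl
  | eq (x : Val) :
      Run Prog.eq x [Event.tick (x.size + 2)] (Val.ofBool (decide (x.hd = x.tl)))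
  | emit (x : Val) : Run Prog.emit x [Event.tick x.size, Event.out x, Event.tick x.size] x
  | pair {f g : Prog} {x a b : Val} {u v : List Event} :
      Run f x u a → Run g x v b →
      Run (Prog.pair f g) x
        (Event.tick x.size :: (u ++ Event.tick a.size :: (v ++ [Event.tick (a.size + b.size)])))
        (Val.cons a b)
  | seq {f g : Prog} {x y z : Val} {u v : List Event} :
      Run f x u y → Run g y v z → Run (Prog.seq f g) x (u ++ v) z
  | ite_true {c f g : Prog} {x t y : Val} {u v : List Event} :
      Run c x u t → t ≠ Val.nil → Run f x v y →
      Run (Prog.ite c f g) x (Event.tick x.size :: (u ++ v)) y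
  | ite_false {c f g : Prog} {x y : Val} {u v : List Event} :
      Run c x u Val.nil → Run g x v y →
      Run (Prog.ite c f g) x (Event.tick x.size :: (u ++ v)) y
  | loop_stop {c f : Prog} {x : Val} {u : List Event} :
      Run c x u Val.nil →
      Run (Prog.loop c f) x (Event.tick x.size :: (u ++ [Event.tick x.size])) x
  | loop_step {c f : Prog} {x t y z : Val} {u v w : List Event} :
      Run c x u t → t ≠ Val.nil → Run f x v y → Run (Prog.loop c f) y w z →
      Run (Prog.loop c f) x (Event.tick x.size :: (u ++ v ++ w)) z

/-- Executions are deterministic. -/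
theorem Prog.Run.deterministic {P : Prog} {x : Val} {w : List Event} {y : Val}
    (h : Prog.Run P x w y) : ∀ {w' : List Event} {y' : Val}, Prog.Run P x w' y' →
      w = w' ∧ y = y' := by
  induction h with
  | skip | nil | hd | tl | eq | emit => intro w' y' h'; cases h'; exact ⟨rfl, rfl⟩
  | pair _ _ ih₁ ih₂ =>
    intro w' y' h'
    cases h' with
    | pair h₁ h₂ =>
      obtain ⟨rfl, rfl⟩ := ih₁ h₁
      obtain ⟨rfl, rfl⟩ := ih₂ h₂
      exact ⟨rfl, rfl⟩
  | seq _ _ ih₁ ih₂ =>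
    intro w' y' h'
    cases h' with
    | seq h₁ h₂ =>
      obtain ⟨rfl, rfl⟩ := ih₁ h₁
      obtain ⟨rfl, rfl⟩ := ih₂ h₂
      exact ⟨rfl, rfl⟩
  | ite_true _ ht _ ih₁ ih₂ =>
    intro w' y' h'
    cases h' with
    | ite_true h₁ _ h₂ =>
      obtain ⟨rfl, rfl⟩ := ih₁ h₁
      obtain ⟨rfl, rfl⟩ := ih₂ h₂
      exact ⟨rfl, rfl⟩
    | ite_false h₁ _ => exact absurd (ih₁ h₁).2 ht
  | ite_false _ _ ih₁ ih₂ =>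
    intro w' y' h'
    cases h' with
    | ite_true h₁ ht _ => exact absurd (ih₁ h₁).2.symm ht
    | ite_false h₁ h₂ =>
      obtain ⟨rfl, -⟩ := ih₁ h₁
      obtain ⟨rfl, rfl⟩ := ih₂ h₂
      exact ⟨rfl, rfl⟩
  | loop_stop _ ih₁ =>
    intro w' y' h'
    cases h' with
    | loop_stop h₁ =>
      obtain ⟨rfl, -⟩ := ih₁ h₁
      exact ⟨rfl, rfl⟩
    | loop_step h₁ ht _ _ => exact absurd (ih₁ h₁).2.symm ht
  | loop_step _ ht _ _ ih₁ ih₂ ih₃ =>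
    intro w' y' h'
    cases h' with
    | loop_stop h₁ => exact absurd (ih₁ h₁).2 ht
    | loop_step h₁ _ h₂ h₃ =>
      obtain ⟨rfl, rfl⟩ := ih₁ h₁
      obtain ⟨rfl, rfl⟩ := ih₂ h₂
      obtain ⟨rfl, rfl⟩ := ih₃ h₃
      exact ⟨rfl, rfl⟩

/-- The values `ys` list the mappings in `M`, one by one and without duplicates. -/
def ListsMappings (ys : List Val) (M : Set Mapping) : Prop :=
  ∃ ms : List Mapping, ms.Nodup ∧ (∀ μ, μ ∈ ms ↔ μ ∈ M) ∧ List.Forall₂ Val.IsTableOf ys ms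

/-! ### Silent computations and their cost -/

/-! In a functional automaton whose states are all reachable from the initial one, which operations
have been performed at a state of an accepting path depends on the state alone. Every labelled
operation occurs exactly once on each accepting path, so another path spliced in up to that state
can neither repeat nor omit one (`Functional.done_iff_notMem`). Hence the join of two such automata
needs only a product of their state sets. Transitions without a letter are taken independently,
while letters are read jointly and only at pairs of states that have done the same common
operations. A common operation then falls between the same two letters in both runs, that is, at the
same index, which is exactly compatibility; the order inside such a block plays no role. The common
operations of the second factor are made silent, which keeps the product functional. Soundness is
`prod_steps_sound` with `Synchronized.index_eq`, completeness is `prod_steps_complete`, and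
`prod_eval` combines them.

Join distributes over union, so two disjunctive automata are joined by the disjunction of the
pairwise products. The decomposition is not part of the input. A component is replaced by the part
of the automaton reachable from the component's initial state; this part can be computed, has the
same accepting runs (`HasComponents.sub_acceptingRun`) and is trim.

For the enumeration, a mapping is identified with the set of pairs (operation, index) of its runs.
The pairs are decided one after the other, and a branch is entered only if some product still has an
accepting run below it. By functionality this test is mere reachability between configurations
(`hasExtension_iff`): a run confined to admissible pairs cannot miss a chosen one. Leaves are
distinct sets of pairs and the test covers all components at once, so nothing is output twice. The
depth-first stack is never deeper than the number of pairs allows, which bounds each round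
polynomially (`exists_prog_enumerate`).

Running times come from closure properties of `PolyTime`, above all closure under folds with a
polynomially bounded accumulator (`PolyTime.foldl`). List operations, saturation of reachable sets
and arithmetic on positions are all such folds. -/

namespace Event

@[simp] theorem time_nil : time [] = 0 := rfl

@[simp] theorem time_tick (n : ℕ) (w : List Event) : time (tick n :: w) = n + time w := rfl

@[simp] theorem time_out (y : Val) (w : List Event) : time (out y :: w) = time w := rfl

@[simp] theorem outputs_nil : outputs [] = [] := rfl

@[simp] theorem outputs_tick (n : ℕ) (w : List Event) :
    outputs (tick n :: w) = outputs w := rfl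

@[simp] theorem outputs_out (y : Val) (w : List Event) :
    outputs (out y :: w) = y :: outputs w := rfl

@[simp] theorem time_append (u v : List Event) : time (u ++ v) = time u + time v := by
  induction u with
  | nil => simp
  | cons e u ih => cases e <;> simp [ih, add_assoc]

@[simp] theorem outputs_append (u v : List Event) :
    outputs (u ++ v) = outputs u ++ outputs v := by
  induction u with
  | nil => simp
  | cons e u ih => cases e <;> simp [ih]

end Event

theorem Polynomial.eval_le_eval_nat (p : Polynomial ℕ) {m n : ℕ} (h : m ≤ n) :
    p.eval m ≤ p.eval n := by
  simp only [Polynomial.eval_eq_sum_range]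
  gcongr

@[simp] theorem Val.size_nil : Val.nil.size = 1 := rfl

theorem Val.one_le_size (x : Val) : 1 ≤ x.size := by
  cases x <;> simp [Val.size]

theorem Val.hd_size_le (x : Val) : x.hd.size ≤ x.size := by
  cases x
  · simp [Val.hd]
  · simp [Val.size, Val.hd]; omega

theorem Val.tl_size_le (x : Val) : x.tl.size ≤ x.size := by
  cases x
  · simp [Val.tl]
  · simp [Val.size, Val.tl]; omega

/-- Each operation is charged at least the size of what it produces. A time bound is therefore also
a size bound, so that composing programs needs no separate control of intermediate sizes. -/
theorem Prog.Run.size_le {P : Prog} {x y : Val} {w : List Event} (h : P.Run x w y) :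
    y.size ≤ Event.time w := by
  induction h with
  | skip | emit => simp
  | nil x => simpa [Val.size] using x.one_le_size
  | hd x => simpa using x.hd_size_le
  | tl x => simpa using x.tl_size_le
  | eq x =>
    have := x.one_le_size
    by_cases hx : x.hd = x.tl <;> simp [hx, Val.ofBool, Val.size, this]
  | @pair _ _ x => have := x.one_le_size; simp [Val.size] at *; omega
  | loop_stop => simp
  | seq | ite_true | ite_false | loop_step => simp at *; omega

/-- `P` turns `x` into `y` without output in time at most `t`. -/
def Computes (P : Prog) (x y : Val) (t : ℕ) : Prop :=
  ∃ w, P.Run x w y ∧ Event.outputs w = [] ∧ Event.time w ≤ t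

namespace Computes

variable {P Q R : Prog} {x y z a b : Val} {s t u : ℕ}

theorem mono (h : Computes P x y s) (hst : s ≤ t) : Computes P x y t :=
  let ⟨w, h₁, h₂, h₃⟩ := h
  ⟨w, h₁, h₂, h₃.trans hst⟩

theorem size_le (h : Computes P x y s) : y.size ≤ s :=
  let ⟨_, h₁, _, h₃⟩ := h
  h₁.size_le.trans h₃

theorem skip : Computes Prog.skip x x x.size := ⟨_, .skip x, rfl, by simp⟩

theorem nil : Computes Prog.nil x Val.nil x.size := ⟨_, .nil x, rfl, by simp⟩

theorem hd : Computes Prog.hd x x.hd x.size := ⟨_, .hd x, rfl, by simp⟩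

theorem tl : Computes Prog.tl x x.tl x.size := ⟨_, .tl x, rfl, by simp⟩

theorem eq : Computes Prog.eq x (Val.ofBool (decide (x.hd = x.tl))) (x.size + 2) :=
  ⟨_, .eq x, rfl, by simp⟩

theorem seq (h₁ : Computes P x y s) (h₂ : Computes Q y z t) :
    Computes (Prog.seq P Q) x z (s + t) := by
  obtain ⟨w₁, r₁, o₁, t₁⟩ := h₁
  obtain ⟨w₂, r₂, o₂, t₂⟩ := h₂
  exact ⟨_, .seq r₁ r₂, by simp [o₁, o₂], by simp; omega⟩

/-- The first result is charged when it is stored and again when the pair is built, the second only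
in the latter; each is no larger than the time that produced it. This gives the factors 3 and 2. -/
theorem pair (h₁ : Computes P x a s) (h₂ : Computes Q x b t) :
    Computes (Prog.pair P Q) x (Val.cons a b) (x.size + 3 * s + 2 * t) := by
  have ha := h₁.size_le
  have hb := h₂.size_le
  obtain ⟨w₁, r₁, o₁, t₁⟩ := h₁
  obtain ⟨w₂, r₂, o₂, t₂⟩ := h₂
  exact ⟨_, .pair r₁ r₂, by simp [o₁, o₂], by simp; omega⟩

theorem ite_true (h₁ : Computes P x a s) (ha : a ≠ Val.nil) (h₂ : Computes Q x y t) :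
    Computes (Prog.ite P Q R) x y (x.size + s + t) := by
  obtain ⟨w₁, r₁, o₁, t₁⟩ := h₁
  obtain ⟨w₂, r₂, o₂, t₂⟩ := h₂
  exact ⟨_, .ite_true r₁ ha r₂, by simp [o₁, o₂], by simp; omega⟩

theorem ite_false (h₁ : Computes P x Val.nil s) (h₂ : Computes R x y t) :
    Computes (Prog.ite P Q R) x y (x.size + s + t) := by
  obtain ⟨w₁, r₁, o₁, t₁⟩ := h₁
  obtain ⟨w₂, r₂, o₂, t₂⟩ := h₂
  exact ⟨_, .ite_false r₁ r₂, by simp [o₁, o₂], by simp; omega⟩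

/-- A loop that goes through the values `X 0, …, X n`. -/
theorem loop (X : ℕ → Val) (n : ℕ)
    (hc : ∀ i < n, ∃ a, a ≠ Val.nil ∧ Computes P (X i) a t)
    (hf : ∀ i < n, Computes Q (X i) (X (i + 1)) t)
    (hn : Computes P (X n) Val.nil t) (hs : ∀ i ≤ n, (X i).size ≤ t) :
    Computes (Prog.loop P Q) (X 0) (X n) ((n + 1) * (3 * t)) := by
  induction n generalizing X with
  | zero =>
    obtain ⟨w, r, o, ht⟩ := hn
    have := hs 0 le_rfl
    exact ⟨_, Prog.Run.loop_stop r, by simp [o], by simp; omega⟩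
  | succ n ih =>
    obtain ⟨w₃, r₃, o₃, t₃⟩ := ih (fun i => X (i + 1))
      (fun i hi => hc (i + 1) (by omega)) (fun i hi => hf (i + 1) (by omega)) hn
      (fun i hi => hs (i + 1) (by omega))
    obtain ⟨a, ha, w₁, r₁, o₁, t₁⟩ := hc 0 (by omega)
    obtain ⟨w₂, r₂, o₂, t₂⟩ := hf 0 (by omega)
    have h0 := hs 0 (by omega)
    refine ⟨_, .loop_step r₁ ha r₂ r₃, by simp [o₁, o₂, o₃], ?_⟩
    -- A round costs the size of the value, the test and the body, hence at most `3 * t`; the final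
    -- failed test fits the same bound.
    simp only [Event.time_tick, Event.time_append]
    linarith

end Computes

/-! ### Functions computable in polynomial time -/

/-- Encodings of the elements of a type by trees. -/
class Enc (α : Type) where
  enc : α → Val
  enc_injective : Function.Injective enc

open Enc

namespace Val

theorem ofBool_injective : Function.Injective ofBool := by
  intro a b h
  cases a <;> cases b <;> simp_all [ofBool]

theorem ofList_injective {α : Type} {f : α → Val} (hf : Function.Injective f) :
    Function.Injective (ofList f) := by
  intro l
  induction l with
  | nil => intro l' h; cases l' <;> simp_all [ofList]
  | cons a l ih =>
    intro l' h
    cases l' with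
    | nil => simp [ofList] at h
    | cons b l' =>
      simp only [ofList, cons.injEq] at h
      rw [hf h.1, ih h.2]

theorem ofNat_injective : Function.Injective ofNat := by
  intro m n h
  have h := ofList_injective ofBool_injective h
  apply Nat.eq_of_testBit_eq
  intro i
  rw [Nat.testBit_eq_inth, Nat.testBit_eq_inth, h]

theorem ofLabel_injective {k : ℕ} : Function.Injective (ofLabel (k := k)) := by
  intro a b h
  cases a <;> cases b <;> simp only [ofLabel, cons.injEq] at h <;>
    first
    | rfl
    | (have h := ofNat_injective h.1; omega)
    | (have h := ofNat_injective h.2; first | rw [h] | rw [Fin.ext h])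

end Val

instance : Enc Bool := ⟨Val.ofBool, Val.ofBool_injective⟩

instance : Enc ℕ := ⟨Val.ofNat, Val.ofNat_injective⟩

instance {k : ℕ} : Enc (Fin k) :=
  ⟨fun a => Val.ofNat a.val, Val.ofNat_injective.comp Fin.val_injective⟩

instance {k : ℕ} : Enc (Label k) := ⟨Val.ofLabel, Val.ofLabel_injective⟩

instance {α : Type} [Enc α] : Enc (List α) :=
  ⟨Val.ofList enc, Val.ofList_injective enc_injective⟩

instance {α β : Type} [Enc α] [Enc β] : Enc (α × β) :=
  ⟨fun x => Val.cons (enc x.1) (enc x.2), fun x y h => by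
    simp only [Val.cons.injEq] at h
    exact Prod.ext (enc_injective h.1) (enc_injective h.2)⟩

/-- The size of the encoding. -/
def encSize {α : Type} [Enc α] (a : α) : ℕ := (enc a : Val).size

/-- `f` is computed in polynomial time. -/
def PolyTime {α β : Type} [Enc α] [Enc β] (f : α → β) : Prop :=
  ∃ (P : Prog) (p : Polynomial ℕ), ∀ a, Computes P (enc a) (enc (f a)) (p.eval (encSize a))

theorem size_enc {α : Type} [Enc α] (a : α) : (enc a : Val).size = encSize a := rfl

section Calculus

variable {α β γ δ : Type} [Enc α] [Enc β] [Enc γ] [Enc δ]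

theorem one_le_encSize (a : α) : 1 ≤ encSize a := Val.one_le_size _

@[simp] theorem encSize_pair (a : α) (b : β) :
    encSize (a, b) = encSize a + encSize b + 1 := rfl

@[simp] theorem encSize_nil : encSize ([] : List α) = 1 := rfl

@[simp] theorem encSize_cons (a : α) (l : List α) :
    encSize (a :: l) = encSize a + encSize l + 1 := rfl

theorem encSize_append (l m : List α) : encSize (l ++ m) + 1 = encSize l + encSize m := by
  induction l with
  | nil => simp; omega
  | cons a l ih => simp; omega

theorem length_lt_encSize (l : List α) : l.length < encSize l := by
  induction l with
  | nil => simp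
  | cons a l ih => simp; omega

theorem encSize_lt_of_mem {a : α} {l : List α} (h : a ∈ l) : encSize a < encSize l := by
  induction l with
  | nil => simp at h
  | cons b l ih =>
    have := one_le_encSize b
    rcases List.mem_cons.1 h with rfl | h
    · simp
    · have := ih h; simp; omega

theorem encSize_sublist {l m : List α} (h : l.Sublist m) : encSize l ≤ encSize m := by
  induction h with
  | slnil => simp
  | cons a _ ih => simp; omega
  | cons_cons a _ ih => simp; omega

theorem encSize_le_length_mul {l : List α} {n : ℕ} (h : ∀ a ∈ l, encSize a ≤ n) :
    encSize l ≤ l.length * (n + 1) + 1 := by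
  induction l with
  | nil => simp
  | cons a l ih =>
    have h₁ := h a (by simp)
    have h₂ := ih fun b hb => h b (by simp [hb])
    simp only [encSize_cons, List.length_cons]
    linarith

@[simp] theorem encSize_reverse (l : List α) : encSize l.reverse = encSize l := by
  induction l with
  | nil => simp
  | cons a l ih =>
    have := encSize_append l.reverse [a]
    simp at *; omega

namespace PolyTime

theorem exists_encSize_le {f : α → β} (hf : PolyTime f) :
    ∃ p : Polynomial ℕ, ∀ a, encSize (f a) ≤ p.eval (encSize a) :=
  let ⟨_, p, h⟩ := hf
  ⟨p, fun a => (h a).size_le⟩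

/-- A function with the same encoded values. -/
theorem of_enc_eq {f : α → β} {g : α → γ} (hf : PolyTime f)
    (h : ∀ a, (enc (f a) : Val) = enc (g a)) : PolyTime g :=
  let ⟨P, p, hP⟩ := hf
  ⟨P, p, fun a => h a ▸ hP a⟩

theorem id : PolyTime (fun a : α => a) :=
  ⟨Prog.skip, Polynomial.X, fun a => by
    rw [Polynomial.eval_X]
    exact Computes.skip⟩

theorem comp {g : β → γ} {f : α → β} (hg : PolyTime g) (hf : PolyTime f) :
    PolyTime (fun a => g (f a)) := by
  obtain ⟨P, p, hP⟩ := hf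
  obtain ⟨Q, q, hQ⟩ := hg
  refine ⟨.seq P Q, p + q.comp p, fun a => ((hP a).seq (hQ _)).mono ?_⟩
  simp only [Polynomial.eval_add, Polynomial.eval_comp]
  gcongr
  exact q.eval_le_eval_nat (hP a).size_le

theorem pair {f : α → β} {g : α → γ} (hf : PolyTime f) (hg : PolyTime g) :
    PolyTime (fun a => (f a, g a)) := by
  obtain ⟨P, p, hP⟩ := hf
  obtain ⟨Q, q, hQ⟩ := hg
  exact ⟨.pair P Q, Polynomial.X + 3 * p + 2 * q, fun a =>
    ((hP a).pair (hQ a)).mono (by simp [encSize])⟩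

theorem fst {f : α → β × γ} (hf : PolyTime f) : PolyTime (fun a => (f a).1) :=
  comp (g := Prod.fst) ⟨.hd, Polynomial.X, fun _ => by
    rw [Polynomial.eval_X]
    exact Computes.hd⟩ hf

theorem snd {f : α → β × γ} (hf : PolyTime f) : PolyTime (fun a => (f a).2) :=
  comp (g := Prod.snd) ⟨.tl, Polynomial.X, fun _ => by
    rw [Polynomial.eval_X]
    exact Computes.tl⟩ hf

theorem const (b : β) : PolyTime (fun _ : α => b) := by
  -- The induction is over the output tree, whose subtrees need not encode elements of `β`.
  suffices h : ∀ y : Val, ∃ (P : Prog) (p : Polynomial ℕ), ∀ a : α,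
      Computes P (enc a) y (p.eval (encSize a)) by
    obtain ⟨P, p, h⟩ := h (enc b)
    exact ⟨P, p, h⟩
  intro y
  induction y with
  | nil => exact ⟨.nil, Polynomial.X, fun a => by
    rw [Polynomial.eval_X]
    exact Computes.nil⟩
  | cons u v hu hv =>
    obtain ⟨P, p, hP⟩ := hu
    obtain ⟨Q, q, hQ⟩ := hv
    exact ⟨.pair P Q, Polynomial.X + 3 * p + 2 * q, fun a =>
      ((hP a).pair (hQ a)).mono (by simp [encSize])⟩

/-- The machine compares trees, and injectivity of the encoding turns this into comparison of
values. -/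
theorem eq [DecidableEq β] {f g : α → β} (hf : PolyTime f) (hg : PolyTime g) :
    PolyTime (fun a => decide (f a = g a)) := by
  refine comp (g := fun x : β × β => decide (x.1 = x.2)) ?_ (hf.pair hg)
  refine ⟨.eq, Polynomial.X + 2, fun x => ?_⟩
  have h := Computes.eq (x := enc x)
  have e : ((enc x : Val).hd = (enc x : Val).tl) ↔ x.1 = x.2 :=
    ⟨fun h => enc_injective h, fun h => congrArg enc h⟩
  simp only [e, size_enc] at h
  simp only [Polynomial.eval_add, Polynomial.eval_X, Polynomial.eval_ofNat]
  exact h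

theorem ite {c : α → Bool} {f g : α → β} (hc : PolyTime c) (hf : PolyTime f)
    (hg : PolyTime g) : PolyTime (fun a => if c a then f a else g a) := by
  obtain ⟨C, r, hC⟩ := hc
  obtain ⟨P, p, hP⟩ := hf
  obtain ⟨Q, q, hQ⟩ := hg
  refine ⟨.ite C P Q, Polynomial.X + r + p + q, fun a => ?_⟩
  have h := hC a
  cases hca : c a <;> rw [hca] at h <;> simp only [hca, Bool.false_eq_true, if_true, if_false]
  · refine (Computes.ite_false h (hQ a)).mono ?_
    simp [size_enc]
  · refine (Computes.ite_true h (by simp [enc, Val.ofBool]) (hP a)).mono ?_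
    simp [size_enc]

theorem and {c d : α → Bool} (hc : PolyTime c) (hd : PolyTime d) :
    PolyTime (fun a => c a && d a) := by
  refine (hc.ite hd (const false)).of_enc_eq fun a => ?_
  cases c a <;> rfl

theorem or {c d : α → Bool} (hc : PolyTime c) (hd : PolyTime d) :
    PolyTime (fun a => c a || d a) := by
  refine (hc.ite (const true) hd).of_enc_eq fun a => ?_
  cases c a <;> rfl

theorem not {c : α → Bool} (hc : PolyTime c) : PolyTime (fun a => !(c a)) := by
  refine (hc.ite (const false) (const true)).of_enc_eq fun a => ?_
  cases c a <;> rfl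

theorem cons {f : α → β} {l : α → List β} (hf : PolyTime f) (hl : PolyTime l) :
    PolyTime (fun a => f a :: l a) :=
  (hf.pair hl).of_enc_eq fun _ => rfl

theorem isEmpty {l : α → List β} (hl : PolyTime l) : PolyTime (fun a => (l a).isEmpty) := by
  refine comp (g := List.isEmpty) ?_ hl
  have h : PolyTime (fun _ : List β => true) := const true
  have h' : PolyTime (fun _ : List β => false) := const false
  obtain ⟨P, p, hP⟩ := h
  obtain ⟨Q, q, hQ⟩ := h'
  refine ⟨.ite .skip Q P, Polynomial.X + Polynomial.X + p + q, fun l => ?_⟩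
  cases l with
  | nil =>
    refine (Computes.ite_false Computes.skip (hP [])).mono ?_
    simp
  | cons b l =>
    refine (Computes.ite_true Computes.skip (by simp [enc, Val.ofList]) (hQ (b :: l))).mono ?_
    simp [size_enc]

theorem tail {l : α → List β} (hl : PolyTime l) : PolyTime (fun a => (l a).tail) := by
  refine comp (g := List.tail) ⟨.tl, Polynomial.X, fun l => ?_⟩ hl
  have := Computes.tl (x := enc l)
  rw [size_enc] at this
  rw [Polynomial.eval_X]
  cases l <;> exact this

/-- A default is needed because the left subtree of an empty list is a leaf, which need not encode
an element. -/
theorem headD {l : α → List β} (b : β) (hl : PolyTime l) :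
    PolyTime (fun a => (l a).headD b) := by
  refine comp (g := fun l : List β => l.headD b) ?_ hl
  have h : PolyTime (fun _ : List β => b) := const b
  obtain ⟨P, p, hP⟩ := h
  refine ⟨.ite .skip .hd P, Polynomial.X + Polynomial.X + Polynomial.X + p, fun l => ?_⟩
  cases l with
  | nil =>
    refine (Computes.ite_false Computes.skip (hP [])).mono ?_
    simp
  | cons b l =>
    refine (Computes.ite_true Computes.skip (by simp [enc, Val.ofList]) .hd).mono ?_
    simp [size_enc]

/-- Folding over a list, the accumulator being of polynomial size. -/
theorem foldl {L : α → List β} {s : α → γ} {f : α → γ → β → γ} (hL : PolyTime L)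
    (hs : PolyTime s) (hf : PolyTime (fun x : α × γ × β => f x.1 x.2.1 x.2.2))
    (q : Polynomial ℕ)
    (hq : ∀ a l, l <+: L a → encSize (l.foldl (f a) (s a)) ≤ q.eval (encSize a)) :
    PolyTime (fun a => (L a).foldl (f a) (s a)) := by
  obtain ⟨p₀, hp₀⟩ := hL.exists_encSize_le
  have hst : PolyTime (fun a => (a, s a, L a)) := id.pair (hs.pair hL)
  obtain ⟨P, p, hP⟩ := hst
  obtain ⟨F, r, hF⟩ := hf
  -- The loop state is the triple of input, accumulator and remaining entries. `C` extracts the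
  -- last, so as a test it fails exactly when the list is used up; `G` processes one entry.
  let C : Prog := .seq .tl .tl
  let G : Prog := .pair .hd (.pair
    (.seq (.pair .hd (.pair (.seq .tl .hd) (.seq C .hd))) F) (.seq C .tl))
  -- `m` bounds the size of every loop state and `T` the cost of any test or body; 1000 is generous
  -- slack.
  let m : Polynomial ℕ := Polynomial.X + q + p₀ + 2
  let T : Polynomial ℕ := 1000 * (m + r.comp m)
  refine ⟨.seq P (.seq (.loop C G) (.seq .tl .hd)), p + (p₀ + 1) * (3 * T) + 2 * T,
    fun a => ?_⟩
  let st : ℕ → α × γ × List β := fun i => (a, ((L a).take i).foldl (f a) (s a), (L a).drop i)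
  have hm : m.eval (encSize a) = encSize a + q.eval (encSize a) + p₀.eval (encSize a) + 2 := by
    simp [m]
  have hT : T.eval (encSize a) =
      1000 * (m.eval (encSize a) + r.eval (m.eval (encSize a))) := by simp [T]
  have hsz : ∀ i, encSize (st i) ≤ m.eval (encSize a) := fun i => by
    have h₁ := hq a ((L a).take i) (List.take_prefix _ _)
    have h₂ := (encSize_sublist (List.drop_sublist i (L a))).trans (hp₀ a)
    rw [hm]
    simp only [st, encSize_pair]
    omega
  have hC : ∀ i, Computes C (enc (st i)) (enc ((L a).drop i)) (2 * m.eval (encSize a)) :=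
    fun i => by
      refine (Computes.tl.seq Computes.tl).mono ?_
      have h₁ := hsz i
      have h₂ := (enc (st i) : Val).tl_size_le
      rw [size_enc] at h₂ ⊢
      omega
  have hloop := Computes.loop (P := C) (Q := G) (t := T.eval (encSize a))
    (fun i => enc (st i)) (L a).length ?_ ?_ ?_ ?_
  rotate_left
  · intro i hi
    refine ⟨_, ?_, (hC i).mono (by omega)⟩
    rw [List.drop_eq_getElem_cons hi]
    simp [enc, Val.ofList]
  · intro i hi
    have e₁ : (L a).drop i = (L a)[i] :: (L a).drop (i + 1) := List.drop_eq_getElem_cons hi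
    have e₂ : st (i + 1) = (a, f a (((L a).take i).foldl (f a) (s a)) (L a)[i],
        (L a).drop (i + 1)) := by
      simp only [st, List.take_succ_eq_append_getElem hi, List.foldl_append, List.foldl_cons,
        List.foldl_nil]
    have hi' := hsz i
    have hn : (enc (st i) : Val).tl.size ≤ m.eval (encSize a) :=
      (Val.tl_size_le _).trans hi'
    have hb : encSize (a, ((L a).take i).foldl (f a) (s a), (L a)[i]) ≤ m.eval (encSize a) := by
      refine le_trans ?_ hi'
      simp only [st, e₁, encSize_pair, encSize_cons]
      omega
    have hd₁ : encSize ((L a).drop i) ≤ m.eval (encSize a) := by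
      refine le_trans ?_ hi'
      simp only [st, encSize_pair]
      omega
    have hc₁ : Computes (.seq C .hd) (enc (st i)) (enc (L a)[i]) (3 * m.eval (encSize a)) := by
      have h := (hC i).seq (Computes.hd)
      rw [e₁] at h
      rw [e₁] at hd₁
      exact h.mono (by rw [size_enc]; omega)
    have hc₂ : Computes (.seq C .tl) (enc (st i)) (enc ((L a).drop (i + 1)))
        (3 * m.eval (encSize a)) := by
      have h := (hC i).seq (Computes.tl)
      rw [e₁] at h
      rw [e₁] at hd₁
      exact h.mono (by rw [size_enc]; omega)
    have hc₃ : Computes (.seq .tl .hd) (enc (st i)) (enc (((L a).take i).foldl (f a) (s a)))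
        (2 * m.eval (encSize a)) := by
      refine (Computes.tl.seq Computes.hd).mono ?_
      simp only [size_enc]
      have := (enc (st i) : Val).tl_size_le
      rw [size_enc] at this
      omega
    have hc₄ : Computes .hd (enc (st i)) (enc a) (m.eval (encSize a)) :=
      Computes.hd.mono hi'
    have hc₅ := (hc₄.pair (hc₃.pair hc₁)).seq
      (hF (a, ((L a).take i).foldl (f a) (s a), (L a)[i]))
    have hc₆ := hc₄.pair (hc₅.pair hc₂)
    rw [e₂]
    refine hc₆.mono ?_
    have := r.eval_le_eval_nat hb
    simp only [size_enc, hT]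
    omega
  · have h := hC (L a).length
    rw [List.drop_length] at h
    exact h.mono (by omega)
  · intro i _
    have := hsz i
    simp only [size_enc, hT]
    omega
  have h₀ : st 0 = (a, s a, L a) := by simp [st]
  have h₁ : (enc (st (L a).length) : Val).tl.hd = enc ((L a).foldl (f a) (s a)) := by
    simp [st, enc, Val.hd, Val.tl]
  have hfin := (hP a).seq (h₀ ▸ hloop |>.seq (Computes.tl.seq Computes.hd))
  rw [h₁] at hfin
  refine hfin.mono ?_
  have h₂ := hsz (L a).length
  have h₃ := (enc (st (L a).length) : Val).tl_size_le
  have h₄ := hp₀ a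
  have h₅ := length_lt_encSize (L a)
  have h₆ : ((L a).length + 1) * (3 * T.eval (encSize a)) ≤
      (p₀.eval (encSize a) + 1) * (3 * T.eval (encSize a)) := by
    gcongr
    omega
  simp only [Polynomial.eval_add, Polynomial.eval_mul, Polynomial.eval_one,
    Polynomial.eval_ofNat]
  simp only [size_enc] at h₃ ⊢
  omega

end PolyTime

end Calculus

/-! ### Polynomial-time operations on lists -/

section Lists

variable {α β γ δ : Type} [Enc α] [Enc β] [Enc γ] [Enc δ]

namespace PolyTime

/-- Folding over a list when every step makes the accumulator grow by a polynomial amount. -/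
theorem foldl_of_growth {L : α → List β} {s : α → γ} {f : α → γ → β → γ} (hL : PolyTime L)
    (hs : PolyTime s) (hf : PolyTime (fun x : α × γ × β => f x.1 x.2.1 x.2.2))
    (g : Polynomial ℕ)
    (hg : ∀ a, ∀ b ∈ L a, ∀ c, encSize (f a c b) ≤ encSize c + g.eval (encSize a)) :
    PolyTime (fun a => (L a).foldl (f a) (s a)) := by
  obtain ⟨p, hp⟩ := hL.exists_encSize_le
  obtain ⟨r, hr⟩ := hs.exists_encSize_le
  refine foldl hL hs hf (r + p * g) fun a l hl => ?_
  have key : ∀ l : List β, (∀ b ∈ l, b ∈ L a) → ∀ c,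
      encSize (l.foldl (f a) c) ≤ encSize c + l.length * g.eval (encSize a) := by
    intro l
    induction l with
    | nil => intro _ c; simp
    | cons b l ih =>
      intro h c
      have h₁ := ih (fun b hb => h b (by simp [hb])) (f a c b)
      have h₂ := hg a b (h b (by simp)) c
      simp only [List.foldl_cons, List.length_cons]
      linarith
  have h₁ := key l (fun b hb => hl.subset hb) (s a)
  have h₂ : l.length ≤ p.eval (encSize a) :=
    (hl.length_le.trans (length_lt_encSize _).le).trans (hp a)
  have h₃ := hr a
  simp only [Polynomial.eval_add, Polynomial.eval_mul]
  nlinarith [Nat.mul_le_mul_right (g.eval (encSize a)) h₂]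

theorem reverse {L : α → List β} (hL : PolyTime L) : PolyTime (fun a => (L a).reverse) := by
  obtain ⟨p, hp⟩ := hL.exists_encSize_le
  have h := foldl_of_growth (s := fun _ => []) (f := fun _ s b => b :: s) hL (const [])
    (cons id.snd.snd id.snd.fst) p (fun a b hb c => by
      have := encSize_lt_of_mem hb
      have := hp a
      simp
      omega)
  simpa using h

/-- Reversing the first list makes pushing its entries one by one onto the second restore their
order. -/
theorem append {L M : α → List β} (hL : PolyTime L) (hM : PolyTime M) :
    PolyTime (fun a => L a ++ M a) := by
  obtain ⟨p, hp⟩ := hL.exists_encSize_le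
  have h := foldl_of_growth (s := M) (f := fun _ s b => b :: s) hL.reverse hM
    (cons id.snd.snd id.snd.fst) p (fun a b hb c => by
      have := encSize_lt_of_mem (List.mem_reverse.1 hb)
      have := hp a
      simp
      omega)
  simpa using h

theorem flatMap {L : α → List β} {f : α → β → List γ} (hL : PolyTime L)
    (hf : PolyTime (fun x : α × β => f x.1 x.2)) :
    PolyTime (fun a => (L a).flatMap (fun b => f a b)) := by
  obtain ⟨p, hp⟩ := hL.exists_encSize_le
  obtain ⟨q, hq⟩ := hf.exists_encSize_le
  have h := foldl_of_growth (s := fun _ => []) (f := fun a s b => s ++ f a b) hL (const [])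
    (append id.snd.fst (hf.comp (id.fst.pair id.snd.snd))) (q.comp (Polynomial.X + p + 1))
    (fun a b hb c => by
      have h₁ := encSize_lt_of_mem hb
      have h₂ := hp a
      have h₃ := encSize_append c (f a b)
      have h₄ : encSize (f a b) ≤ _ := hq (a, b)
      have h₅ := q.eval_le_eval_nat (show encSize (a, b) ≤
        encSize a + p.eval (encSize a) + 1 by simp; omega)
      simp only [Polynomial.eval_comp, Polynomial.eval_add, Polynomial.eval_X,
        Polynomial.eval_one]
      omega)
  have e : ∀ (a : α) (l : List β) (s : List γ),
      l.foldl (fun s b => s ++ f a b) s = s ++ l.flatMap (f a) := by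
    intro a l
    induction l with
    | nil => simp
    | cons b l ih => intro s; simp [ih]
  simpa [e] using h

theorem map {L : α → List β} {f : α → β → γ} (hL : PolyTime L)
    (hf : PolyTime (fun x : α × β => f x.1 x.2)) :
    PolyTime (fun a => (L a).map (fun b => f a b)) := by
  have h := flatMap (f := fun a b => [f a b]) hL (hf.cons (const []))
  simp only [← List.map_eq_flatMap] at h
  exact h

theorem filter {L : α → List β} {f : α → β → Bool} (hL : PolyTime L)
    (hf : PolyTime (fun x : α × β => f x.1 x.2)) :
    PolyTime (fun a => (L a).filter (fun b => f a b)) := by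
  have h := flatMap (f := fun a b => if f a b then [b] else []) hL
    (hf.ite (id.snd.cons (const [])) (const []))
  have e : ∀ (a : α) (l : List β),
      l.flatMap (fun b => if f a b then [b] else []) = l.filter (fun b => f a b) := by
    intro a l
    induction l with
    | nil => simp
    | cons b l ih => cases hb : f a b <;> simp [hb, ih]
  simpa [e] using h

theorem any {L : α → List β} {f : α → β → Bool} (hL : PolyTime L)
    (hf : PolyTime (fun x : α × β => f x.1 x.2)) :
    PolyTime (fun a => (L a).any (fun b => f a b)) := by
  refine (hL.filter hf).isEmpty.not.of_enc_eq fun a => congrArg enc ?_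
  rw [Bool.eq_iff_iff]
  simp

theorem all {L : α → List β} {f : α → β → Bool} (hL : PolyTime L)
    (hf : PolyTime (fun x : α × β => f x.1 x.2)) :
    PolyTime (fun a => (L a).all (fun b => f a b)) := by
  refine (hL.any (f := fun a b => !f a b) hf.not).not.of_enc_eq fun a => congrArg enc ?_
  rw [Bool.eq_iff_iff]
  simp

theorem mem [DecidableEq β] {x : α → β} {L : α → List β} (hx : PolyTime x)
    (hL : PolyTime L) : PolyTime (fun a => decide (x a ∈ L a)) := by
  refine (hL.any (f := fun a b => decide (b = x a)) (id.snd.eq (hx.comp id.fst))).of_enc_eq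
    fun a => congrArg enc ?_
  rw [Bool.eq_iff_iff]
  simp

theorem product {L : α → List β} {M : α → List γ} (hL : PolyTime L) (hM : PolyTime M) :
    PolyTime (fun a => L a ×ˢ M a) :=
  hL.flatMap (f := fun a b => (M a).map (fun c => (b, c)))
    ((hM.comp id.fst).map (f := fun x c => (x.2, c)) (id.fst.snd.pair id.snd))

end PolyTime

/-- The list without repetitions. -/
def List.nub [DecidableEq α] (l : List α) : List α :=
  l.foldl (fun s a => if decide (a ∈ s) then s else a :: s) []

omit [Enc α] in
theorem List.nub_spec [DecidableEq α] (l : List α) : l.nub.Nodup ∧ ∀ a, a ∈ l.nub ↔ a ∈ l := by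
  suffices h : ∀ (l s : List α), s.Nodup →
      (l.foldl (fun s a => if decide (a ∈ s) then s else a :: s) s).Nodup ∧
      ∀ a, a ∈ l.foldl (fun s a => if decide (a ∈ s) then s else a :: s) s ↔
        a ∈ l ∨ a ∈ s by
    simpa [List.nub] using h l [] (by simp)
  intro l
  induction l with
  | nil => simp
  | cons b l ih =>
    intro s hs
    by_cases hb : b ∈ s
    · have := ih s hs
      simp only [List.foldl_cons, hb, decide_true, if_true]
      refine ⟨this.1, fun a => ?_⟩
      rw [this.2, List.mem_cons]
      grind
    · have := ih (b :: s) (by simp [hb, hs])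
      simp only [List.foldl_cons, hb, decide_false, Bool.false_eq_true, if_false]
      refine ⟨this.1, fun a => ?_⟩
      rw [this.2, List.mem_cons, List.mem_cons]
      grind

theorem PolyTime.nub [DecidableEq β] {L : α → List β} (hL : PolyTime L) :
    PolyTime (fun a => (L a).nub) := by
  obtain ⟨p, hp⟩ := hL.exists_encSize_le
  refine foldl_of_growth (s := fun _ => []) (f := fun _ s b => if decide (b ∈ s) then s else b :: s)
    hL (const []) ((id.snd.snd.mem id.snd.fst).ite id.snd.fst (id.snd.snd.cons id.snd.fst)) p
    (fun a b hb c => ?_)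
  have := encSize_lt_of_mem hb
  have := hp a
  split <;> simp
  omega

/-! ### Reachability -/

/-- The elements of `U` that are reached from elements of `U` with property `S` by steps of the
relation `R` within `U`. -/
def reachClosure (U : List α) (S : α → Bool) (R : α → α → Bool) : List α :=
  U.foldl (fun X _ => U.filter (fun a => S a || X.any (fun b => R b a))) []

-- The iterated operator is monotone and produces an increasing chain of sublists of `U`. The chain
-- gains an element in each round until it is stationary, so `U.length` rounds reach a fixed point;
-- the fold uses `U` only as a counter.
omit [Enc α] in
theorem mem_reachClosure {U : List α} {S : α → Bool} {R : α → α → Bool} {a : α} :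
    a ∈ reachClosure U S R ↔
      ∃ s ∈ U, S s ∧ Relation.ReflTransGen (fun b c => R b c ∧ c ∈ U) s a := by
  let F : List α → List α := fun X => U.filter (fun a => S a || X.any (fun b => R b a))
  have hF : ∀ X a, a ∈ F X ↔ a ∈ U ∧ (S a ∨ ∃ b ∈ X, R b a) := fun X a => by simp [F]
  have hmono : ∀ X Y, X ⊆ Y → (F X).Sublist (F Y) := fun X Y h => by
    refine List.monotone_filter_right U fun a ha => ?_
    simp only [Bool.or_eq_true, List.any_eq_true] at ha ⊢
    exact ha.imp_right fun ⟨b, hb, hab⟩ => ⟨b, h hb, hab⟩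
  have hiter : ∀ (l : List α) X, l.foldl (fun X _ => F X) X = F^[l.length] X := by
    intro l
    induction l with
    | nil => simp
    | cons b l ih => intro X; simp [ih]
  have hcl : reachClosure U S R = F^[U.length] [] := hiter U []
  have hstep : ∀ n, (F^[n] []).Sublist (F^[n + 1] []) := by
    intro n
    induction n with
    | zero => simp
    | succ n ih =>
      rw [Function.iterate_succ_apply', Function.iterate_succ_apply' F (n + 1)]
      exact hmono _ _ ih.subset
  have hfix : ∀ n, n ≤ (F^[n] []).length ∨ F^[n + 1] [] = F^[n] [] := by
    intro n
    induction n with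
    | zero => simp
    | succ n ih =>
      rcases ih with ih | ih
      · by_cases h : F^[n + 1] [] = F^[n] []
        · right
          rw [Function.iterate_succ_apply' F (n + 1), h, ← Function.iterate_succ_apply' F n, h]
        · left
          have h₁ := (hstep n).length_le
          have h₂ : (F^[n] []).length ≠ (F^[n + 1] []).length := fun e =>
            h ((hstep n).eq_of_length e).symm
          omega
      · right
        rw [Function.iterate_succ_apply' F (n + 1), ih, ← Function.iterate_succ_apply' F n, ih]
  have hsub : ∀ n, (F^[n] []).Sublist U := by
    intro n
    cases n with
    | zero => simp
    | succ n => rw [Function.iterate_succ_apply']; exact List.filter_sublist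
  -- Either the chain has already stabilized, or it has as many entries as `U` and so equals `U`.
  have hend : F^[U.length + 1] [] = F^[U.length] [] := by
    rcases hfix U.length with h | h
    · have e := (hsub U.length).eq_of_length (le_antisymm (hsub _).length_le h)
      have h₁ := (hstep U.length)
      rw [e] at h₁
      rw [e]
      exact (hsub _).eq_of_length (le_antisymm (hsub _).length_le h₁.length_le)
    · exact h
  rw [hcl]
  constructor
  · generalize U.length = n
    induction n generalizing a with
    | zero => simp
    | succ n ih =>
      intro h
      rw [Function.iterate_succ_apply', hF] at h
      obtain ⟨ha, hS | ⟨b, hb, hab⟩⟩ := h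
      · exact ⟨a, ha, hS, .refl⟩
      · obtain ⟨s, hs, hS, hsb⟩ := ih hb
        exact ⟨s, hs, hS, hsb.tail ⟨hab, ha⟩⟩
  · rintro ⟨s, hs, hS, h⟩
    induction h with
    | refl =>
      rw [← hend, Function.iterate_succ_apply', hF]
      exact ⟨hs, .inl hS⟩
    | tail _ h ih =>
      rw [← hend, Function.iterate_succ_apply', hF]
      exact ⟨h.2, .inr ⟨_, ih, h.1⟩⟩

theorem PolyTime.closure {U : α → List β} {S : α → β → Bool} {R : α → β → β → Bool}
    (hU : PolyTime U) (hS : PolyTime (fun x : α × β => S x.1 x.2))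
    (hR : PolyTime (fun x : α × β × β => R x.1 x.2.1 x.2.2)) :
    PolyTime (fun a => reachClosure (U a) (fun b => S a b) (fun b c => R a b c)) := by
  obtain ⟨p, hp⟩ := hU.exists_encSize_le
  refine foldl (s := fun _ => []) (f := fun a X _ =>
    (U a).filter (fun b => S a b || X.any (fun c => R a c b))) hU (const []) ?_ (p + 1) ?_
  · refine (hU.comp id.fst).filter (f := fun (x : α × List β × β) b => S x.1 b || x.2.1.any (fun c => R x.1 c b))
      ((hS.comp (id.fst.fst.pair id.snd)).or ?_)
    exact id.fst.snd.fst.any (f := fun (x : (α × List β × β) × β) c => R x.1.1 c x.2)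
      (hR.comp (id.fst.fst.fst.pair (id.snd.pair id.fst.snd)))
  · intro a l _
    simp only [Polynomial.eval_add, Polynomial.eval_one]
    rcases List.eq_nil_or_concat l with rfl | ⟨l, b, rfl⟩
    · simp
    · simp only [List.concat_eq_append, List.foldl_append, List.foldl_cons, List.foldl_nil]
      have := encSize_sublist (List.filter_sublist (l := U a) (p := fun b => S a b ||
        (l.foldl (fun X _ => (U a).filter (fun b => S a b || X.any (fun c => R a c b)))
          []).any (fun c => R a c b)))
      have := hp a
      omega

end Lists

/-! ### Polynomial-time operations on numbers -/

section Numbers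

variable {α : Type} [Enc α]

/-- Successor of a number in binary. -/
def succBits (l : List Bool) : List Bool :=
  let x := l.foldl (fun (s : Bool × List Bool) b => (s.1 && b, s.2 ++ [s.1 ^^ b])) (true, [])
  if x.1 then x.2 ++ [true] else x.2

/-- The flag of the fold is the carry. Once it is lost the remaining bits are copied unchanged
(`h₀`), and bits already written remain a prefix of the result (`h₁`); a carry surviving to the end
adds a new leading bit. -/
theorem bits_succ (n : ℕ) : (n + 1).bits = succBits n.bits := by
  let st : Bool × List Bool → Bool → Bool × List Bool :=
    fun s b => (s.1 && b, s.2 ++ [s.1 ^^ b])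
  let fin : Bool × List Bool → List Bool := fun x => if x.1 then x.2 ++ [true] else x.2
  have h₀ : ∀ (l out : List Bool), fin (l.foldl st (false, out)) = out ++ l := by
    intro l
    induction l with
    | nil => simp [fin]
    | cons b l ih => intro out; simp [st, ih]
  have h₁ : ∀ (l out : List Bool),
      fin (l.foldl st (true, out)) = out ++ fin (l.foldl st (true, [])) := by
    intro l
    induction l with
    | nil => simp [fin]
    | cons b l ih =>
      intro out
      cases b
      · simp only [List.foldl_cons, st, Bool.and_false]
        rw [h₀, h₀]
        simp
      · simp only [List.foldl_cons, st, Bool.and_true]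
        rw [ih, ih ([] ++ _)]
        simp
  change _ = fin (n.bits.foldl st (true, []))
  induction n using Nat.binaryRec' with
  | zero => simp [fin]
  | bit b n hn ih =>
    rw [Nat.bits_append_bit n b hn]
    cases b
    · have e : Nat.bit false n + 1 = Nat.bit true n := by simp [Nat.bit_val]
      rw [e, Nat.bits_append_bit n true (by simp)]
      simp only [List.foldl_cons, st, Bool.and_false]
      rw [h₀]
      simp
    · have e : Nat.bit true n + 1 = Nat.bit false (n + 1) := by simp [Nat.bit_val]; ring
      rw [e, Nat.bits_append_bit (n + 1) false (by simp), ih]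
      rw [List.foldl_cons, show st (true, []) true = (true, [false]) from rfl, h₁ _ [false]]
      simp

theorem PolyTime.succ {f : α → ℕ} (hf : PolyTime f) : PolyTime (fun a => f a + 1) := by
  have hb : PolyTime (fun a => (f a).bits) := hf.of_enc_eq fun _ => rfl
  have h : PolyTime succBits := by
    have h := foldl_of_growth (α := List Bool) (L := fun l => l) (s := fun _ => (true, []))
      (f := fun _ (s : Bool × List Bool) b => (s.1 && b, s.2 ++ [s.1 ^^ b])) id (const _)
      ?_ 10 ?_
    · exact h.fst.ite (h.snd.append (const _)) h.snd
    · have hx : PolyTime (fun x : List Bool × (Bool × List Bool) × Bool => x.2.1.1 ^^ x.2.2) := by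
        refine (id.snd.fst.fst.ite id.snd.snd.not id.snd.snd).of_enc_eq fun x => ?_
        cases x.2.1.1 <;> simp
      exact (id.snd.fst.fst.and id.snd.snd).pair (id.snd.fst.snd.append (hx.cons (const _)))
    · intro a b _ c
      have hbool : ∀ b : Bool, encSize b ≤ 3 := fun b => by
        cases b <;> simp [encSize, enc, Val.ofBool, Val.size]
      have h₁ := encSize_append c.2 [c.1 ^^ b]
      have h₂ := hbool (c.1 && b)
      have h₃ := hbool (c.1 ^^ b)
      have h₄ : encSize c = encSize c.1 + encSize c.2 + 1 := rfl
      simp only [encSize_pair, encSize_cons, encSize_nil, Polynomial.eval_ofNat] at *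
      omega
  exact (h.comp hb).of_enc_eq fun a => by rw [← bits_succ]; rfl

/-- A bound linear in the value, rather than logarithmic, suffices: it is applied to positions,
which are bounded by the length of a list in the input. -/
theorem encSize_nat_le (n : ℕ) : encSize n ≤ 4 * n + 1 := by
  have hbool : ∀ b ∈ n.bits, encSize b ≤ 3 := fun b _ => by
    cases b <;> simp [encSize, enc, Val.ofBool, Val.size]
  have h₁ : encSize n ≤ n.bits.length * (3 + 1) + 1 := encSize_le_length_mul hbool
  have h₂ : n.bits.length ≤ n := by
    rw [Nat.size_eq_bits_len]
    exact Nat.size_le.2 Nat.lt_two_pow_self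
  omega

/-! ### Positions in a document -/

/-- The entries of a list together with their position, counted from `1`, and the next
position. -/
def positioned {β : Type} (l : List β) : List (ℕ × β × ℕ) :=
  (l.zipIdx 1).map fun x => (x.2, x.1, x.2 + 1)

theorem mem_positioned {β : Type} {l : List β} {i j : ℕ} {b : β} :
    (i, b, j) ∈ positioned l ↔ 1 ≤ i ∧ l[i - 1]? = some b ∧ j = i + 1 := by
  simp only [positioned, List.mem_map, Prod.exists, Prod.mk.injEq]
  constructor
  · rintro ⟨c, m, h, rfl, rfl, rfl⟩
    rw [List.mem_zipIdx_iff_le_and_getElem?_sub] at h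
    exact ⟨h.1, h.2, rfl⟩
  · rintro ⟨h₁, h₂, rfl⟩
    exact ⟨b, i, List.mem_zipIdx_iff_le_and_getElem?_sub.2 ⟨h₁, h₂⟩, rfl, rfl, rfl⟩

theorem foldl_positioned {β : Type} (l : List β) (n : ℕ) (acc : List (ℕ × β × ℕ)) :
    l.foldl (fun (s : ℕ × List (ℕ × β × ℕ)) b => (s.1 + 1, (s.1, b, s.1 + 1) :: s.2)) (n, acc) =
      (n + l.length, ((l.zipIdx n).map fun x => (x.2, x.1, x.2 + 1)).reverse ++ acc) := by
  induction l generalizing n acc with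
  | nil => simp
  | cons b l ih => simp [ih]; omega

/-- One pass with a counter yields both the final index and the table, successor being the only
arithmetic needed. Each table entry stores its next position as well, so that later tests only
compare numbers. -/
theorem PolyTime.length_positioned {β : Type} [Enc β] {l : α → List β} (hl : PolyTime l) :
    PolyTime (fun a => ((l a).length + 1, positioned (l a))) := by
  obtain ⟨p, hp⟩ := hl.exists_encSize_le
  have h := foldl (s := fun _ => ((1 : ℕ), ([] : List (ℕ × β × ℕ))))
    (f := fun _ s b => (s.1 + 1, (s.1, b, s.1 + 1) :: s.2)) hl (const _)
    (id.snd.fst.fst.succ.pair ((id.snd.fst.fst.pair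
      (id.snd.snd.pair id.snd.fst.fst.succ)).cons id.snd.fst.snd))
    (10 * p + 20 + p * (10 * p + 20)) ?_
  · simp only [foldl_positioned, List.append_nil] at h
    refine (h.fst.pair h.snd.reverse).of_enc_eq fun a => congrArg enc ?_
    simp [positioned, add_comm]
  · intro a m hm
    rw [foldl_positioned]
    have h₁ : encSize (positioned m) ≤ (positioned m).length *
        (10 * p.eval (encSize a) + 20) + 1 := by
      refine encSize_le_length_mul (n := 10 * p.eval (encSize a) + 19) ?_
      rintro ⟨i, b, j⟩ h
      obtain ⟨h₁, h₂, rfl⟩ := mem_positioned.1 h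
      obtain ⟨h₃, rfl⟩ := List.getElem?_eq_some_iff.1 h₂
      have h₄ := hm.length_le
      have h₅ := length_lt_encSize (l a)
      have h₆ := hp a
      have h₇ := encSize_lt_of_mem (hm.subset (List.getElem_mem h₃))
      have h₈ := encSize_nat_le i
      have h₉ := encSize_nat_le (i + 1)
      simp only [encSize_pair]
      omega
    have h₂ : (positioned m).length = m.length := by simp [positioned]
    have h₄ := hm.length_le
    have h₅ := length_lt_encSize (l a)
    have h₆ := hp a
    have h₇ := encSize_nat_le (1 + m.length)
    have h₈ := Nat.mul_le_mul_right (10 * p.eval (encSize a) + 20)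
      (show m.length ≤ p.eval (encSize a) by omega)
    rw [h₂] at h₁
    simp only [encSize_pair, List.append_nil, encSize_reverse, Polynomial.eval_add,
      Polynomial.eval_mul, Polynomial.eval_ofNat]
    change _ + encSize (positioned m) + 1 ≤ _
    omega

/-! ### Names for tuples of states -/

/-- An injective coding of lists of numbers by bit strings. -/
def codeBits (l : List ℕ) : List Bool :=
  (l.flatMap fun n => (n.bits.flatMap fun b => [true, b]) ++ [false]) ++ [true]

/-- A number that names a list of numbers. -/
def nameOf (l : List ℕ) : ℕ := (codeBits l).foldr (fun b n => Nat.bit b n) 0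

/-- The closing `true` is the most significant bit. It keeps trailing `false` entries of `l` from
vanishing as leading zeros, so the number determines the string. -/
theorem bits_foldr (l : List Bool) :
    ((l ++ [true]).foldr (fun b n => Nat.bit b n) 0).bits = l ++ [true] := by
  induction l with
  | nil => simp
  | cons b l ih =>
    simp only [List.cons_append, List.foldr_cons]
    rw [Nat.bits_append_bit, ih]
    intro h
    rw [h] at ih
    simp at ih

theorem bits_nameOf (l : List ℕ) : (nameOf l).bits = codeBits l := bits_foldr _

theorem bits_injective : Function.Injective Nat.bits := fun m n h =>
  Val.ofNat_injective (by rw [Val.ofNat, Val.ofNat, h])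

/-- The code is self-delimiting: each data bit is announced by `true` and each number is ended by
`false`, so numbers can be read off from the front. -/
theorem nameOf_injective : Function.Injective nameOf := by
  intro l m h
  replace h : codeBits l = codeBits m := by rw [← bits_nameOf, h, bits_nameOf]
  replace h := List.append_cancel_right h
  have key : ∀ (l m : List Bool) (s t : List Bool),
      (l.flatMap fun b => [true, b]) ++ false :: s = (m.flatMap fun b => [true, b]) ++ false :: t →
      l = m ∧ s = t := by
    intro l
    induction l with
    | nil => intro m s t h; cases m <;> simp_all
    | cons b l ih =>
      intro m s t h
      cases m with
      | nil => simp at h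
      | cons c m =>
        simp only [List.flatMap_cons, List.cons_append, List.nil_append, List.cons.injEq,
          true_and] at h
        have := ih m s t h.2
        simp [h.1, this]
  induction l generalizing m with
  | nil =>
    cases m with
    | nil => rfl
    | cons b m => simp at h
  | cons a l ih =>
    cases m with
    | nil => simp at h
    | cons b m =>
      simp only [List.flatMap_cons, List.append_assoc, List.cons_append, List.nil_append] at h
      have h' := key _ _ _ _ h
      rw [bits_injective h'.1, ih h'.2]

theorem PolyTime.nameOf {l : α → List ℕ} (hl : PolyTime l) :
    PolyTime (fun a => nameOf (l a)) := by
  have hb : PolyTime (fun n : ℕ => n.bits) := id.of_enc_eq fun _ => rfl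
  have h : PolyTime (fun a => codeBits (l a)) := by
    refine (hl.flatMap (f := fun _ n => (n.bits.flatMap fun b => [true, b]) ++ [false])
      (append ?_ (const _))).append (const _)
    exact (hb.comp id.snd).flatMap (f := fun _ b => [true, b])
      ((const true).cons (id.snd.cons (const [])))
  exact h.of_enc_eq fun a => by rw [← bits_nameOf]; rfl

end Numbers

/-! ### Runs of vset-automata -/

/-- In `l` either none of `x`, `y` occurs, or both once, with `x` before `y`. -/
theorem List.filter_eq_pair_iff {α : Type} [DecidableEq α] {x y : α} (hxy : x ≠ y)
    (l : List α) :
    (l.count x ≤ 1 ∧ l.count y ≤ 1 ∧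
      (∀ i : ℕ, l[i]? = some x → ∃ j : ℕ, i ≤ j ∧ l[j]? = some y) ∧
      (∀ j : ℕ, l[j]? = some y → ∃ i : ℕ, i ≤ j ∧ l[i]? = some x)) ↔
    l.filter (fun z => decide (z = x) || decide (z = y)) = [] ∨
      l.filter (fun z => decide (z = x) || decide (z = y)) = [x, y] := by
  constructor
  · rintro ⟨cx, cy, h₁, h₂⟩
    by_cases hx : x ∈ l
    · right
      obtain ⟨s, t, rfl, hs⟩ := List.eq_append_cons_of_mem hx
      -- `s` ends before the first `x`, and a `y` in it would require an `x` at no later place.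
      have hys : y ∉ s := by
        intro hy
        obtain ⟨j, hj, e⟩ := List.getElem_of_mem hy
        obtain ⟨i, hi, e'⟩ := h₂ j (by rw [List.getElem?_append_left hj, ← e]; simp)
        rw [List.getElem?_append_left (by omega)] at e'
        exact hs (List.mem_of_getElem? e')
      have hxt : x ∉ t := by
        intro h
        have := List.count_pos_iff.2 h
        simp at cx
        omega
      have hyt : y ∈ t := by
        obtain ⟨j, hj, e⟩ := h₁ s.length (by simp)
        have := List.mem_of_getElem? e
        simp [hys, hxy.symm] at this
        exact this
      obtain ⟨t₁, t₂, rfl, ht⟩ := List.eq_append_cons_of_mem hyt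
      have hy₂ : y ∉ t₂ := by
        intro h
        have := List.count_pos_iff.2 h
        simp [hxy] at cy
        omega
      have key : ∀ m : List α, x ∉ m → y ∉ m →
          m.filter (fun z => decide (z = x) || decide (z = y)) = [] := by
        intro m h₁ h₂
        rw [List.filter_eq_nil_iff]
        intro z hz
        simp only [Bool.or_eq_true, decide_eq_true_eq]
        rintro (rfl | rfl)
        exacts [h₁ hz, h₂ hz]
      simp only [List.mem_append, List.mem_cons, not_or] at hxt
      simp [key s hs hys, key t₁ hxt.1 ht, key t₂ hxt.2.2 hy₂]
    · left
      rw [List.filter_eq_nil_iff]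
      intro z hz
      simp only [Bool.or_eq_true, decide_eq_true_eq]
      rintro (rfl | rfl)
      · exact hx hz
      · obtain ⟨j, hj, e⟩ := List.getElem_of_mem hz
        obtain ⟨i, _, e'⟩ := h₂ j (by rw [← e]; simp)
        exact hx (List.mem_of_getElem? e')
  · intro h
    have hcx : l.count x = (l.filter (fun z => decide (z = x) || decide (z = y))).count x :=
      (List.count_filter (by simp)).symm
    have hcy : l.count y = (l.filter (fun z => decide (z = x) || decide (z = y))).count y :=
      (List.count_filter (by simp)).symm
    rcases h with h | h
    · rw [h] at hcx hcy
      refine ⟨by simp [hcx], by simp [hcy], fun i hi => ?_, fun i hi => ?_⟩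
      · exact absurd (List.mem_of_getElem? hi) (List.count_eq_zero.1 (by simpa using hcx))
      · exact absurd (List.mem_of_getElem? hi) (List.count_eq_zero.1 (by simpa using hcy))
    · rw [h] at hcx hcy
      simp only [List.count_cons_self, List.count_cons_of_ne hxy, List.count_cons_of_ne hxy.symm,
        List.count_nil] at hcx hcy
      obtain ⟨s, t, rfl, hs, -, ht⟩ := List.filter_eq_cons_iff.1 h
      obtain ⟨t₁, t₂, rfl, ht₁, -, ht₂⟩ := List.filter_eq_cons_iff.1 ht
      have ex : (s ++ x :: (t₁ ++ y :: t₂))[s.length]? = some x := by simp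
      have ey : (s ++ x :: (t₁ ++ y :: t₂))[s.length + (1 + t₁.length)]? = some y := by
        simp [add_comm 1]
      have uniq : ∀ (m : List α) (z : α) (i j : ℕ), m.count z = 1 → m[i]? = some z →
          m[j]? = some z → i = j := by
        intro m z i j hc hi hj
        by_contra hij
        have h2 : List.Duplicate z m := by
          rw [List.duplicate_iff_exists_distinct_get]
          obtain ⟨hi', ei⟩ := List.getElem?_eq_some_iff.1 hi
          obtain ⟨hj', ej⟩ := List.getElem?_eq_some_iff.1 hj
          rcases lt_or_gt_of_ne hij with h | h
          · exact ⟨⟨i, hi'⟩, ⟨j, hj'⟩, h, by simp [ei], by simp [ej]⟩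
          · exact ⟨⟨j, hj'⟩, ⟨i, hi'⟩, h, by simp [ej], by simp [ei]⟩
        rw [List.duplicate_iff_two_le_count] at h2
        omega
      refine ⟨by omega, by omega, fun i hi => ⟨_, ?_, ey⟩, fun i hi => ⟨_, ?_, ex⟩⟩
      · rw [uniq _ _ _ _ hcx hi ex]; omega
      · rw [uniq _ _ _ _ hcy hi ey]; omega

namespace Label

variable {k : ℕ}

/-- The operations on the variable `v`. -/
def isOpOf (v : ℕ) (l : Label k) : Bool := decide (l = opn v) || decide (l = cls v)

theorem isOpOf_iff {v : ℕ} {l : Label k} : l.isOpOf v = true ↔ l = opn v ∨ l = cls v := by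
  simp [isOpOf]

/-- The variable operations. -/
def IsOp (l : Label k) : Prop := ∃ v, l.isOpOf v = true

/-- The letters. -/
def IsLetter (l : Label k) : Prop := ∃ a, l = letter a

end Label

/-- The operations on `v` in a run. -/
def opsOf {k : ℕ} (v : ℕ) (ρ : List (Label k × ℕ)) : List (Label k × ℕ) :=
  ρ.filter fun e => e.1.isOpOf v

section Runs

variable {k : ℕ}

theorem map_opsOf (v : ℕ) (ρ : List (Label k × ℕ)) :
    (opsOf v ρ).map Prod.fst = (ρ.map Prod.fst).filter (Label.isOpOf v) := by
  rw [opsOf, List.filter_map]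
  rfl

/-- Validity becomes a statement about the sublist of operations on a single variable. In this form
it is easily compared between runs that interleave or differ in silent steps. -/
theorem validRun_iff (ρ : List (Label k × ℕ)) :
    VA.ValidRun ρ ↔ ∀ v, (opsOf v ρ).map Prod.fst = [] ∨
      (opsOf v ρ).map Prod.fst = [Label.opn v, Label.cls v] := by
  refine forall_congr' fun v => ?_
  rw [map_opsOf]
  exact List.filter_eq_pair_iff (by simp) _

theorem mem_opsOf {v : ℕ} {ρ : List (Label k × ℕ)} {e : Label k × ℕ} :
    e ∈ opsOf v ρ ↔ e ∈ ρ ∧ (e.1 = Label.opn v ∨ e.1 = Label.cls v) := by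
  rw [opsOf, List.mem_filter, Label.isOpOf_iff]

theorem eq_pair_of_map_eq {v : ℕ} {ρ : List (Label k × ℕ)}
    (h : ρ.map Prod.fst = [Label.opn v, Label.cls v]) :
    ∃ i j, ρ = [(Label.opn v, i), (Label.cls v, j)] := by
  match ρ, h with
  | [(a, i), (b, j)], h =>
    simp at h
    exact ⟨i, j, by simp [h.1, h.2]⟩

theorem opsOf_eq_pair_iff {ρ : List (Label k × ℕ)} (h : VA.ValidRun ρ) {v i j : ℕ} :
    opsOf v ρ = [(Label.opn v, i), (Label.cls v, j)] ↔
      (Label.opn v, i) ∈ ρ ∧ (Label.cls v, j) ∈ ρ := by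
  have h₁ : (Label.opn v, i) ∈ ρ ↔ (Label.opn v, i) ∈ opsOf v ρ := by simp [mem_opsOf]
  have h₂ : (Label.cls v, j) ∈ ρ ↔ (Label.cls v, j) ∈ opsOf v ρ := by simp [mem_opsOf]
  rw [h₁, h₂]
  rcases (validRun_iff ρ).1 h v with h | h
  · rw [List.map_eq_nil_iff.1 h]; simp
  · obtain ⟨i', j', e⟩ := eq_pair_of_map_eq h
    rw [e]
    simp [eq_comm]

theorem isRunMapping_iff {ρ : List (Label k × ℕ)} (h : VA.ValidRun ρ) {μ : Mapping} :
    VA.IsRunMapping ρ μ ↔ ∀ v s, μ v = some s ↔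
      opsOf v ρ = [(Label.opn v, s.start), (Label.cls v, s.finish)] := by
  simp only [VA.IsRunMapping, opsOf_eq_pair_iff h]

theorem isRunMapping_unique {ρ : List (Label k × ℕ)} {μ ν : Mapping}
    (hμ : VA.IsRunMapping ρ μ) (hν : VA.IsRunMapping ρ ν) : μ = ν := by
  funext v
  exact Option.ext fun s => (hμ v s).trans (hν v s).symm

end Runs

namespace VA

variable {k : ℕ} {A B : VA k} {d : List (Fin k)}

theorem Steps.le {p q i j : ℕ} {ρ : List (Label k × ℕ)} (h : A.Steps d p i ρ q j) :
    i ≤ j ∧ ∀ e ∈ ρ, i ≤ e.2 ∧ e.2 ≤ j := by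
  induction h with
  | refl => simp
  | eps _ _ ih | opn _ _ ih | cls _ _ ih =>
    refine ⟨ih.1, ?_⟩
    simp only [List.mem_cons, forall_eq_or_imp]
    exact ⟨⟨le_rfl, ih.1⟩, ih.2⟩
  | letter _ _ _ ih =>
    refine ⟨by omega, ?_⟩
    simp only [List.mem_cons, forall_eq_or_imp]
    exact ⟨⟨by omega, ih.1⟩, fun e he => ⟨by have := ih.2 e he; omega, (ih.2 e he).2⟩⟩

theorem Steps.sorted {p q i j : ℕ} {ρ : List (Label k × ℕ)} (h : A.Steps d p i ρ q j) :
    ρ.Pairwise fun e f => e.2 ≤ f.2 := by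
  induction h with
  | refl => simp
  | eps _ h ih | opn _ h ih | cls _ h ih | letter _ _ h ih =>
    exact List.pairwise_cons.2 ⟨fun e he => (h.le.2 e he).1, ih⟩

theorem Steps.label_mem {p q i j : ℕ} {ρ : List (Label k × ℕ)} (h : A.Steps d p i ρ q j) :
    ∀ e ∈ ρ, ∃ p' q', (p', e.1, q') ∈ A.trans := by
  induction h with
  | refl => simp
  | eps ht _ ih | opn ht _ ih | cls ht _ ih | letter ht _ _ ih =>
    simp only [List.mem_cons, forall_eq_or_imp]
    exact ⟨⟨_, _, ht⟩, ih⟩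

/-- Steps of `A` from a set of states that is closed under transitions shared with `B`. -/
theorem Steps.congr {S : Set ℕ}
    (hS : ∀ p ∈ S, ∀ l q, (p, l, q) ∈ A.trans → (p, l, q) ∈ B.trans ∧ q ∈ S)
    {p q i j : ℕ} {ρ : List (Label k × ℕ)} (h : A.Steps d p i ρ q j) (hp : p ∈ S) :
    B.Steps d p i ρ q j ∧ q ∈ S := by
  induction h with
  | refl => exact ⟨.refl _ _, hp⟩
  | eps ht _ ih =>
    have := hS _ hp _ _ ht
    exact ⟨.eps this.1 (ih this.2).1, (ih this.2).2⟩
  | letter ht hd _ ih =>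
    have := hS _ hp _ _ ht
    exact ⟨.letter this.1 hd (ih this.2).1, (ih this.2).2⟩
  | opn ht _ ih =>
    have := hS _ hp _ _ ht
    exact ⟨.opn this.1 (ih this.2).1, (ih this.2).2⟩
  | cls ht _ ih =>
    have := hS _ hp _ _ ht
    exact ⟨.cls this.1 (ih this.2).1, (ih this.2).2⟩

theorem exists_isRunMapping {ρ : List (Label k × ℕ)} (hρ : ValidRun ρ) : ∃ μ, IsRunMapping ρ μ := by
  classical
  refine ⟨fun v => if h : ∃ s : Span,
    opsOf v ρ = [(Label.opn v, s.start), (Label.cls v, s.finish)] then some h.choose else none, ?_⟩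
  rw [isRunMapping_iff hρ]
  intro v s
  constructor
  · intro e
    split at e
    · next h =>
      rw [← Option.some_injective _ e]
      exact h.choose_spec
    · simp at e
  · intro e
    have h : ∃ s : Span, opsOf v ρ = [(Label.opn v, s.start), (Label.cls v, s.finish)] := ⟨s, e⟩
    rw [dif_pos h]
    have e' := e.symm.trans h.choose_spec
    simp only [List.cons.injEq, Prod.mk.injEq, true_and, and_true] at e'
    rw [Option.some_inj]
    exact Span.ext e'.1.symm e'.2.symm

/-! ### Paths and functionality -/

/-- There is a transition from `p` to `q`. -/
def Edge (A : VA k) (p q : ℕ) : Prop := ∃ l, (p, l, q) ∈ A.trans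

/-- `A.Path p ls q`: a path from `p` to `q` with the labels `ls`. -/
inductive Path (A : VA k) : ℕ → List (Label k) → ℕ → Prop where
  | refl (q : ℕ) : Path A q [] q
  | cons {p q r : ℕ} {l : Label k} {ls : List (Label k)} :
      (p, l, q) ∈ A.trans → Path A q ls r → Path A p (l :: ls) r

theorem Path.append {p q r : ℕ} {ls ms : List (Label k)} (h : A.Path p ls q)
    (h' : A.Path q ms r) : A.Path p (ls ++ ms) r := by
  induction h with
  | refl => exact h'
  | cons ht _ ih => exact .cons ht (ih h')

theorem Path.split {p q : ℕ} {ls : List (Label k)} (h : A.Path p ls q) {l : Label k}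
    (hl : l ∈ ls) : ∃ p' q' ls₁ ls₂, A.Path p ls₁ p' ∧ (p', l, q') ∈ A.trans ∧
      A.Path q' ls₂ q := by
  induction h with
  | refl => simp at hl
  | cons ht hr ih =>
    rcases List.mem_cons.1 hl with rfl | hl
    · exact ⟨_, _, _, _, .refl _, ht, hr⟩
    · obtain ⟨p', q', ls₁, ls₂, h₁, h₂, h₃⟩ := ih hl
      exact ⟨p', q', _, ls₂, .cons ht h₁, h₂, h₃⟩

theorem Path.reach {p q : ℕ} {ls : List (Label k)} (h : A.Path p ls q) :
    Relation.ReflTransGen A.Edge p q := by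
  induction h with
  | refl => exact .refl
  | cons ht _ ih => exact .head ⟨_, ht⟩ ih

theorem exists_path {p q : ℕ} (h : Relation.ReflTransGen A.Edge p q) :
    ∃ ls, A.Path p ls q := by
  induction h using Relation.ReflTransGen.head_induction_on with
  | refl => exact ⟨_, .refl _⟩
  | head h _ ih =>
    obtain ⟨l, hl⟩ := h
    obtain ⟨ls, hls⟩ := ih
    exact ⟨_, .cons hl hls⟩

theorem Steps.path {p q i j : ℕ} {ρ : List (Label k × ℕ)} (h : A.Steps d p i ρ q j) :
    A.Path p (ρ.map Prod.fst) q := by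
  induction h with
  | refl => exact .refl _
  | eps ht _ ih | opn ht _ ih | cls ht _ ih | letter ht _ _ ih => exact .cons ht ih

/-- The letters of a path. -/
def word (ls : List (Label k)) : List (Fin k) :=
  ls.filterMap fun l => match l with
    | Label.letter a => some a
    | _ => none

/-- A path without a document becomes a run on any document whose unread part is its own word.
Indices count from 1, so after `i` letters the index is `i + 1`. -/
theorem Path.exists_steps {p q : ℕ} {ls : List (Label k)} (h : A.Path p ls q) (i : ℕ)
    (hd : d.drop i = word ls) :
    ∃ ρ, ρ.map Prod.fst = ls ∧ A.Steps d p (i + 1) ρ q (i + (word ls).length + 1) := by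
  induction h generalizing i with
  | refl => exact ⟨[], rfl, .refl _ _⟩
  | @cons _ _ _ l ls ht _ ih =>
    cases l with
    | eps =>
      obtain ⟨ρ, rfl, h⟩ := ih i hd
      exact ⟨(Label.eps, i + 1) :: ρ, rfl, .eps ht h⟩
    | opn v =>
      obtain ⟨ρ, rfl, h⟩ := ih i hd
      exact ⟨(Label.opn v, i + 1) :: ρ, rfl, .opn ht h⟩
    | cls v =>
      obtain ⟨ρ, rfl, h⟩ := ih i hd
      exact ⟨(Label.cls v, i + 1) :: ρ, rfl, .cls ht h⟩
    | letter a =>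
      have e : word (Label.letter a :: ls) = a :: word ls := rfl
      rw [e] at hd ⊢
      have hd' : d.drop (i + 1) = word ls := by
        rw [← List.tail_drop, hd, List.tail_cons]
      have ha : d[i + 1 - 1]? = some a := by
        have := congrArg (fun m : List (Fin k) => m[0]?) hd
        simpa using this
      obtain ⟨ρ, rfl, h⟩ := ih (i + 1) hd'
      refine ⟨(Label.letter a, i + 1 + 1) :: ρ, rfl, .letter ht ha ?_⟩
      convert h using 1
      simp
      ring

/-- Functionality speaks of all documents, so it constrains every path from the initial to an
accepting state: such a path is an accepting run on the word it spells. Arguments about splicing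
paths rely on this form. -/
theorem Functional.filter_eq (hA : A.Functional) {ls : List (Label k)} {q : ℕ}
    (h : A.Path A.init ls q) (hq : q ∈ A.accept) (v : ℕ) :
    ls.filter (Label.isOpOf v) = [Label.opn v, Label.cls v] ∨
      (ls.filter (Label.isOpOf v) = [] ∧ v ∉ A.vars) := by
  obtain ⟨ρ, rfl, hρ⟩ := h.exists_steps (d := word ls) 0 rfl
  rw [zero_add] at hρ
  obtain ⟨h₁, h₂⟩ := hA (word (ρ.map Prod.fst)) ρ ⟨q, hq, by simpa using hρ⟩
  rw [← map_opsOf]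
  rcases (validRun_iff ρ).1 h₁ v with h | h
  · refine .inr ⟨h, fun hv => ?_⟩
    have := (h₂ v hv).1
    rw [map_opsOf, List.filter_eq_nil_iff] at h
    exact h _ this (by simp [Label.isOpOf])
  · exact .inl h

theorem Functional.opsOf_eq (hA : A.Functional) {ρ : List (Label k × ℕ)}
    (h : A.AcceptingRun d ρ) (v : ℕ) :
    (opsOf v ρ).map Prod.fst = [Label.opn v, Label.cls v] ∨ (opsOf v ρ = [] ∧ v ∉ A.vars) := by
  obtain ⟨q, hq, h⟩ := h
  rw [← List.map_eq_nil_iff (f := Prod.fst), map_opsOf]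
  exact hA.filter_eq h.path hq v

/-- A criterion variable by variable, in the shape that the interleaving of two runs delivers. -/
theorem functional_of_opsOf_eq (h : ∀ d ρ, A.AcceptingRun d ρ → ∀ v,
    (opsOf v ρ).map Prod.fst = [Label.opn v, Label.cls v] ∨ (opsOf v ρ = [] ∧ v ∉ A.vars)) :
    A.Functional := by
  intro d ρ hρ
  refine ⟨(validRun_iff ρ).2 fun v => (h d ρ hρ v).symm.imp (fun h => by simp [h.1]) (fun h => h),
    fun v hv => ?_⟩
  rcases h d ρ hρ v with h | h
  · have hs : ∀ l, l ∈ (opsOf v ρ).map Prod.fst → l ∈ ρ.map Prod.fst := by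
      intro l
      rw [map_opsOf]
      exact fun h => (List.mem_filter.1 h).1
    rw [h] at hs
    exact ⟨hs _ (by simp), hs _ (by simp)⟩
  · exact absurd hv h.2

/-- An operation of a functional automaton occurs exactly once in an accepting path. -/
theorem Functional.not_mem_of_mem (hA : A.Functional) {ls ms : List (Label k)} {q : ℕ}
    (h : A.Path A.init (ls ++ ms) q) (hq : q ∈ A.accept) {l : Label k} (hl : l.IsOp)
    (hls : l ∈ ls) : l ∉ ms := by
  intro hms
  obtain ⟨v, hv⟩ := hl
  have h1 : 1 ≤ (ls.filter (Label.isOpOf v)).count l :=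
    List.count_pos_iff.2 (List.mem_filter.2 ⟨hls, hv⟩)
  have h2 : 1 ≤ (ms.filter (Label.isOpOf v)).count l :=
    List.count_pos_iff.2 (List.mem_filter.2 ⟨hms, hv⟩)
  have h3 : ((ls ++ ms).filter (Label.isOpOf v)).count l ≤ 1 := by
    rcases hA.filter_eq h hq v with h | h
    · rw [h]
      rcases Label.isOpOf_iff.1 hv with rfl | rfl <;> simp
    · rw [h.1]; simp
  rw [List.filter_append, List.count_append] at h3
  omega

theorem Functional.mem_of_mem (hA : A.Functional) {ls : List (Label k)} {q : ℕ}
    (h : A.Path A.init ls q) (hq : q ∈ A.accept) {l : Label k} (hl : l.IsOp)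
    {p r : ℕ} (ht : (p, l, r) ∈ A.trans) : l ∈ ls := by
  obtain ⟨v, hv⟩ := hl
  have hvars : v ∈ A.vars := by
    rcases Label.isOpOf_iff.1 hv with rfl | rfl
    exacts [⟨_, _, .inl ht⟩, ⟨_, _, .inr ht⟩]
  rcases hA.filter_eq h hq v with h | h
  · have : l ∈ ls.filter (Label.isOpOf v) := by
      rw [h]
      rcases Label.isOpOf_iff.1 hv with rfl | rfl <;> simp
    exact (List.mem_filter.1 this).1
  · exact absurd hvars h.2

end VA

theorem List.mem_sprod {α β : Type} {l : List α} {m : List β} {x : α × β} :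
    x ∈ l ×ˢ m ↔ x.1 ∈ l ∧ x.2 ∈ m := List.mem_product

/-! ### Components -/

section Runs

variable {k : ℕ}

theorem opsOf_cons_eps (v i : ℕ) (ρ : List (Label k × ℕ)) :
    opsOf v ((Label.eps, i) :: ρ) = opsOf v ρ := by
  simp [opsOf, Label.isOpOf]

theorem validRun_cons_eps (i : ℕ) (ρ : List (Label k × ℕ)) :
    VA.ValidRun ((Label.eps, i) :: ρ) ↔ VA.ValidRun ρ := by
  simp only [validRun_iff, opsOf_cons_eps]

theorem isRunMapping_cons_eps (i : ℕ) (ρ : List (Label k × ℕ)) (μ : Mapping) :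
    VA.IsRunMapping ((Label.eps, i) :: ρ) μ ↔ VA.IsRunMapping ρ μ := by
  simp [VA.IsRunMapping]

end Runs

namespace VA

variable {k : ℕ} {A B : VA k} {C : List (VA k)} {d : List (Fin k)}

namespace HasComponents

theorem eq_of_mem (h : A.HasComponents C) {B B' : VA k} (hB : B ∈ C) (hB' : B' ∈ C) {q : ℕ}
    (hq : q ∈ B.states) (hq' : q ∈ B'.states) : B = B' := by
  by_contra hne
  have : Std.Symm (fun B B' : VA k => List.Disjoint B.states B'.states) :=
    ⟨fun _ _ hd => List.Disjoint.symm hd⟩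
  exact h.disjoint.forall hB hB' hne hq hq'

theorem trans_of_mem (h : A.HasComponents C) (hB : B ∈ C) {p q : ℕ} {l : Label k}
    (hp : p ∈ B.states) : (p, l, q) ∈ A.trans ↔ (p, l, q) ∈ B.trans := by
  rw [h.trans_iff]
  constructor
  · rintro (⟨B', hB', ht⟩ | ⟨B', hB', ht⟩)
    · rwa [h.eq_of_mem hB hB' hp (B'.src_mem _ ht)]
    · simp only [Prod.mk.injEq] at ht
      rw [ht.1] at hp
      exact absurd hp (h.init_new B hB)
  · exact fun ht => .inl ⟨B, hB, ht⟩

theorem accept_of_mem (h : A.HasComponents C) (hB : B ∈ C) {q : ℕ} (hq : q ∈ B.states) :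
    q ∈ A.accept ↔ q ∈ B.accept := by
  rw [h.accept_iff]
  constructor
  · rintro ⟨B', hB', hq'⟩
    rwa [h.eq_of_mem hB hB' hq (B'.accept_mem _ hq')]
  · exact fun hq => ⟨B, hB, hq⟩

theorem trans_init (h : A.HasComponents C) {l : Label k} {q : ℕ} :
    (A.init, l, q) ∈ A.trans ↔ l = Label.eps ∧ ∃ B ∈ C, q = B.init := by
  rw [h.trans_iff]
  constructor
  · rintro (⟨B, hB, ht⟩ | ⟨B, hB, ht⟩)
    · exact absurd (B.src_mem _ ht) (h.init_new B hB)
    · simp only [Prod.mk.injEq, true_and] at ht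
      exact ⟨ht.1, B, hB, ht.2⟩
  · rintro ⟨rfl, B, hB, rfl⟩
    exact .inr ⟨B, hB, rfl⟩

/-- The initial state is not accepting and has only ε-transitions into components, and no component
can be left. An accepting run is thus an ε-step followed by an accepting run of one component, and
the ε-step affects neither validity nor the mapping. -/
theorem mem_eval (h : A.HasComponents C) {μ : Mapping} :
    μ ∈ A.eval d ↔ ∃ B ∈ C, μ ∈ B.eval d := by
  constructor
  · rintro ⟨ρ, ⟨q, hq, hs⟩, hv, hm⟩
    -- The final index is made a variable so that case analysis on the steps can unify it.
    obtain ⟨n, hn⟩ : ∃ n, d.length + 1 = n := ⟨_, rfl⟩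
    have first : ∀ {l : Label k} {q' i : ℕ} {ρ' : List (Label k × ℕ)},
        (A.init, l, q') ∈ A.trans → A.Steps d q' i ρ' q n →
        l = Label.eps ∧ ∃ B ∈ C, B.Steps d B.init i ρ' q n ∧ q ∈ B.accept := by
      intro l q' i ρ' ht hs
      obtain ⟨rfl, B, hB, rfl⟩ := h.trans_init.1 ht
      obtain ⟨h₁, h₂⟩ := hs.congr (B := B) (S := {p | p ∈ B.states}) (fun p hp l q ht =>
        have ht := (h.trans_of_mem hB hp).1 ht
        ⟨ht, B.dst_mem _ ht⟩) B.init_mem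
      exact ⟨rfl, B, hB, h₁, (h.accept_of_mem hB h₂).1 hq⟩
    rw [hn] at hs
    cases hs with
    | refl =>
      obtain ⟨B, hB, hq⟩ := (h.accept_iff _).1 hq
      exact absurd (B.accept_mem _ hq) (h.init_new B hB)
    | eps ht hs =>
      obtain ⟨-, B, hB, hs, hq⟩ := first ht hs
      exact ⟨B, hB, _, ⟨q, hq, hn ▸ hs⟩, (validRun_cons_eps _ _).1 hv,
        (isRunMapping_cons_eps _ _ _).1 hm⟩
    | letter ht _ hs | opn ht hs | cls ht hs => exact absurd (first ht hs).1 (by simp)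
  · rintro ⟨B, hB, ρ, ⟨q, hq, hs⟩, hv, hm⟩
    obtain ⟨h₁, -⟩ := hs.congr (B := A) (S := {p | p ∈ B.states}) (fun p hp l q ht =>
      ⟨(h.trans_of_mem hB hp).2 ht, B.dst_mem _ ht⟩) B.init_mem
    exact ⟨_, ⟨q, (h.accept_iff q).2 ⟨B, hB, hq⟩,
      .eps (h.trans_init.2 ⟨rfl, B, hB, rfl⟩) h₁⟩, (validRun_cons_eps _ _).2 hv,
      (isRunMapping_cons_eps _ _ _).2 hm⟩

end HasComponents

end VA

/-! ### The part of an automaton that is reached from a state -/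

/-- The data of a vset-automaton: states, initial state, accepting states, transitions. -/
abbrev RawVA (k : ℕ) : Type := List ℕ × ℕ × List ℕ × List (ℕ × Label k × ℕ)

namespace RawVA

variable {k : ℕ}

/-- The data present a vset-automaton. -/
structure WF (X : RawVA k) : Prop where
  init_mem : X.2.1 ∈ X.1
  accept_mem : ∀ q ∈ X.2.2.1, q ∈ X.1
  src_mem : ∀ t ∈ X.2.2.2, t.1 ∈ X.1
  dst_mem : ∀ t ∈ X.2.2.2, t.2.2 ∈ X.1

/-- The states reached from `s`. -/
def reach (X : RawVA k) (s : ℕ) : List ℕ :=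
  s :: reachClosure X.1 (fun a => decide (a = s)) fun p q =>
    X.2.2.2.any fun t => decide (t.1 = p) && decide (t.2.2 = q)

/-- The part that is reached from `s`, with initial state `s`. -/
def sub (X : RawVA k) (s : ℕ) : RawVA k :=
  (X.reach s, s, X.2.2.1.filter (fun q => decide (q ∈ X.reach s)),
    X.2.2.2.filter fun t => decide (t.1 ∈ X.reach s) && decide (t.2.2 ∈ X.reach s))

/-- `reach` lists `s` explicitly, so this holds even if `s` is not a state, and the construction is
total on raw data. -/
theorem sub_wf (X : RawVA k) (s : ℕ) : (X.sub s).WF where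
  init_mem := by simp [sub, reach]
  accept_mem q hq := by
    simp only [sub, List.mem_filter, decide_eq_true_eq] at hq
    exact hq.2
  src_mem t ht := by
    simp only [sub, List.mem_filter, Bool.and_eq_true, decide_eq_true_eq] at ht
    exact ht.2.1
  dst_mem t ht := by
    simp only [sub, List.mem_filter, Bool.and_eq_true, decide_eq_true_eq] at ht
    exact ht.2.2

end RawVA

namespace VA

variable {k : ℕ} {A B : VA k} {C : List (VA k)} {d : List (Fin k)}

/-- The data of an automaton. -/
def raw (A : VA k) : RawVA k := (A.states, A.init, A.accept, A.trans)

/-- The automaton with the given data. -/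
def ofRaw (X : RawVA k) (h : X.WF) : VA k :=
  ⟨X.1, X.2.1, X.2.2.1, X.2.2.2, h.init_mem, h.accept_mem, h.src_mem, h.dst_mem⟩

theorem raw_wf (A : VA k) : A.raw.WF := ⟨A.init_mem, A.accept_mem, A.src_mem, A.dst_mem⟩

theorem mem_reach {s q : ℕ} (hs : s ∈ A.states) :
    q ∈ A.raw.reach s ↔ Relation.ReflTransGen A.Edge s q := by
  have e : ∀ p q, (A.raw.2.2.2.any fun t => decide (t.1 = p) && decide (t.2.2 = q)) = true ↔
      A.Edge p q := by
    intro p q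
    simp only [raw, List.any_eq_true, Bool.and_eq_true, decide_eq_true_eq, Edge]
    constructor
    · rintro ⟨⟨_, l, _⟩, h, rfl, rfl⟩
      exact ⟨l, h⟩
    · rintro ⟨l, h⟩
      exact ⟨_, h, rfl, rfl⟩
  simp only [RawVA.reach, List.mem_cons, mem_reachClosure, e, decide_eq_true_eq]
  constructor
  · rintro (rfl | ⟨_, _, rfl, h⟩)
    · exact .refl
    · exact Relation.ReflTransGen.mono (fun _ _ h => h.1) _ _ h
  · refine fun h => .inr ⟨s, hs, rfl, Relation.ReflTransGen.mono (fun p q h => ⟨h, ?_⟩) _ _ h⟩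
    obtain ⟨l, h⟩ := h
    exact A.dst_mem _ h

/-- The part of `A` that is reached from `s`, with initial state `s`. -/
def sub (A : VA k) (s : ℕ) : VA k := ofRaw (A.raw.sub s) (A.raw.sub_wf s)

@[simp] theorem sub_init (A : VA k) (s : ℕ) : (A.sub s).init = s := rfl

theorem mem_sub_states {s q : ℕ} (hs : s ∈ A.states) :
    q ∈ (A.sub s).states ↔ Relation.ReflTransGen A.Edge s q := mem_reach hs

theorem mem_sub_accept {s q : ℕ} :
    q ∈ (A.sub s).accept ↔ q ∈ A.accept ∧ q ∈ (A.sub s).states := by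
  simp only [sub, ofRaw, RawVA.sub, List.mem_filter, decide_eq_true_eq]
  rfl

theorem mem_sub_trans {s : ℕ} {t : ℕ × Label k × ℕ} : t ∈ (A.sub s).trans ↔
    t ∈ A.trans ∧ t.1 ∈ (A.sub s).states ∧ t.2.2 ∈ (A.sub s).states := by
  simp only [sub, ofRaw, RawVA.sub, List.mem_filter, Bool.and_eq_true, decide_eq_true_eq]
  rfl

/-- All states are reached from the initial state. -/
def Trim (A : VA k) : Prop := ∀ q ∈ A.states, Relation.ReflTransGen A.Edge A.init q

theorem sub_trim {s : ℕ} (hs : s ∈ A.states) : (A.sub s).Trim := by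
  intro q hq
  rw [mem_sub_states hs] at hq
  rw [sub_init]
  induction hq with
  | refl => exact .refl
  | tail h₁ h₂ ih =>
    obtain ⟨l, h⟩ := h₂
    refine ih.tail ⟨l, mem_sub_trans.2 ⟨h, (mem_sub_states hs).2 h₁, (mem_sub_states hs).2 ?_⟩⟩
    exact h₁.tail ⟨l, h⟩

namespace HasComponents

theorem init_mem_states (h : A.HasComponents C) (hB : B ∈ C) : B.init ∈ A.states :=
  (h.states_iff _).2 (.inr ⟨B, hB, B.init_mem⟩)

theorem sub_states_subset (h : A.HasComponents C) (hB : B ∈ C) {q : ℕ}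
    (hq : q ∈ (A.sub B.init).states) : q ∈ B.states := by
  rw [mem_sub_states (h.init_mem_states hB)] at hq
  induction hq with
  | refl => exact B.init_mem
  | tail _ h₂ ih =>
    obtain ⟨l, ht⟩ := h₂
    exact B.dst_mem _ ((h.trans_of_mem hB ih).1 ht)

/-- Runs from the initial state of a component stay in the component and visit reachable states
only. The reachable part can be computed from `A` alone, without knowledge of the decomposition, and
may stand in for the component. -/
theorem sub_acceptingRun (h : A.HasComponents C) (hB : B ∈ C) {ρ : List (Label k × ℕ)} :
    (A.sub B.init).AcceptingRun d ρ ↔ B.AcceptingRun d ρ := by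
  have hi := h.init_mem_states hB
  constructor
  · rintro ⟨q, hq, hs⟩
    obtain ⟨h₁, h₂⟩ := hs.congr (B := B) (S := {p | p ∈ (A.sub B.init).states})
      (fun p hp l q ht => ⟨(h.trans_of_mem hB (h.sub_states_subset hB hp)).1
        (mem_sub_trans.1 ht).1, (A.sub B.init).dst_mem _ ht⟩) (A.sub B.init).init_mem
    exact ⟨q, (h.accept_of_mem hB (h.sub_states_subset hB h₂)).1 (mem_sub_accept.1 hq).1, h₁⟩
  · rintro ⟨q, hq, hs⟩
    obtain ⟨h₁, h₂⟩ := hs.congr (B := A.sub B.init) (S := {p | p ∈ (A.sub B.init).states})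
      (fun p hp l q ht => by
        have ht' := (h.trans_of_mem hB (h.sub_states_subset hB hp)).2 ht
        have hq : q ∈ (A.sub B.init).states :=
          (mem_sub_states hi).2 (((mem_sub_states hi).1 hp).tail ⟨l, ht'⟩)
        exact ⟨mem_sub_trans.2 ⟨ht', hp, hq⟩, hq⟩) (A.sub B.init).init_mem
    exact ⟨q, mem_sub_accept.2 ⟨(h.accept_of_mem hB (B.accept_mem _ hq)).2 hq, h₂⟩, h₁⟩

theorem sub_eval (h : A.HasComponents C) (hB : B ∈ C) : (A.sub B.init).eval = B.eval := by
  funext d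
  ext μ
  simp only [eval, Set.mem_ofPred_eq, h.sub_acceptingRun hB]

theorem sub_functional (h : A.HasComponents C) (hB : B ∈ C) : (A.sub B.init).Functional := by
  intro d ρ hρ
  obtain ⟨h₁, h₂⟩ := h.functional B hB d ρ ((h.sub_acceptingRun hB).1 hρ)
  refine ⟨h₁, fun v hv => h₂ v ?_⟩
  have key : ∀ {t}, t ∈ (A.sub B.init).trans → t ∈ B.trans := fun ht =>
    have ht := mem_sub_trans.1 ht
    (h.trans_of_mem hB (h.sub_states_subset hB ht.2.1)).1 ht.1
  obtain ⟨p, q, hv⟩ := hv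
  exact ⟨p, q, hv.imp key key⟩

end HasComponents

end VA

/-! ### The product of two automata -/

namespace Label

variable {k : ℕ}

/-- The tag of a label. -/
def tag : Label k → ℕ
  | eps => 0
  | letter _ => 1
  | opn _ => 2
  | cls _ => 3

/-- The argument of a label. -/
def arg : Label k → ℕ
  | eps => 0
  | letter a => a.val
  | opn v => v
  | cls v => v

/-- Whether a label is a variable operation. -/
def isOp (l : Label k) : Bool := decide (l.tag = 2) || decide (l.tag = 3)

theorem isOp_iff {l : Label k} : l.isOp = true ↔ l.IsOp := by
  cases l <;> simp [isOp, tag, IsOp, isOpOf]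

theorem tag_eq_one_iff {l : Label k} : l.tag = 1 ↔ l.IsLetter := by
  cases l <;> simp [tag, IsLetter]

theorem IsOp.not_isLetter {l : Label k} (h : l.IsOp) : ¬ l.IsLetter := by
  rintro ⟨a, rfl⟩
  obtain ⟨v, hv⟩ := h
  simp [isOpOf] at hv

end Label

namespace RawVA

variable {k : ℕ}

/-- Whether some transition has the label `l`. -/
def hasLabel (X : RawVA k) (l : Label k) : Bool := X.2.2.2.any fun t => decide (t.2.1 = l)

/-- Whether some path to `q` has a transition with the label `l`. -/
def done (X : RawVA k) (q : ℕ) (l : Label k) : Bool :=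
  X.2.2.2.any fun t => decide (t.2.1 = l) && decide (q ∈ X.reach t.2.2)

/-- Whether the same common operations have been done at the states `p` and `q`. -/
def compat (X Y : RawVA k) (p q : ℕ) : Bool :=
  X.2.2.2.all fun t => !(t.2.1.isOp && Y.hasLabel t.2.1) ||
    decide (X.done p t.2.1 = Y.done q t.2.1)

/-- The name of the state `(p, q)` of the product. -/
def pairName (X Y : RawVA k) (p q : ℕ) : ℕ := nameOf [X.2.1, Y.2.1, p, q]

/-- The transitions of the product: letters are read synchronously by states that are
compatible; the operations that the second automaton shares with the first one are silent. -/
def prodTrans (X Y : RawVA k) : List (ℕ × Label k × ℕ) :=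
  ((X.2.2.2 ×ˢ Y.2.2.2).filter fun z => decide (z.1.2.1 = z.2.2.1) &&
      (decide (z.1.2.1.tag = 1) && X.compat Y z.1.1 z.2.1)).map
    (fun z => (X.pairName Y z.1.1 z.2.1, z.1.2.1, X.pairName Y z.1.2.2 z.2.2.2)) ++
  (((X.2.2.2.filter fun t => !decide (t.2.1.tag = 1)) ×ˢ Y.1).map
    (fun z => (X.pairName Y z.1.1 z.2, z.1.2.1, X.pairName Y z.1.2.2 z.2)) ++
  (X.1 ×ˢ (Y.2.2.2.filter fun t => !decide (t.2.1.tag = 1))).map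
    (fun z => (X.pairName Y z.1 z.2.1, if X.hasLabel z.2.2.1 then Label.eps else z.2.2.1,
      X.pairName Y z.1 z.2.2.2)))

/-- The product. -/
def prod (X Y : RawVA k) : RawVA k :=
  ((X.1 ×ˢ Y.1).map (fun z => X.pairName Y z.1 z.2), X.pairName Y X.2.1 Y.2.1,
    (X.2.2.1 ×ˢ Y.2.2.1).map (fun z => X.pairName Y z.1 z.2), X.prodTrans Y)

theorem mem_prodTrans {X Y : RawVA k} {P Q : ℕ} {l : Label k} :
    (P, l, Q) ∈ X.prodTrans Y ↔
      (∃ p p' q q', l.IsLetter ∧ (p, l, p') ∈ X.2.2.2 ∧ (q, l, q') ∈ Y.2.2.2 ∧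
        X.compat Y p q = true ∧ P = X.pairName Y p q ∧ Q = X.pairName Y p' q') ∨
      (∃ p p' q, ¬ l.IsLetter ∧ (p, l, p') ∈ X.2.2.2 ∧ q ∈ Y.1 ∧
        P = X.pairName Y p q ∧ Q = X.pairName Y p' q) ∨
      (∃ p q q' l', ¬ l'.IsLetter ∧ (q, l', q') ∈ Y.2.2.2 ∧ p ∈ X.1 ∧
        l = (if X.hasLabel l' then Label.eps else l') ∧
        P = X.pairName Y p q ∧ Q = X.pairName Y p q') := by
  rw [prodTrans, List.mem_append, List.mem_append]
  refine or_congr ?_ (or_congr ?_ ?_)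
  · simp only [List.mem_map, List.mem_filter, Prod.exists, List.mem_sprod,
      Bool.and_eq_true, decide_eq_true_eq, Prod.mk.injEq, Label.tag_eq_one_iff]
    constructor
    · rintro ⟨p, l, p', q, _, q', ⟨⟨h₁, h₂⟩, rfl, h₃, h₄⟩, rfl, rfl, rfl⟩
      exact ⟨p, p', q, q', h₃, h₁, h₂, h₄, rfl, rfl⟩
    · rintro ⟨p, p', q, q', h₃, h₁, h₂, h₄, rfl, rfl⟩
      exact ⟨p, l, p', q, l, q', ⟨⟨h₁, h₂⟩, rfl, h₃, h₄⟩, rfl, rfl, rfl⟩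
  · simp only [List.mem_map, List.mem_filter, Prod.exists, List.mem_sprod,
      Bool.not_eq_true', decide_eq_false_iff_not, Prod.mk.injEq, Label.tag_eq_one_iff]
    constructor
    · rintro ⟨p, l, p', q, ⟨⟨h₁, h₂⟩, h₃⟩, rfl, rfl, rfl⟩
      exact ⟨p, p', q, h₂, h₁, h₃, rfl, rfl⟩
    · rintro ⟨p, p', q, h₂, h₁, h₃, rfl, rfl⟩
      exact ⟨p, l, p', q, ⟨⟨h₁, h₂⟩, h₃⟩, rfl, rfl, rfl⟩
  · simp only [List.mem_map, List.mem_filter, Prod.exists, List.mem_sprod,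
      Bool.not_eq_true', decide_eq_false_iff_not, Prod.mk.injEq, Label.tag_eq_one_iff]
    constructor
    · rintro ⟨p, q, l', q', ⟨h₁, h₂, h₃⟩, rfl, rfl, rfl⟩
      exact ⟨p, q, q', l', h₃, h₂, h₁, rfl, rfl, rfl⟩
    · rintro ⟨p, q, q', l', h₃, h₂, h₁, rfl, rfl, rfl⟩
      exact ⟨p, q, l', q', ⟨h₁, h₂, h₃⟩, rfl, rfl, rfl⟩

theorem prod_wf {X Y : RawVA k} (hX : X.WF) (hY : Y.WF) : (X.prod Y).WF := by
  have hmem : ∀ {p q}, p ∈ X.1 → q ∈ Y.1 → X.pairName Y p q ∈ (X.prod Y).1 := fun hp hq =>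
    List.mem_map.2 ⟨(_, _), List.mem_sprod.2 ⟨hp, hq⟩, rfl⟩
  have htr : ∀ t ∈ (X.prod Y).2.2.2, t.1 ∈ (X.prod Y).1 ∧ t.2.2 ∈ (X.prod Y).1 := by
    rintro ⟨P, l, Q⟩ ht
    rcases mem_prodTrans.1 ht with ⟨p, p', q, q', -, h₁, h₂, -, rfl, rfl⟩ |
      ⟨p, p', q, -, h₁, h₂, rfl, rfl⟩ | ⟨p, q, q', l', -, h₁, h₂, -, rfl, rfl⟩
    · exact ⟨hmem (hX.src_mem _ h₁) (hY.src_mem _ h₂), hmem (hX.dst_mem _ h₁) (hY.dst_mem _ h₂)⟩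
    · exact ⟨hmem (hX.src_mem _ h₁) h₂, hmem (hX.dst_mem _ h₁) h₂⟩
    · exact ⟨hmem h₂ (hY.src_mem _ h₁), hmem h₂ (hY.dst_mem _ h₁)⟩
  refine ⟨hmem hX.init_mem hY.init_mem, fun q hq => ?_, fun t ht => (htr t ht).1,
    fun t ht => (htr t ht).2⟩
  obtain ⟨⟨a, b⟩, h, rfl⟩ := List.mem_map.1 hq
  have h := List.mem_sprod.1 h
  exact hmem (hX.accept_mem _ h.1) (hY.accept_mem _ h.2)

theorem pairName_inj {X Y : RawVA k} {p q p' q' : ℕ} :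
    X.pairName Y p q = X.pairName Y p' q' ↔ p = p' ∧ q = q' := by
  rw [pairName, pairName, nameOf_injective.eq_iff]
  simp

end RawVA

/-! ### Runs of the product -/

namespace VA

variable {k : ℕ} {A B : VA k} {d : List (Fin k)}

theorem Steps.other {p q r i j : ℕ} {l : Label k} {ρ : List (Label k × ℕ)}
    (hl : ¬ l.IsLetter) (ht : (p, l, q) ∈ A.trans) (h : A.Steps d q i ρ r j) :
    A.Steps d p i ((l, i) :: ρ) r j := by
  cases l with
  | eps => exact .eps ht h
  | letter a => exact absurd ⟨a, rfl⟩ hl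
  | opn v => exact .opn ht h
  | cls v => exact .cls ht h

/-- Induction on sequences of steps, the steps that read no letter being treated alike. -/
@[elab_as_elim]
theorem Steps.induction
    {motive : ∀ (p i : ℕ) (ρ : List (Label k × ℕ)) (q j : ℕ), A.Steps d p i ρ q j → Prop}
    (refl : ∀ q i, motive q i [] q i (.refl q i))
    (other : ∀ {p q r i j l ρ} (hl : ¬ l.IsLetter) (ht : (p, l, q) ∈ A.trans)
      (h : A.Steps d q i ρ r j), motive q i ρ r j h →
      motive p i ((l, i) :: ρ) r j (h.other hl ht))
    (letter : ∀ {p q r i j a ρ} (ht : (p, Label.letter a, q) ∈ A.trans)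
      (hd : d[i - 1]? = some a) (h : A.Steps d q (i + 1) ρ r j), motive q (i + 1) ρ r j h →
      motive p i ((Label.letter a, i + 1) :: ρ) r j (.letter ht hd h))
    {p i : ℕ} {ρ : List (Label k × ℕ)} {q j : ℕ} (h : A.Steps d p i ρ q j) :
    motive p i ρ q j h := by
  induction h with
  | refl => exact refl _ _
  | eps ht h ih | opn ht h ih | cls ht h ih =>
    exact other (by simp [Label.IsLetter]) ht h ih
  | letter ht hd h ih => exact letter ht hd h ih

theorem Steps.head_cases {p i : ℕ} {ρ : List (Label k × ℕ)} {q j : ℕ}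
    (h : A.Steps d p i ρ q j) :
    (ρ = [] ∧ p = q ∧ i = j) ∨
    (∃ l p' ρ', ¬ l.IsLetter ∧ (p, l, p') ∈ A.trans ∧ ρ = (l, i) :: ρ' ∧
      A.Steps d p' i ρ' q j) ∨
    (∃ a p' ρ', (p, Label.letter a, p') ∈ A.trans ∧ d[i - 1]? = some a ∧
      ρ = (Label.letter a, i + 1) :: ρ' ∧ A.Steps d p' (i + 1) ρ' q j) := by
  induction h using Steps.induction with
  | refl => exact .inl ⟨rfl, rfl, rfl⟩
  | other hl ht h => exact .inr (.inl ⟨_, _, _, hl, ht, rfl, h⟩)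
  | letter ht hd h => exact .inr (.inr ⟨_, _, _, ht, hd, rfl, h⟩)

theorem Path.mem_states {p q : ℕ} {ls : List (Label k)} (h : A.Path p ls q)
    (hp : p ∈ A.states) : q ∈ A.states := by
  induction h with
  | refl => exact hp
  | cons ht _ ih => exact ih (A.dst_mem _ ht)

theorem Path.singleton {p q : ℕ} {l : Label k} (h : (p, l, q) ∈ A.trans) : A.Path p [l] q :=
  .cons h (.refl _)

theorem hasLabel_iff {l : Label k} :
    A.raw.hasLabel l = true ↔ ∃ p q, (p, l, q) ∈ A.trans := by
  simp only [RawVA.hasLabel, raw, List.any_eq_true, decide_eq_true_eq, Prod.exists]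
  constructor
  · rintro ⟨p, _, q, h, rfl⟩; exact ⟨p, q, h⟩
  · rintro ⟨p, q, h⟩; exact ⟨p, l, q, h, rfl⟩

theorem done_iff {q : ℕ} {l : Label k} : A.raw.done q l = true ↔
    ∃ p p', (p, l, p') ∈ A.trans ∧ Relation.ReflTransGen A.Edge p' q := by
  simp only [RawVA.done, List.any_eq_true, Bool.and_eq_true, decide_eq_true_eq, Prod.exists]
  constructor
  · rintro ⟨p, _, p', h, rfl, hq⟩
    exact ⟨p, p', h, (mem_reach (A.dst_mem _ h)).1 hq⟩
  · rintro ⟨p, p', h, hq⟩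
    exact ⟨p, l, p', h, rfl, (mem_reach (A.dst_mem _ h)).2 hq⟩

theorem compat_iff {p q : ℕ} : A.raw.compat B.raw p q = true ↔
    ∀ l : Label k, l.IsOp → A.raw.hasLabel l = true → B.raw.hasLabel l = true →
      (A.raw.done p l = true ↔ B.raw.done q l = true) := by
  simp only [RawVA.compat, List.all_eq_true, Bool.or_eq_true, Bool.not_eq_true',
    decide_eq_true_eq, Bool.and_eq_false_imp, Label.isOp_iff, ← Bool.eq_iff_iff]
  constructor
  · intro h l hl hA hB
    obtain ⟨p, q, ht⟩ := hasLabel_iff.1 hA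
    rcases h (p, l, q) ht with h | h
    · rw [h hl] at hB; cases hB
    · exact h
  · intro h t ht
    by_cases hl : t.2.1.IsOp
    · cases hB : B.raw.hasLabel t.2.1
      · exact .inl fun _ => rfl
      · exact .inr (h _ hl (hasLabel_iff.2 ⟨_, _, ht⟩) hB)
    · exact .inl fun h => absurd h hl

/-- On an accepting path, the operations that have been done are those before the state. -/
theorem Functional.done_iff_notMem (hA : A.Functional) (hT : A.Trim) {p q : ℕ}
    {ls ms : List (Label k)} (h : A.Path A.init ls p) (h' : A.Path p ms q) (hq : q ∈ A.accept)
    {l : Label k} (hl : l.IsOp) (hlA : A.raw.hasLabel l = true) :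
    A.raw.done p l = true ↔ l ∉ ms := by
  rw [done_iff]
  constructor
  · rintro ⟨r, r', ht, hr⟩
    -- Trimness supplies a path from the initial state to the transition labelled `l`. Continued
    -- through `p` along `ms` it is accepting and already contains `l`, so `l` cannot occur again in
    -- `ms`.
    obtain ⟨ls₁, h₁⟩ := exists_path (hT r (A.src_mem _ ht))
    obtain ⟨ls₂, h₂⟩ := exists_path hr
    refine hA.not_mem_of_mem (ls := ls₁ ++ ([l] ++ ls₂)) ?_ hq hl (by simp)
    exact (h₁.append ((Path.singleton ht).append h₂)).append h'
  · intro hms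
    -- Every labelled operation occurs on an accepting path; if not after `p`, then before it.
    obtain ⟨r, r', ht⟩ := hasLabel_iff.1 hlA
    have := hA.mem_of_mem (h.append h') hq hl ht
    obtain ⟨p₁, p₂, _, ls₂, -, h₂, h₃⟩ := h.split ((List.mem_append.1 this).resolve_right hms)
    exact ⟨p₁, p₂, h₂, h₃.reach⟩

/-- `A.Shuffle ρ₁ ρ₂ ρ`: the run `ρ` interleaves the runs `ρ₁` of `A` and `ρ₂`, letters being
read synchronously and operations of `ρ₂` that occur in `A` being silent. -/
inductive Shuffle (A : VA k) :
    List (Label k × ℕ) → List (Label k × ℕ) → List (Label k × ℕ) → Prop where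
  | nil : Shuffle A [] [] []
  | left {l : Label k} {i : ℕ} {ρ₁ ρ₂ ρ : List (Label k × ℕ)} :
      A.raw.hasLabel l = true → Shuffle A ρ₁ ρ₂ ρ → Shuffle A ((l, i) :: ρ₁) ρ₂ ((l, i) :: ρ)
  | right {l : Label k} {i : ℕ} {ρ₁ ρ₂ ρ : List (Label k × ℕ)} :
      Shuffle A ρ₁ ρ₂ ρ → Shuffle A ρ₁ ((l, i) :: ρ₂)
        ((if A.raw.hasLabel l then Label.eps else l, i) :: ρ)
  | both {a : Fin k} {i : ℕ} {ρ₁ ρ₂ ρ : List (Label k × ℕ)} :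
      Shuffle A ρ₁ ρ₂ ρ → Shuffle A ((Label.letter a, i) :: ρ₁) ((Label.letter a, i) :: ρ₂)
        ((Label.letter a, i) :: ρ)

/-- For each variable, one of the two runs contributes all operations: the first if its automaton
has the label, for then those of the second are silent. The hypothesis `hv` makes opening and
closing follow the same rule. -/
theorem Shuffle.opsOf_eq {ρ₁ ρ₂ ρ : List (Label k × ℕ)} (h : A.Shuffle ρ₁ ρ₂ ρ) (v : ℕ)
    (hv : A.raw.hasLabel (Label.opn v) = A.raw.hasLabel (Label.cls v)) :
    opsOf v ρ = if A.raw.hasLabel (Label.opn v) then opsOf v ρ₁ else opsOf v ρ₂ := by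
  have hcons : ∀ (l : Label k) i σ, opsOf v ((l, i) :: σ) =
      if l.isOpOf v then (l, i) :: opsOf v σ else opsOf v σ := fun l i σ => by
    simp [opsOf, List.filter_cons]
  have hle : ∀ (l : Label k), l.isOpOf v = true →
      A.raw.hasLabel l = A.raw.hasLabel (Label.opn v) := by
    intro l hl
    rcases Label.isOpOf_iff.1 hl with rfl | rfl
    exacts [rfl, hv.symm]
  have heps : (Label.eps : Label k).isOpOf v = false := by simp [Label.isOpOf]
  induction h with
  | nil => simp [opsOf]
  | @left l i ρ₁ ρ₂ ρ hA _ ih =>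
    rw [hcons, hcons, ih]
    by_cases hl : l.isOpOf v = true
    · rw [hle l hl] at hA
      simp [hl, hA]
    · simp [hl]
  | @right l i ρ₁ ρ₂ ρ _ ih =>
    rw [hcons, hcons, ih]
    by_cases hl : l.isOpOf v = true
    · have hA := hle l hl
      cases h : A.raw.hasLabel (Label.opn v) <;> simp [hl, hA, h, heps]
    · cases h : A.raw.hasLabel l <;> simp [hl, heps]
  | @both a i ρ₁ ρ₂ ρ _ ih =>
    rw [hcons, hcons, hcons, ih]
    simp [Label.isOpOf]

/-- The product of two automata. -/
def prod (A B : VA k) : VA k := ofRaw (A.raw.prod B.raw) (RawVA.prod_wf A.raw_wf B.raw_wf)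

theorem mem_prod_trans {P Q : ℕ} {l : Label k} : (P, l, Q) ∈ (A.prod B).trans ↔
      (∃ p p' q q', l.IsLetter ∧ (p, l, p') ∈ A.trans ∧ (q, l, q') ∈ B.trans ∧
        A.raw.compat B.raw p q = true ∧ P = A.raw.pairName B.raw p q ∧
        Q = A.raw.pairName B.raw p' q') ∨
      (∃ p p' q, ¬ l.IsLetter ∧ (p, l, p') ∈ A.trans ∧ q ∈ B.states ∧
        P = A.raw.pairName B.raw p q ∧ Q = A.raw.pairName B.raw p' q) ∨
      (∃ p q q' l', ¬ l'.IsLetter ∧ (q, l', q') ∈ B.trans ∧ p ∈ A.states ∧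
        l = (if A.raw.hasLabel l' then Label.eps else l') ∧
        P = A.raw.pairName B.raw p q ∧ Q = A.raw.pairName B.raw p q') :=
  RawVA.mem_prodTrans

theorem mem_prod_states {P : ℕ} : P ∈ (A.prod B).states ↔
    ∃ p ∈ A.states, ∃ q ∈ B.states, P = A.raw.pairName B.raw p q := by
  simp only [prod, ofRaw, RawVA.prod, List.mem_map, List.mem_sprod, Prod.exists]
  constructor
  · rintro ⟨p, q, ⟨hp, hq⟩, rfl⟩; exact ⟨p, hp, q, hq, rfl⟩
  · rintro ⟨p, hp, q, hq, rfl⟩; exact ⟨p, q, ⟨hp, hq⟩, rfl⟩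

theorem mem_prod_accept {P : ℕ} : P ∈ (A.prod B).accept ↔
    ∃ p ∈ A.accept, ∃ q ∈ B.accept, P = A.raw.pairName B.raw p q := by
  simp only [prod, ofRaw, RawVA.prod, List.mem_map, List.mem_sprod, Prod.exists]
  constructor
  · rintro ⟨p, q, ⟨hp, hq⟩, rfl⟩; exact ⟨p, hp, q, hq, rfl⟩
  · rintro ⟨p, hp, q, hq, rfl⟩; exact ⟨p, q, ⟨hp, hq⟩, rfl⟩

/-- At each letter, both runs are cut at compatible states. -/
def Synchronized (A B : VA k) (d : List (Fin k)) (p q i : ℕ) (ρ₁ ρ₂ : List (Label k × ℕ))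
    (p' q' j : ℕ) : Prop :=
  ∀ m, i ≤ m → m < j → ∃ r s σ₁ τ₁ σ₂ τ₂, ρ₁ = σ₁ ++ τ₁ ∧ ρ₂ = σ₂ ++ τ₂ ∧
    A.Steps d p i σ₁ r m ∧ A.Steps d r m τ₁ p' j ∧
    B.Steps d q i σ₂ s m ∧ B.Steps d s m τ₂ q' j ∧
    (∀ e ∈ τ₁, m < e.2) ∧ (∀ e ∈ τ₂, m < e.2) ∧ A.raw.compat B.raw r s = true

/-- Each product step projects to a step of one factor, or of both at a letter. The cuts demanded at
later letters are inherited by prepending the projected step, and the test on a letter transition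
provides the cut at that letter. -/
theorem prod_steps_sound {P Q i j : ℕ} {ρ : List (Label k × ℕ)}
    (h : (A.prod B).Steps d P i ρ Q j) : ∀ p q, P = A.raw.pairName B.raw p q →
    ∃ p' q' ρ₁ ρ₂, Q = A.raw.pairName B.raw p' q' ∧ A.Steps d p i ρ₁ p' j ∧
      B.Steps d q i ρ₂ q' j ∧ A.Shuffle ρ₁ ρ₂ ρ ∧ Synchronized A B d p q i ρ₁ ρ₂ p' q' j := by
  induction h using Steps.induction with
  | refl Q i =>
    intro p q hP
    exact ⟨p, q, [], [], hP, .refl _ _, .refl _ _, .nil, fun m h₁ h₂ => by omega⟩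
  | @other P Q R i j l ρ hl ht h ih =>
    rintro p q rfl
    rcases mem_prod_trans.1 ht with ⟨_, _, _, _, h, _⟩ | ⟨p₁, p₂, q₁, h₁, h₂, h₃, e, rfl⟩ |
      ⟨p₁, q₁, q₂, l', h₁, h₂, h₃, rfl, e, rfl⟩
    · exact absurd h hl
    · obtain ⟨rfl, rfl⟩ := RawVA.pairName_inj.1 e
      obtain ⟨p', q', ρ₁, ρ₂, rfl, s₁, s₂, sh, sy⟩ := ih p₂ q rfl
      refine ⟨p', q', (l, i) :: ρ₁, ρ₂, rfl, s₁.other h₁ h₂, s₂,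
        .left (hasLabel_iff.2 ⟨_, _, h₂⟩) sh, fun m hm hm' => ?_⟩
      obtain ⟨r, s, σ₁, τ₁, σ₂, τ₂, rfl, rfl, h₄, h₅, h₆⟩ := sy m hm hm'
      exact ⟨r, s, (l, i) :: σ₁, τ₁, σ₂, τ₂, rfl, rfl, h₄.other h₁ h₂, h₅, h₆⟩
    · obtain ⟨rfl, rfl⟩ := RawVA.pairName_inj.1 e
      obtain ⟨p', q', ρ₁, ρ₂, rfl, s₁, s₂, sh, sy⟩ := ih p q₂ rfl
      refine ⟨p', q', ρ₁, (l', i) :: ρ₂, rfl, s₁, s₂.other h₁ h₂, .right sh,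
        fun m hm hm' => ?_⟩
      obtain ⟨r, s, σ₁, τ₁, σ₂, τ₂, rfl, rfl, h₄, h₅, h₆, h₇⟩ := sy m hm hm'
      exact ⟨r, s, σ₁, τ₁, (l', i) :: σ₂, τ₂, rfl, rfl, h₄, h₅, h₆.other h₁ h₂, h₇⟩
  | @letter P Q R i j a ρ ht hd h ih =>
    rintro p q rfl
    rcases mem_prod_trans.1 ht with ⟨p₁, p₂, q₁, q₂, -, h₁, h₂, h₃, e, rfl⟩ |
      ⟨_, _, _, h, _⟩ | ⟨_, _, _, l', h, _, _, e, _⟩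
    · obtain ⟨rfl, rfl⟩ := RawVA.pairName_inj.1 e
      obtain ⟨p', q', ρ₁, ρ₂, rfl, s₁, s₂, sh, sy⟩ := ih p₂ q₂ rfl
      refine ⟨p', q', _, _, rfl, .letter h₁ hd s₁, .letter h₂ hd s₂, .both sh,
        fun m hm hm' => ?_⟩
      rcases hm.eq_or_lt with rfl | hm
      -- The cut at the letter being read has empty prefixes: the rest of both runs lies at larger
      -- indices.
      · refine ⟨p, q, [], _, [], _, rfl, rfl, .refl _ _, .letter h₁ hd s₁, .refl _ _,
          .letter h₂ hd s₂, ?_, ?_, h₃⟩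
        · simp only [List.mem_cons, forall_eq_or_imp]
          exact ⟨by omega, fun e he => (s₁.le.2 e he).1⟩
        · simp only [List.mem_cons, forall_eq_or_imp]
          exact ⟨by omega, fun e he => (s₂.le.2 e he).1⟩
      · obtain ⟨r, s, σ₁, τ₁, σ₂, τ₂, rfl, rfl, h₄, h₅, h₆, h₇⟩ := sy m hm hm'
        exact ⟨r, s, _ :: σ₁, τ₁, _ :: σ₂, τ₂, rfl, rfl, .letter h₁ hd h₄, h₅,
          .letter h₂ hd h₆, h₇⟩
    · exact absurd ⟨a, rfl⟩ h
    · split at e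
      · cases e
      · exact absurd ⟨a, e.symm⟩ h

/-- If `a < b`, cut both runs just before the letter at index `a`. The first has then performed the
operation and the second has not, contrary to the compatibility of the states there. The case `b <
a` is symmetric. -/
theorem Synchronized.index_eq (hA : A.Functional) (hTA : A.Trim) (hB : B.Functional)
    (hTB : B.Trim) {p' q' j : ℕ} {ρ₁ ρ₂ : List (Label k × ℕ)}
    (h : Synchronized A B d A.init B.init 1 ρ₁ ρ₂ p' q' j)
    (h₁ : A.Steps d A.init 1 ρ₁ p' j) (h₂ : B.Steps d B.init 1 ρ₂ q' j)
    (hp : p' ∈ A.accept) (hq : q' ∈ B.accept) {l : Label k} (hl : l.IsOp) {a b : ℕ}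
    (ha : (l, a) ∈ ρ₁) (hb : (l, b) ∈ ρ₂) : a = b := by
  have hlA : A.raw.hasLabel l = true := hasLabel_iff.2 (h₁.label_mem _ ha)
  have hlB : B.raw.hasLabel l = true := hasLabel_iff.2 (h₂.label_mem _ hb)
  have ha' := h₁.le.2 _ ha
  have hb' := h₂.le.2 _ hb
  rcases lt_trichotomy a b with hab | hab | hab
  · obtain ⟨r, s, σ₁, τ₁, σ₂, τ₂, rfl, rfl, s₁, t₁, s₂, t₂, l₁, l₂, hc⟩ :=
      h a ha'.1 (by simp at hb'; omega)
    have c := (compat_iff.1 hc) l hl hlA hlB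
    rw [hA.done_iff_notMem hTA s₁.path t₁.path hp hl hlA,
      hB.done_iff_notMem hTB s₂.path t₂.path hq hl hlB] at c
    have hσ : (l, a) ∈ σ₁ := (List.mem_append.1 ha).resolve_right fun h => by
      have := l₁ _ h; simp at this
    have hτ : (l, b) ∈ τ₂ := (List.mem_append.1 hb).resolve_left fun h => by
      have := (s₂.le.2 _ h).2; simp at this; omega
    have hn : l ∉ τ₁.map Prod.fst := hA.not_mem_of_mem (s₁.path.append t₁.path) hp hl
      (List.mem_map_of_mem (f := Prod.fst) hσ)
    exact absurd (List.mem_map_of_mem (f := Prod.fst) hτ) (c.1 hn)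
  · exact hab
  · obtain ⟨r, s, σ₁, τ₁, σ₂, τ₂, rfl, rfl, s₁, t₁, s₂, t₂, l₁, l₂, hc⟩ :=
      h b hb'.1 (by simp at ha'; omega)
    have c := (compat_iff.1 hc) l hl hlA hlB
    rw [hA.done_iff_notMem hTA s₁.path t₁.path hp hl hlA,
      hB.done_iff_notMem hTB s₂.path t₂.path hq hl hlB] at c
    have hσ : (l, b) ∈ σ₂ := (List.mem_append.1 hb).resolve_right fun h => by
      have := l₂ _ h; simp at this
    have hτ : (l, a) ∈ τ₁ := (List.mem_append.1 ha).resolve_left fun h => by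
      have := (s₁.le.2 _ h).2; simp at this; omega
    have hn : l ∉ τ₂.map Prod.fst := hB.not_mem_of_mem (s₂.path.append t₂.path) hq hl
      (List.mem_map_of_mem (f := Prod.fst) hσ)
    exact absurd (List.mem_map_of_mem (f := Prod.fst) hτ) (c.2 hn)

/-- A greedy schedule: advance the first factor while it has steps without a letter, then the
second, then read the letter jointly. At that moment everything at index `i` is done in both, so the
common operations still to come are those at larger indices, on which the runs agree. The hypothesis
concerns only indices above `i`, since operations at `i` itself may be done in one factor and
pending in the other. The paths from the initial states are carried along to relate `done` to the
remaining run. -/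
theorem prod_steps_complete (hA : A.Functional) (hTA : A.Trim) (hB : B.Functional)
    (hTB : B.Trim) {p' q' j : ℕ} (hp' : p' ∈ A.accept) (hq' : q' ∈ B.accept) :
    ∀ (n : ℕ) {ρ₁ ρ₂ : List (Label k × ℕ)}, ρ₁.length + ρ₂.length ≤ n →
    ∀ {p q i : ℕ} {ls ms : List (Label k)}, A.Path A.init ls p → B.Path B.init ms q →
      A.Steps d p i ρ₁ p' j → B.Steps d q i ρ₂ q' j →
      (∀ l : Label k, l.IsOp → A.raw.hasLabel l = true → B.raw.hasLabel l = true →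
        ∀ m, i < m → ((l, m) ∈ ρ₁ ↔ (l, m) ∈ ρ₂)) →
      ∃ ρ, (A.prod B).Steps d (A.raw.pairName B.raw p q) i ρ (A.raw.pairName B.raw p' q') j ∧
        A.Shuffle ρ₁ ρ₂ ρ := by
  intro n
  induction n with
  | zero =>
    intro ρ₁ ρ₂ hn p q i ls ms hp hq h₁ h₂ _
    obtain ⟨rfl, rfl⟩ : ρ₁ = [] ∧ ρ₂ = [] := by
      constructor <;> apply List.eq_nil_of_length_eq_zero <;> omega
    cases h₁
    cases h₂
    exact ⟨[], .refl _ _, .nil⟩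
  | succ n ih =>
    intro ρ₁ ρ₂ hn p q i ls ms hp hq h₁ h₂ H
    rcases h₁.head_cases with c₁ | ⟨l, r, σ, hl, ht, rfl, h₁'⟩ | c₁
    rotate_left
    · obtain ⟨ρ, hs, hsh⟩ := ih (ρ₁ := σ) (ρ₂ := ρ₂) (by simp at hn; omega)
        (hp.append (Path.singleton ht)) hq h₁' h₂ (fun l' h h' h'' m hm => by
          rw [← H l' h h' h'' m hm, List.mem_cons, Prod.mk.injEq]
          exact (or_iff_right fun h => by omega).symm)
      exact ⟨_, hs.other hl (mem_prod_trans.2 (.inr (.inl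
        ⟨p, r, q, hl, ht, hq.mem_states B.init_mem, rfl, rfl⟩))),
        .left (hasLabel_iff.2 ⟨_, _, ht⟩) hsh⟩
    all_goals
      rcases h₂.head_cases with c₂ | ⟨l, r, σ, hl, ht, rfl, h₂'⟩ | c₂
      rotate_left
      · obtain ⟨ρ, hs, hsh⟩ := ih (ρ₁ := ρ₁) (ρ₂ := σ) (by simp at hn; omega)
          hp (hq.append (Path.singleton ht)) h₁ h₂' (fun l' h h' h'' m hm => by
            rw [H l' h h' h'' m hm, List.mem_cons, Prod.mk.injEq]
            exact or_iff_right fun h => by omega)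
        refine ⟨_, hs.other (l := if A.raw.hasLabel l then Label.eps else l) ?_
          (mem_prod_trans.2 (.inr (.inr
            ⟨p, q, r, l, hl, ht, hp.mem_states A.init_mem, rfl, rfl, rfl⟩))), .right hsh⟩
        split
        · simp [Label.IsLetter]
        · exact hl
    -- Four cases remain, each run being at a letter or at its end. Here both are at a letter,
    -- necessarily the same one.
    · obtain ⟨a, r, σ, ht, hd, rfl, h₁'⟩ := c₁
      obtain ⟨a', r', σ', ht', hd', rfl, h₂'⟩ := c₂
      obtain rfl : a = a' := by rw [hd] at hd'; exact Option.some_injective _ hd'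
      have hc : A.raw.compat B.raw p q = true := by
        rw [compat_iff]
        intro l hl hlA hlB
        rw [hA.done_iff_notMem hTA hp h₁.path hp' hl hlA,
          hB.done_iff_notMem hTB hq h₂.path hq' hl hlB, not_iff_not]
        have hne : l ≠ Label.letter a := fun h => hl.not_isLetter ⟨a, h⟩
        -- An operation still to come occurs after the letter, hence at an index above `i`, where
        -- the hypothesis applies.
        have key : ∀ {τ : List (Label k × ℕ)}, (∀ e ∈ τ, i + 1 ≤ e.2) →
            (l ∈ ((Label.letter a, i + 1) :: τ).map Prod.fst ↔
              ∃ m, i < m ∧ (l, m) ∈ ((Label.letter a, i + 1) :: τ)) := by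
          intro τ hτ
          simp only [List.map_cons, List.mem_cons, hne, false_or, List.mem_map, Prod.exists,
            exists_and_right, exists_eq_right, Prod.mk.injEq, false_and]
          exact ⟨fun ⟨m, hm⟩ => ⟨m, hτ _ hm, hm⟩, fun ⟨m, _, hm⟩ => ⟨m, hm⟩⟩
        rw [key fun e he => (h₁'.le.2 e he).1, key fun e he => (h₂'.le.2 e he).1]
        exact exists_congr fun m => and_congr_right fun hm => H l hl hlA hlB m hm
      obtain ⟨ρ, hs, hsh⟩ := ih (ρ₁ := σ) (ρ₂ := σ') (by simp at hn; omega)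
        (hp.append (Path.singleton ht)) (hq.append (Path.singleton ht')) h₁' h₂'
        (fun l hl hlA hlB m hm => by
          have hne : l ≠ Label.letter a := fun h => hl.not_isLetter ⟨a, h⟩
          have := H l hl hlA hlB m (by omega)
          simpa [hne] using this)
      exact ⟨_, .letter (mem_prod_trans.2 (.inl
        ⟨p, r, q, r', ⟨a, rfl⟩, ht, ht', hc, rfl, rfl⟩)) hd hs, .both hsh⟩
    -- One run cannot read a letter when the other has already reached the final index.
    · obtain ⟨a, r, σ, ht, hd, rfl, h₁'⟩ := c₁
      have := h₁'.le.1
      omega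
    · obtain ⟨a, r, σ, ht, hd, rfl, h₂'⟩ := c₂
      have := h₂'.le.1
      omega
    · obtain ⟨rfl, rfl, rfl⟩ := c₁
      obtain ⟨rfl, rfl, -⟩ := c₂
      exact ⟨[], .refl _ _, .nil⟩

/-! ### Functionality and semantics of the product -/

theorem eq_span_of_mem {p q j : ℕ} {ρ : List (Label k × ℕ)} (h : A.Steps d p 1 ρ q j)
    (hρ : ValidRun ρ) {μ : Mapping} (hμ : IsRunMapping ρ μ) {v : ℕ}
    (hv : (opsOf v ρ).map Prod.fst = [Label.opn v, Label.cls v]) : ∃ s, μ v = some s := by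
  obtain ⟨a, b, e⟩ := eq_pair_of_map_eq hv
  have h₁ : 1 ≤ a := by
    have : (Label.opn v, a) ∈ ρ := (mem_opsOf.1 (e ▸ List.mem_cons_self : _ ∈ opsOf v ρ)).1
    exact (h.le.2 _ this).1
  have h₂ : a ≤ b := by
    have := h.sorted.filter (fun e => e.1.isOpOf v)
    change (opsOf v ρ).Pairwise _ at this
    rw [e] at this
    simpa using this
  exact ⟨⟨a, b, h₁, h₂⟩, ((isRunMapping_iff hρ).1 hμ v _).2 e⟩

/-- A run that interleaves accepting runs has the united operations. -/
theorem Shuffle.opsOf_cases (hA : A.Functional) {ρ₁ ρ₂ ρ : List (Label k × ℕ)}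
    (h : A.Shuffle ρ₁ ρ₂ ρ) (h₁ : A.AcceptingRun d ρ₁) (v : ℕ) :
    ((opsOf v ρ₁).map Prod.fst = [Label.opn v, Label.cls v] ∧ opsOf v ρ = opsOf v ρ₁) ∨
      (opsOf v ρ₁ = [] ∧ v ∉ A.vars ∧ opsOf v ρ = opsOf v ρ₂) := by
  have hlab : ∀ l : Label k, l.isOpOf v = true → (A.raw.hasLabel l = true ↔ v ∈ A.vars) := by
    intro l hl
    rw [hasLabel_iff]
    constructor
    · rintro ⟨p, q, ht⟩
      rcases Label.isOpOf_iff.1 hl with rfl | rfl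
      exacts [⟨p, q, .inl ht⟩, ⟨p, q, .inr ht⟩]
    · intro hv
      obtain ⟨q, hq, hs⟩ := id h₁
      have hm : l ∈ ρ₁.map Prod.fst := by
        have := (hA d ρ₁ h₁).2 v hv
        rcases Label.isOpOf_iff.1 hl with rfl | rfl
        exacts [this.1, this.2]
      obtain ⟨e, he, rfl⟩ := List.mem_map.1 hm
      exact hs.label_mem e he
  have ho := hlab (Label.opn v) (by simp [Label.isOpOf])
  have hc := hlab (Label.cls v) (by simp [Label.isOpOf])
  have key := h.opsOf_eq v (Bool.eq_iff_iff.2 (ho.trans hc.symm))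
  rcases hA.opsOf_eq h₁ v with h | ⟨h, hv⟩
  · refine .inl ⟨h, ?_⟩
    have hv : v ∈ A.vars := by
      by_contra hv
      obtain ⟨q, -, hs⟩ := h₁
      have hm : Label.opn v ∈ ρ₁.map Prod.fst := by
        have : Label.opn v ∈ (opsOf v ρ₁).map Prod.fst := by simp [h]
        rw [map_opsOf] at this
        exact (List.mem_filter.1 this).1
      obtain ⟨e, he, h'⟩ := List.mem_map.1 hm
      obtain ⟨p, p', ht⟩ := hs.label_mem e he
      rw [h'] at ht
      exact hv ⟨_, _, .inl ht⟩
    rw [key, if_pos (ho.2 hv)]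
  · refine .inr ⟨h, hv, ?_⟩
    rw [key, if_neg (fun h => hv (ho.1 h))]

theorem vars_prod {v : ℕ} (h : v ∈ (A.prod B).vars) : v ∈ A.vars ∨ v ∈ B.vars := by
  have key : ∀ {P Q : ℕ} {l : Label k}, (P, l, Q) ∈ (A.prod B).trans → l.isOpOf v = true →
      v ∈ A.vars ∨ v ∈ B.vars := by
    intro P Q l ht hl
    have hvars : ∀ {X : VA k} {p q}, (p, l, q) ∈ X.trans → v ∈ X.vars := by
      intro X p q ht
      rcases Label.isOpOf_iff.1 hl with rfl | rfl
      exacts [⟨p, q, .inl ht⟩, ⟨p, q, .inr ht⟩]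
    rcases mem_prod_trans.1 ht with ⟨p, p', q, q', -, h₁, -⟩ | ⟨p, p', q, -, h₁, -⟩ |
      ⟨p, q, q', l', -, h₁, -, rfl, -⟩
    · exact .inl (hvars h₁)
    · exact .inl (hvars h₁)
    · split at hl
      · simp [Label.isOpOf] at hl
      · next h => rw [if_neg h] at hvars; exact .inr (hvars h₁)
  obtain ⟨p, q, h | h⟩ := h
  · exact key h (by simp [Label.isOpOf])
  · exact key h (by simp [Label.isOpOf])

/-- Accepting runs of the product interleave accepting runs of the factors. -/
theorem exists_of_prod_acceptingRun {ρ : List (Label k × ℕ)} (h : (A.prod B).AcceptingRun d ρ) :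
    ∃ p ∈ A.accept, ∃ q ∈ B.accept, ∃ ρ₁ ρ₂, A.Steps d A.init 1 ρ₁ p (d.length + 1) ∧
      B.Steps d B.init 1 ρ₂ q (d.length + 1) ∧ A.Shuffle ρ₁ ρ₂ ρ ∧
      Synchronized A B d A.init B.init 1 ρ₁ ρ₂ p q (d.length + 1) := by
  obtain ⟨Q, hQ, hs⟩ := h
  obtain ⟨p, q, ρ₁, ρ₂, e, h₁, h₂, h₃, h₄⟩ := prod_steps_sound hs A.init B.init rfl
  obtain ⟨p', hp, q', hq, e'⟩ := mem_prod_accept.1 hQ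
  obtain ⟨rfl, rfl⟩ := RawVA.pairName_inj.1 (e.symm.trans e')
  exact ⟨p, hp, q, hq, ρ₁, ρ₂, h₁, h₂, h₃, h₄⟩

/-- The operations of a product run on a given variable all come from one accepting run of a factor,
so they inherit the required pattern. Silencing the common operations of the second factor prevents
repetition. -/
theorem prod_functional (hA : A.Functional) (hB : B.Functional) :
    (A.prod B).Functional := by
  refine functional_of_opsOf_eq fun d ρ hρ v => ?_
  obtain ⟨p, hp, q, hq, ρ₁, ρ₂, h₁, h₂, hsh, -⟩ := exists_of_prod_acceptingRun hρ
  rcases hsh.opsOf_cases hA ⟨p, hp, h₁⟩ v with ⟨h, e⟩ | ⟨-, hv, e⟩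
  · rw [e]
    exact .inl h
  · rw [e]
    refine (hB.opsOf_eq ⟨q, hq, h₂⟩ v).imp_right fun h => ⟨h.1, fun hv' => ?_⟩
    exact (vars_prod hv').elim hv h.2

/-- On a common variable the interleaving keeps the operations of the first run, just as
`Mapping.union` prefers its first argument. -/
theorem isRunMapping_union (hA : A.Functional) {p : ℕ} (hp : p ∈ A.accept)
    {ρ₁ ρ₂ ρ : List (Label k × ℕ)} (h₁ : A.Steps d A.init 1 ρ₁ p (d.length + 1))
    (hv₁ : ValidRun ρ₁) (hv₂ : ValidRun ρ₂) (h : A.Shuffle ρ₁ ρ₂ ρ) (hv : ValidRun ρ)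
    {μ₁ μ₂ : Mapping} (hμ₁ : IsRunMapping ρ₁ μ₁) (hμ₂ : IsRunMapping ρ₂ μ₂) :
    IsRunMapping ρ (μ₁.union μ₂) := by
  rw [isRunMapping_iff hv]
  rw [isRunMapping_iff hv₂] at hμ₂
  intro v s
  rcases h.opsOf_cases hA ⟨p, hp, h₁⟩ v with ⟨h, e⟩ | ⟨h, -, e⟩
  · obtain ⟨s', hs'⟩ := eq_span_of_mem h₁ hv₁ hμ₁ h
    rw [isRunMapping_iff hv₁] at hμ₁
    rw [e, ← hμ₁ v s, Mapping.union, hs', Option.some_or]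
  · rw [isRunMapping_iff hv₁] at hμ₁
    have hn : μ₁ v = none := by
      rw [Option.eq_none_iff_forall_ne_some]
      intro s hs
      rw [hμ₁, h] at hs
      cases hs
    rw [e, ← hμ₂ v s, Mapping.union, hn, Option.none_or]

theorem prod_eval (hA : A.Functional) (hTA : A.Trim) (hB : B.Functional) (hTB : B.Trim) :
    (A.prod B).eval = Spanner.join A.eval B.eval := by
  funext d
  ext μ
  constructor
  · rintro ⟨ρ, hρ, hv, hμ⟩
    obtain ⟨p, hp, q, hq, ρ₁, ρ₂, h₁, h₂, hsh, hsy⟩ := exists_of_prod_acceptingRun hρ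
    have hv₁ := (hA d ρ₁ ⟨p, hp, h₁⟩).1
    have hv₂ := (hB d ρ₂ ⟨q, hq, h₂⟩).1
    obtain ⟨μ₁, hμ₁⟩ := exists_isRunMapping hv₁
    obtain ⟨μ₂, hμ₂⟩ := exists_isRunMapping hv₂
    refine ⟨μ₁, ⟨ρ₁, ⟨p, hp, h₁⟩, hv₁, hμ₁⟩, μ₂, ⟨ρ₂, ⟨q, hq, h₂⟩, hv₂, hμ₂⟩, ?_,
      isRunMapping_unique hμ (isRunMapping_union hA hp h₁ hv₁ hv₂ hsh hv hμ₁ hμ₂)⟩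
    intro v s₁ s₂ e₁ e₂
    have e₁ := (hμ₁ v s₁).1 e₁
    have e₂ := (hμ₂ v s₂).1 e₂
    have key := fun {l} (hl : Label.IsOp l) {a b} =>
      hsy.index_eq hA hTA hB hTB h₁ h₂ hp hq hl (a := a) (b := b)
    exact Span.ext (key ⟨v, by simp [Label.isOpOf]⟩ e₁.1 e₂.1)
      (key ⟨v, by simp [Label.isOpOf]⟩ e₁.2 e₂.2)
  · rintro ⟨μ₁, ⟨ρ₁, ⟨p, hp, h₁⟩, hv₁, hμ₁⟩, μ₂, ⟨ρ₂, ⟨q, hq, h₂⟩, hv₂, hμ₂⟩, hc, rfl⟩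
    -- An operation known to both automata concerns a variable that, by functionality, both mappings
    -- define. Compatibility gives it one span, so both runs have the operation at the same index.
    have H : ∀ l : Label k, l.IsOp → A.raw.hasLabel l = true → B.raw.hasLabel l = true →
        ∀ m, 1 < m → ((l, m) ∈ ρ₁ ↔ (l, m) ∈ ρ₂) := by
      rintro l ⟨v, hl⟩ hlA hlB m -
      have hvars : ∀ {X : VA k}, X.raw.hasLabel l = true → v ∈ X.vars := by
        intro X h
        obtain ⟨p, q, ht⟩ := hasLabel_iff.1 h
        rcases Label.isOpOf_iff.1 hl with rfl | rfl
        exacts [⟨p, q, .inl ht⟩, ⟨p, q, .inr ht⟩]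
      obtain ⟨s₁, e₁⟩ := eq_span_of_mem h₁ hv₁ hμ₁
        ((hA.opsOf_eq ⟨p, hp, h₁⟩ v).resolve_right fun h => h.2 (hvars hlA))
      obtain ⟨s₂, e₂⟩ := eq_span_of_mem h₂ hv₂ hμ₂
        ((hB.opsOf_eq ⟨q, hq, h₂⟩ v).resolve_right fun h => h.2 (hvars hlB))
      obtain rfl := hc v s₁ s₂ e₁ e₂
      have f₁ := ((isRunMapping_iff hv₁).1 hμ₁ v s₁).1 e₁
      have f₂ := ((isRunMapping_iff hv₂).1 hμ₂ v s₁).1 e₂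
      have g : ∀ ρ : List (Label k × ℕ), (l, m) ∈ ρ ↔ (l, m) ∈ opsOf v ρ := fun ρ => by
        rw [mem_opsOf]
        exact (and_iff_left (Label.isOpOf_iff.1 hl)).symm
      rw [g ρ₁, g ρ₂, f₁, f₂]
    obtain ⟨ρ, hs, hsh⟩ := prod_steps_complete hA hTA hB hTB hp hq _ le_rfl (.refl _) (.refl _)
      h₁ h₂ H
    have hρ : (A.prod B).AcceptingRun d ρ := ⟨_, mem_prod_accept.2 ⟨p, hp, q, hq, rfl⟩, hs⟩
    have hv := (prod_functional hA hB d ρ hρ).1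
    exact ⟨ρ, hρ, hv, isRunMapping_union hA hp h₁ hv₁ hv₂ hsh hv hμ₁ hμ₂⟩

end VA

/-! ### The join of two disjunctive functional automata -/

namespace RawVA

variable {k : ℕ}

/-- The targets of the transitions from the initial state. -/
def inits (X : RawVA k) : List ℕ :=
  (X.2.2.2.filter fun t => decide (t.1 = X.2.1)).map fun t => t.2.2

/-- The pairwise products of the components. -/
def joinComponents (X Y : RawVA k) : List (RawVA k) :=
  (X.inits ×ˢ Y.inits).map fun z => (X.sub z.1).prod (Y.sub z.2)

/-- The disjunction of automata, with a new initial state. -/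
def disjunction (L : List (RawVA k)) : RawVA k :=
  (nameOf [] :: L.flatMap (fun X => X.1), nameOf [], L.flatMap (fun X => X.2.2.1),
    L.flatMap (fun X => X.2.2.2) ++ L.map fun X => (nameOf [], Label.eps, X.2.1))

theorem disjunction_wf {L : List (RawVA k)} (h : ∀ X ∈ L, X.WF) : (disjunction L).WF := by
  have hmem : ∀ X ∈ L, ∀ q ∈ X.1, q ∈ (disjunction L).1 := fun X hX q hq =>
    List.mem_cons_of_mem _ (List.mem_flatMap.2 ⟨X, hX, hq⟩)
  have htr : ∀ t ∈ (disjunction L).2.2.2, t.1 ∈ (disjunction L).1 ∧ t.2.2 ∈ (disjunction L).1 := by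
    intro t ht
    rcases List.mem_append.1 ht with ht | ht
    · obtain ⟨X, hX, ht⟩ := List.mem_flatMap.1 ht
      exact ⟨hmem X hX _ ((h X hX).src_mem _ ht), hmem X hX _ ((h X hX).dst_mem _ ht)⟩
    · obtain ⟨X, hX, rfl⟩ := List.mem_map.1 ht
      exact ⟨List.mem_cons_self, hmem X hX _ (h X hX).init_mem⟩
  refine ⟨List.mem_cons_self, fun q hq => ?_, fun t ht => (htr t ht).1, fun t ht => (htr t ht).2⟩
  obtain ⟨X, hX, hq⟩ := List.mem_flatMap.1 hq
  exact hmem X hX _ ((h X hX).accept_mem _ hq)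

theorem joinComponents_wf (X Y : RawVA k) : ∀ Z ∈ X.joinComponents Y, Z.WF := by
  intro Z hZ
  obtain ⟨z, -, rfl⟩ := List.mem_map.1 hZ
  exact prod_wf (sub_wf _ _) (sub_wf _ _)

end RawVA

namespace VA

variable {k : ℕ} {A₁ A₂ : VA k} {C₁ C₂ : List (VA k)}

/-- The join of two automata that are disjunctions. -/
def join (A₁ A₂ : VA k) : VA k :=
  ofRaw (RawVA.disjunction (A₁.raw.joinComponents A₂.raw))
    (RawVA.disjunction_wf (RawVA.joinComponents_wf _ _))

theorem HasComponents.mem_inits {A : VA k} {C : List (VA k)} (h : A.HasComponents C) {s : ℕ} :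
    s ∈ A.raw.inits ↔ ∃ B ∈ C, s = B.init := by
  simp only [RawVA.inits, List.mem_map, List.mem_filter, decide_eq_true_eq, Prod.exists]
  constructor
  · rintro ⟨_, l, _, ⟨ht, rfl⟩, rfl⟩
    exact (h.trans_init.1 ht).2
  · rintro ⟨B, hB, rfl⟩
    exact ⟨_, _, _, ⟨h.trans_init.2 ⟨rfl, B, hB, rfl⟩, rfl⟩, rfl⟩

/-- The components of the join: the products of the components. -/
def productComponents (A₁ A₂ : VA k) (C₁ C₂ : List (VA k)) : List (VA k) :=
  (C₁ ×ˢ C₂).map fun D => (A₁.sub D.1.init).prod (A₂.sub D.2.init)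

theorem mem_joinComponents (h₁ : A₁.HasComponents C₁) (h₂ : A₂.HasComponents C₂)
    {X : RawVA k} : X ∈ A₁.raw.joinComponents A₂.raw ↔
      ∃ B ∈ productComponents A₁ A₂ C₁ C₂, B.raw = X := by
  simp only [RawVA.joinComponents, productComponents, List.mem_map, List.mem_sprod, Prod.exists,
    h₁.mem_inits, h₂.mem_inits]
  constructor
  · rintro ⟨_, _, ⟨⟨B, hB, rfl⟩, B', hB', rfl⟩, rfl⟩
    exact ⟨_, ⟨B, B', ⟨hB, hB'⟩, rfl⟩, rfl⟩
  · rintro ⟨_, ⟨B, B', ⟨hB, hB'⟩, rfl⟩, rfl⟩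
    exact ⟨_, _, ⟨⟨B, hB, rfl⟩, B', hB', rfl⟩, rfl⟩

theorem HasComponents.nodup {A : VA k} {C : List (VA k)} (h : A.HasComponents C) : C.Nodup := by
  refine h.disjoint.imp ?_
  rintro B _ hd rfl
  exact hd B.init_mem B.init_mem

/-- The name of a product state records the initial states of both factors, and these identify the
components. Distinct products are therefore disjoint, and the name of the empty list is free for the
new initial state. -/
theorem join_hasComponents (h₁ : A₁.HasComponents C₁) (h₂ : A₂.HasComponents C₂) :
    (A₁.join A₂).HasComponents (productComponents A₁ A₂ C₁ C₂) := by
  have hmem : ∀ {B}, B ∈ productComponents A₁ A₂ C₁ C₂ ↔ ∃ B₁ ∈ C₁, ∃ B₂ ∈ C₂,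
      B = (A₁.sub B₁.init).prod (A₂.sub B₂.init) := by
    intro B
    simp only [productComponents, List.mem_map, List.mem_sprod, Prod.exists]
    constructor
    · rintro ⟨B, B', ⟨hB, hB'⟩, rfl⟩; exact ⟨B, hB, B', hB', rfl⟩
    · rintro ⟨B, hB, B', hB', rfl⟩; exact ⟨B, B', ⟨hB, hB'⟩, rfl⟩
  have hL : ∀ {p : RawVA k → Prop}, (∃ X ∈ A₁.raw.joinComponents A₂.raw, p X) ↔
      ∃ B ∈ productComponents A₁ A₂ C₁ C₂, p B.raw := by
    intro p
    simp only [mem_joinComponents h₁ h₂]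
    constructor
    · rintro ⟨_, ⟨B, hB, rfl⟩, h⟩; exact ⟨B, hB, h⟩
    · rintro ⟨B, hB, h⟩; exact ⟨_, ⟨B, hB, rfl⟩, h⟩
  refine ⟨?_, ?_, ?_, ?_, ?_, ?_⟩
  · intro B hB
    obtain ⟨B₁, hB₁, B₂, hB₂, rfl⟩ := hmem.1 hB
    exact prod_functional (h₁.sub_functional hB₁) (h₂.sub_functional hB₂)
  · rw [productComponents, List.pairwise_map]
    refine (h₁.nodup.product h₂.nodup).imp_of_mem ?_
    intro D D' hD hD' hne P hP hP'
    obtain ⟨hD₁, hD₂⟩ := List.mem_sprod.1 hD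
    obtain ⟨hD₁', hD₂'⟩ := List.mem_sprod.1 hD'
    obtain ⟨p, -, q, -, rfl⟩ := mem_prod_states.1 hP
    obtain ⟨p', -, q', -, e⟩ := mem_prod_states.1 hP'
    have e := nameOf_injective e
    simp only [List.cons.injEq] at e
    have e₁ : D.1.init = D'.1.init := e.1
    have e₂ : D.2.init = D'.2.init := e.2.1
    refine hne (Prod.ext (h₁.eq_of_mem hD₁ hD₁' D.1.init_mem ?_)
      (h₂.eq_of_mem hD₂ hD₂' D.2.init_mem ?_))
    · rw [e₁]; exact D'.1.init_mem
    · rw [e₂]; exact D'.2.init_mem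
  · intro B hB hi
    obtain ⟨B₁, hB₁, B₂, hB₂, rfl⟩ := hmem.1 hB
    obtain ⟨p, -, q, -, e⟩ := mem_prod_states.1 hi
    have e := nameOf_injective e
    cases e
  · intro q
    refine List.mem_cons.trans (or_congr_right ?_)
    rw [List.mem_flatMap]
    exact hL
  · intro q
    refine List.mem_flatMap.trans ?_
    exact hL
  · intro t
    refine List.mem_append.trans (or_congr ?_ ?_)
    · rw [List.mem_flatMap]
      exact hL
    · rw [List.mem_map, hL]
      simp only [eq_comm (b := t)]
      rfl

theorem productComponents_eval (h₁ : A₁.HasComponents C₁) (h₂ : A₂.HasComponents C₂) :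
    List.Forall₂ (fun B (D : VA k × VA k) => B.eval = Spanner.join D.1.eval D.2.eval)
      (productComponents A₁ A₂ C₁ C₂) (C₁ ×ˢ C₂) := by
  rw [productComponents, List.forall₂_map_left_iff, List.forall₂_same]
  intro D hD
  obtain ⟨hD₁, hD₂⟩ := List.mem_sprod.1 hD
  rw [prod_eval (h₁.sub_functional hD₁) (sub_trim (h₁.init_mem_states hD₁))
    (h₂.sub_functional hD₂) (sub_trim (h₂.init_mem_states hD₂)), h₁.sub_eval hD₁,
    h₂.sub_eval hD₂]

/-- Join distributes over the unions formed by the components. Stated for the list of products, it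
serves the enumeration without building their disjunction. -/
theorem mem_eval_join (h₁ : A₁.HasComponents C₁) (h₂ : A₂.HasComponents C₂)
    {d : List (Fin k)} {μ : Mapping} : μ ∈ Spanner.join A₁.eval A₂.eval d ↔
      ∃ B ∈ productComponents A₁ A₂ C₁ C₂, μ ∈ B.eval d := by
  have key : ∀ D ∈ C₁ ×ˢ C₂, ((A₁.sub D.1.init).prod (A₂.sub D.2.init)).eval =
      Spanner.join D.1.eval D.2.eval := by
    have := productComponents_eval h₁ h₂
    rwa [productComponents, List.forall₂_map_left_iff, List.forall₂_same] at this
  constructor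
  · rintro ⟨μ₁, hμ₁, μ₂, hμ₂, hc⟩
    obtain ⟨B₁, hB₁, hμ₁⟩ := h₁.mem_eval.1 hμ₁
    obtain ⟨B₂, hB₂, hμ₂⟩ := h₂.mem_eval.1 hμ₂
    have hD := List.mem_sprod (x := (B₁, B₂)).2 ⟨hB₁, hB₂⟩
    refine ⟨_, List.mem_map_of_mem hD, ?_⟩
    rw [key _ hD]
    exact ⟨μ₁, hμ₁, μ₂, hμ₂, hc⟩
  · rintro ⟨B, hB, hμ⟩
    obtain ⟨D, hD, rfl⟩ := List.mem_map.1 hB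
    rw [key D hD] at hμ
    obtain ⟨μ₁, hμ₁, μ₂, hμ₂, hc⟩ := hμ
    obtain ⟨hD₁, hD₂⟩ := List.mem_sprod.1 hD
    exact ⟨μ₁, h₁.mem_eval.2 ⟨_, hD₁, hμ₁⟩, μ₂, h₂.mem_eval.2 ⟨_, hD₂, hμ₂⟩, hc⟩

theorem join_eval (h₁ : A₁.DisjunctiveFunctional) (h₂ : A₂.DisjunctiveFunctional) :
    (A₁.join A₂).eval = Spanner.join A₁.eval A₂.eval := by
  obtain ⟨C₁, h₁⟩ := h₁
  obtain ⟨C₂, h₂⟩ := h₂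
  funext d
  ext μ
  rw [mem_eval_join h₁ h₂, (join_hasComponents h₁ h₂).mem_eval]

end VA

/-! ### The join is computed in polynomial time -/

namespace PolyTime

variable {k : ℕ} {α : Type} [Enc α] {X Y : α → RawVA k} {l : α → Label k} {p q : α → ℕ}

/-- A label is encoded as the pair of its tag and argument; for ε this works because 0 is encoded by
a leaf. -/
theorem tag_arg (hl : PolyTime l) : PolyTime (fun a => ((l a).tag, (l a).arg)) :=
  hl.of_enc_eq fun a => by cases l a <;> rfl

theorem tag (hl : PolyTime l) : PolyTime (fun a => (l a).tag) := hl.tag_arg.fst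

theorem arg (hl : PolyTime l) : PolyTime (fun a => (l a).arg) := hl.tag_arg.snd

theorem isOp (hl : PolyTime l) : PolyTime (fun a => (l a).isOp) :=
  (hl.tag.eq (const 2)).or (hl.tag.eq (const 3))

theorem reach (hX : PolyTime X) (hp : PolyTime p) :
    PolyTime (fun a => (X a).reach (p a)) :=
  hp.cons (closure (S := fun a q => decide (q = p a))
    (R := fun a q r => (X a).2.2.2.any fun t => decide (t.1 = q) && decide (t.2.2 = r))
    hX.fst (id.snd.eq (hp.comp id.fst))
    (any (f := fun (x : α × ℕ × ℕ) (t : ℕ × Label k × ℕ) =>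
      decide (t.1 = x.2.1) && decide (t.2.2 = x.2.2)) (hX.comp id.fst).snd.snd.snd
      ((id.snd.fst.eq id.fst.snd.fst).and (id.snd.snd.snd.eq id.fst.snd.snd))))

theorem sub (hX : PolyTime X) (hp : PolyTime p) : PolyTime (fun a => (X a).sub (p a)) := by
  have hr := hX.reach hp
  refine hr.pair (hp.pair (pair ?_ ?_))
  · exact hX.snd.snd.fst.filter (f := fun a q => decide (q ∈ (X a).reach (p a)))
      (id.snd.mem (hr.comp id.fst))
  · exact hX.snd.snd.snd.filter (f := fun a (t : ℕ × Label k × ℕ) =>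
      decide (t.1 ∈ (X a).reach (p a)) && decide (t.2.2 ∈ (X a).reach (p a)))
      ((id.snd.fst.mem (hr.comp id.fst)).and (id.snd.snd.snd.mem (hr.comp id.fst)))

theorem hasLabel (hX : PolyTime X) (hl : PolyTime l) :
    PolyTime (fun a => (X a).hasLabel (l a)) :=
  hX.snd.snd.snd.any (f := fun a (t : ℕ × Label k × ℕ) => decide (t.2.1 = l a)) (id.snd.snd.fst.eq (hl.comp id.fst))

theorem done (hX : PolyTime X) (hq : PolyTime q) (hl : PolyTime l) :
    PolyTime (fun a => (X a).done (q a) (l a)) :=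
  hX.snd.snd.snd.any (f := fun a (t : ℕ × Label k × ℕ) => decide (t.2.1 = l a) && decide (q a ∈ (X a).reach t.2.2))
    ((id.snd.snd.fst.eq (hl.comp id.fst)).and
      ((hq.comp id.fst).mem ((hX.comp id.fst).reach id.snd.snd.snd)))

theorem compat (hX : PolyTime X) (hY : PolyTime Y) (hp : PolyTime p) (hq : PolyTime q) :
    PolyTime (fun a => (X a).compat (Y a) (p a) (q a)) :=
  hX.snd.snd.snd.all (f := fun a (t : ℕ × Label k × ℕ) => !(t.2.1.isOp && (Y a).hasLabel t.2.1) ||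
    decide ((X a).done (p a) t.2.1 = (Y a).done (q a) t.2.1))
    ((id.snd.snd.fst.isOp.and ((hY.comp id.fst).hasLabel id.snd.snd.fst)).not.or
      (((hX.comp id.fst).done (hp.comp id.fst) id.snd.snd.fst).eq
        ((hY.comp id.fst).done (hq.comp id.fst) id.snd.snd.fst)))

theorem pairName (hX : PolyTime X) (hY : PolyTime Y) (hp : PolyTime p) (hq : PolyTime q) :
    PolyTime (fun a => (X a).pairName (Y a) (p a) (q a)) :=
  nameOf (hX.snd.fst.cons (hY.snd.fst.cons (hp.cons (hq.cons (const [])))))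

theorem prodTrans (hX : PolyTime X) (hY : PolyTime Y) :
    PolyTime (fun a => (X a).prodTrans (Y a)) := by
  have hN : ∀ {β : Type} [Enc β] {p q : α × β → ℕ}, PolyTime p → PolyTime q →
      PolyTime (fun x : α × β => (X x.1).pairName (Y x.1) (p x) (q x)) := fun hp hq =>
    (hX.comp id.fst).pairName (hY.comp id.fst) hp hq
  refine append ?_ (append ?_ ?_)
  · refine map (f := fun a (z : (ℕ × Label k × ℕ) × (ℕ × Label k × ℕ)) =>
      ((X a).pairName (Y a) z.1.1 z.2.1, z.1.2.1, (X a).pairName (Y a) z.1.2.2 z.2.2.2))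
      (filter (f := fun a (z : (ℕ × Label k × ℕ) × (ℕ × Label k × ℕ)) =>
        decide (z.1.2.1 = z.2.2.1) && (decide (z.1.2.1.tag = 1) &&
          (X a).compat (Y a) z.1.1 z.2.1)) (hX.snd.snd.snd.product hY.snd.snd.snd) ?_) ?_
    · exact (id.snd.fst.snd.fst.eq id.snd.snd.snd.fst).and
        ((id.snd.fst.snd.fst.tag.eq (const 1)).and
          ((hX.comp id.fst).compat (hY.comp id.fst) id.snd.fst.fst id.snd.snd.fst))
    · exact (hN id.snd.fst.fst id.snd.snd.fst).pair (id.snd.fst.snd.fst.pair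
        (hN id.snd.fst.snd.snd id.snd.snd.snd.snd))
  · refine map (f := fun a (z : (ℕ × Label k × ℕ) × ℕ) =>
      ((X a).pairName (Y a) z.1.1 z.2, z.1.2.1, (X a).pairName (Y a) z.1.2.2 z.2))
      ((hX.snd.snd.snd.filter (f := fun _ (t : ℕ × Label k × ℕ) => !decide (t.2.1.tag = 1))
        (id.snd.snd.fst.tag.eq (const 1)).not).product hY.fst) ?_
    exact (hN id.snd.fst.fst id.snd.snd).pair (id.snd.fst.snd.fst.pair
      (hN id.snd.fst.snd.snd id.snd.snd))
  · refine map (f := fun a (z : ℕ × ℕ × Label k × ℕ) =>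
      ((X a).pairName (Y a) z.1 z.2.1, if (X a).hasLabel z.2.2.1 then Label.eps else z.2.2.1,
        (X a).pairName (Y a) z.1 z.2.2.2))
      (hX.fst.product (hY.snd.snd.snd.filter (f := fun _ (t : ℕ × Label k × ℕ) => !decide (t.2.1.tag = 1))
        (id.snd.snd.fst.tag.eq (const 1)).not)) ?_
    exact (hN id.snd.fst id.snd.snd.fst).pair ((ite ((hX.comp id.fst).hasLabel
      id.snd.snd.snd.fst) (const Label.eps) id.snd.snd.snd.fst).pair
      (hN id.snd.fst id.snd.snd.snd.snd))

theorem prod (hX : PolyTime X) (hY : PolyTime Y) : PolyTime (fun a => (X a).prod (Y a)) := by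
  have hN := (hX.comp (id (α := α × ℕ × ℕ)).fst).pairName (hY.comp id.fst)
    id.snd.fst id.snd.snd
  refine pair ?_ (pair (hX.pairName hY hX.snd.fst hY.snd.fst) (pair ?_ (hX.prodTrans hY)))
  · exact (hX.fst.product hY.fst).map (f := fun a (z : ℕ × ℕ) => (X a).pairName (Y a) z.1 z.2) hN
  · exact (hX.snd.snd.fst.product hY.snd.snd.fst).map
      (f := fun a (z : ℕ × ℕ) => (X a).pairName (Y a) z.1 z.2) hN

theorem inits (hX : PolyTime X) : PolyTime (fun a => (X a).inits) :=
  (hX.snd.snd.snd.filter (f := fun a (t : ℕ × Label k × ℕ) => decide (t.1 = (X a).2.1))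
    (id.snd.fst.eq (hX.comp id.fst).snd.fst)).map (f := fun _ (t : ℕ × Label k × ℕ) => t.2.2) id.snd.snd.snd

theorem joinComponents (hX : PolyTime X) (hY : PolyTime Y) :
    PolyTime (fun a => (X a).joinComponents (Y a)) :=
  map (L := fun a => (X a).inits ×ˢ (Y a).inits) (f := fun a (z : ℕ × ℕ) => ((X a).sub z.1).prod ((Y a).sub z.2))
    (hX.inits.product hY.inits) (((hX.comp id.fst).sub id.snd.fst).prod ((hY.comp id.fst).sub id.snd.snd))

theorem disjunction {L : α → List (RawVA k)} (hL : PolyTime L) :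
    PolyTime (fun a => RawVA.disjunction (L a)) :=
  ((const _).cons (hL.flatMap (f := fun _ (X : RawVA k) => X.1) id.snd.fst)).pair ((const _).pair
    ((hL.flatMap (f := fun _ (X : RawVA k) => X.2.2.1) id.snd.snd.snd.fst).pair
      ((hL.flatMap (f := fun _ (X : RawVA k) => X.2.2.2) id.snd.snd.snd.snd).append
        (hL.map (f := fun _ (X : RawVA k) => (_root_.nameOf [], Label.eps, X.2.1))
          ((const _).pair ((const _).pair id.snd.snd.fst))))))

end PolyTime

/-- The join of disjunctive functional automata is compiled in polynomial time. -/
theorem exists_prog_join (k : ℕ) : ∃ (P : Prog) (p : Polynomial ℕ), ∀ A₁ A₂ : VA k,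
    A₁.DisjunctiveFunctional → A₂.DisjunctiveFunctional →
    ∃ (w : List Event) (A : VA k),
      P.Run (Val.cons (Val.ofVA A₁) (Val.ofVA A₂)) w (Val.ofVA A) ∧
      Event.time w ≤ p.eval (Val.cons (Val.ofVA A₁) (Val.ofVA A₂)).size ∧
      A.DisjunctiveFunctional ∧
      A.eval = Spanner.join A₁.eval A₂.eval ∧
      ∀ C₁ C₂ : List (VA k), A₁.HasComponents C₁ → A₂.HasComponents C₂ →
        ∃ C : List (VA k), A.HasComponents C ∧
          List.Forall₂ (fun B (D : VA k × VA k) => B.eval = Spanner.join D.1.eval D.2.eval)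
            C (C₁ ×ˢ C₂) := by
  have h : PolyTime (fun x : RawVA k × RawVA k =>
      RawVA.disjunction (x.1.joinComponents x.2)) :=
    (PolyTime.id.fst.joinComponents PolyTime.id.snd).disjunction
  obtain ⟨P, p, hP⟩ := h
  refine ⟨P, p, fun A₁ A₂ h₁ h₂ => ?_⟩
  obtain ⟨w, hr, -, ht⟩ := hP (A₁.raw, A₂.raw)
  -- An automaton and its raw data have the same encoding by definition, so the run fits as it is.
  refine ⟨w, A₁.join A₂, hr, ht, ?_, VA.join_eval h₁ h₂, fun C₁ C₂ h₁ h₂ =>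
    ⟨_, VA.join_hasComponents h₁ h₂, VA.productComponents_eval h₁ h₂⟩⟩
  obtain ⟨C₁, h₁⟩ := h₁
  obtain ⟨C₂, h₂⟩ := h₂
  exact ⟨_, VA.join_hasComponents h₁ h₂⟩

/-! ### Delay -/

namespace Event

/-- If `acc` time units have passed since the last output, then with the events `w` no more than
`b` time units pass without output. -/
def Within (b : ℕ) : ℕ → List Event → Prop
  | acc, [] => acc ≤ b
  | acc, tick n :: w => Within b (acc + n) w
  | acc, out _ :: w => acc ≤ b ∧ Within b 0 w

theorem Within.le {b acc : ℕ} {w : List Event} (h : Within b acc w) : acc ≤ b := by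
  induction w generalizing acc with
  | nil => exact h
  | cons e w ih =>
    cases e with
    | tick n => have := ih (acc := acc + n) h; omega
    | out y => exact h.1

theorem within_append_iff {b acc : ℕ} {u w : List Event} (hu : outputs u = []) :
    Within b acc (u ++ w) ↔ Within b (acc + time u) w := by
  induction u generalizing acc with
  | nil => simp
  | cons e u ih =>
    cases e with
    | tick n =>
      simp only [List.cons_append, Within, time_tick]
      rw [ih hu, add_assoc]
    | out y => simp at hu

theorem Within.exists_suffix {b acc : ℕ} {u w : List Event} (h : Within b acc (u ++ w)) :
    ∃ acc', Within b acc' w := by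
  induction u generalizing acc with
  | nil => exact ⟨acc, h⟩
  | cons e u ih =>
    cases e with
    | tick n => exact ih (acc := acc + n) h
    | out y => exact ih h.2

theorem Within.delayAtMost {b acc : ℕ} {w : List Event} (h : Within b acc w) :
    DelayAtMost b w := by
  rintro u ⟨s, t, rfl⟩ hu
  rw [List.append_assoc] at h
  obtain ⟨acc', h⟩ := h.exists_suffix
  have := ((within_append_iff hu).1 h).le
  omega

end Event

/-! ### Enumeration of the leaves of a binary tree -/

section Enumeration

variable {α β γ δ : Type} [Enc α] [Enc β] [Enc γ] [Enc δ] [Inhabited β]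

/-- The leaves below the node where the elements `l` have been chosen and the elements `r` remain
to be considered. -/
def leaves (E : List β → List β → Bool) : List β → List β → List (List β)
  | [], l => if E [] l then [l] else []
  | e :: r, l => leaves E r (e :: l) ++ leaves E r l

/-- The test `E` says whether there are leaves below a node. -/
def IsExtendable (E : List β → List β → Bool) : Prop :=
  ∀ e r l, E (e :: r) l = (E r (e :: l) || E r l)

/-- Replace the first node of the stack by its extendable children. -/
def expand (E : List β → List β → Bool) (st : List (List β × List β)) :
    List (List β × List β) :=
  if (st.headD ([], [])).1.isEmpty then st else
    [((st.headD ([], [])).1.tail, (st.headD ([], [])).1.headD default :: (st.headD ([], [])).2),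
      ((st.headD ([], [])).1.tail, (st.headD ([], [])).2)].filter (fun n => E n.1 n.2) ++ st.tail

/-- Expand until the first node is a leaf. -/
def descend (E : List β → List β → Bool) (st : List (List β × List β)) :
    List (List β × List β) :=
  (st.headD ([], [])).1.foldl (fun st _ => expand E st) st

omit [Enc β] in
theorem expand_cons (E : List β → List β → Bool) (e : β) (r l : List β)
    (st : List (List β × List β)) : expand E ((e :: r, l) :: st) =
      [(r, e :: l), (r, l)].filter (fun n => E n.1 n.2) ++ st := rfl

omit [Enc β] in
theorem expand_nil (E : List β → List β → Bool) (l : List β) (st : List (List β × List β)) :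
    expand E (([], l) :: st) = ([], l) :: st := rfl

/-- Moving an element from the remaining to the chosen list leaves the size of a node unchanged, and
discarding it lowers the size. One node is replaced by at most two. -/
theorem expand_bound (E : List β → List β → Bool) {m : ℕ} {st : List (List β × List β)}
    (h : ∀ n ∈ st, encSize n ≤ m) :
    (∀ n ∈ expand E st, encSize n ≤ m) ∧ (expand E st).length ≤ st.length + 1 := by
  match st, h with
  | [], h => exact ⟨h, by simp [expand]⟩
  | ([], l) :: st, h => exact ⟨h, by rw [expand_nil]; omega⟩
  | (e :: r, l) :: st, h =>
    rw [expand_cons]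
    have h₀ := h _ List.mem_cons_self
    simp only [encSize_pair, encSize_cons] at h₀
    constructor
    · intro n hn
      rcases List.mem_append.1 hn with hn | hn
      · have hn := (List.mem_filter.1 hn).1
        simp only [List.mem_cons, List.not_mem_nil, or_false] at hn
        rcases hn with rfl | rfl
        · simp only [encSize_pair, encSize_cons]; omega
        · simp only [encSize_pair]; omega
      · exact h n (List.mem_cons_of_mem _ hn)
    · have := List.length_filter_le (fun n : List β × List β => E n.1 n.2)
        [(r, e :: l), (r, l)]
      simp only [List.length_append, List.length_cons, List.length_nil] at this ⊢
      omega

theorem foldl_expand_bound (E : List β → List β → Bool) {m : ℕ} (r : List β)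
    {st : List (List β × List β)} (h : ∀ n ∈ st, encSize n ≤ m) :
    (∀ n ∈ r.foldl (fun st _ => expand E st) st, encSize n ≤ m) ∧
      (r.foldl (fun st _ => expand E st) st).length ≤ st.length + r.length := by
  induction r generalizing st with
  | nil => exact ⟨h, by simp⟩
  | cons e r ih =>
    have h₁ := expand_bound E h
    have h₂ := ih h₁.1
    exact ⟨h₂.1, by simp only [List.foldl_cons, List.length_cons]; omega⟩

theorem PolyTime.expand {E : γ → List β → List β → Bool}
    (hE : PolyTime (fun x : γ × List β × List β => E x.1 x.2.1 x.2.2))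
    {c : α → γ} {st : α → List (List β × List β)} (hc : PolyTime c) (hst : PolyTime st) :
    PolyTime (fun a => expand (E (c a)) (st a)) := by
  have hn := hst.headD ([], [])
  refine hn.fst.isEmpty.ite hst (append (filter (f := fun a (n : List β × List β) =>
    E (c a) n.1 n.2) (cons ?_ (cons ?_ (const []))) ?_) hst.tail)
  · exact hn.fst.tail.pair ((hn.fst.headD default).cons hn.snd)
  · exact hn.fst.tail.pair hn.snd
  · exact hE.comp ((hc.comp id.fst).pair id.snd)

/-- The number of expansions is the number of elements remaining at the first node. Both it and the
initial stack are bounded by the input size, hence at most `2 * X` nodes, none larger than the input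
up to an additive constant. -/
theorem PolyTime.descend {E : γ → List β → List β → Bool}
    (hE : PolyTime (fun x : γ × List β × List β => E x.1 x.2.1 x.2.2)) :
    PolyTime (fun x : γ × List (List β × List β) => (x.1, descend (E x.1) x.2)) := by
  refine id.fst.pair (foldl (f := fun x st _ => _root_.expand (E x.1) st)
    (id.snd.headD ([], [])).fst id.snd (PolyTime.expand hE id.fst.fst id.snd.fst)
    ((2 * Polynomial.X) * (Polynomial.X + 1) + 1) fun x l hl => ?_)
  have hsz : encSize x = encSize x.1 + encSize x.2 + 1 := rfl
  have h₁ : ∀ n ∈ x.2, encSize n ≤ encSize x := fun n hn => by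
    have := encSize_lt_of_mem hn
    omega
  obtain ⟨h₂, h₃⟩ := foldl_expand_bound (E x.1) l h₁
  have h₄ := encSize_le_length_mul h₂
  have h₅ := length_lt_encSize x.2
  have h₆ := length_lt_encSize (x.2.headD ([], [])).1
  have h₇ : encSize (x.2.headD ([], [])) ≤ encSize x + 2 := by
    match h : x.2 with
    | [] =>
      have := one_le_encSize x
      simp
      omega
    | n :: st =>
      have := h₁ n (by simp [h])
      simp only [List.headD_cons]
      omega
  have h₈ : encSize (x.2.headD ([], [])).1 + 2 ≤ encSize (x.2.headD ([], [])) := by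
    have := one_le_encSize (x.2.headD ([], [])).2
    have e : encSize (x.2.headD ([], [])) = encSize (x.2.headD ([], [])).1 +
      encSize (x.2.headD ([], [])).2 + 1 := rfl
    omega
  have h₉ := hl.length_le
  have h₁₀ := Nat.mul_le_mul_right (encSize x + 1) (show
    (l.foldl (fun st _ => _root_.expand (E x.1) st) x.2).length ≤ 2 * encSize x by omega)
  simp only [Polynomial.eval_add, Polynomial.eval_mul, Polynomial.eval_ofNat,
    Polynomial.eval_X, Polynomial.eval_one]
  omega

/-- The depths of the nodes on the stack. -/
def StackDepth (N : ℕ) : List (List β × List β) → Prop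
  | [] => True
  | n :: st => st.length + n.1.length ≤ N ∧ StackDepth N st

/-- The leaves below the nodes of a stack. -/
def stackLeaves (E : List β → List β → Bool) (st : List (List β × List β)) : List (List β) :=
  st.flatMap fun n => leaves E n.1 n.2

omit [Enc β] [Inhabited β] in
theorem leaves_eq_nil {E : List β → List β → Bool} (hE : IsExtendable E) {r l : List β}
    (h : E r l = false) : leaves E r l = [] := by
  induction r generalizing l with
  | nil => simp [leaves, h]
  | cons e r ih =>
    rw [hE, Bool.or_eq_false_iff] at h
    simp [leaves, ih h.1, ih h.2]

/-- What holds for the stacks of the enumeration. -/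
structure StackInv (E : List β → List β → Bool) (N m : ℕ) (st : List (List β × List β)) :
    Prop where
  extendable : ∀ n ∈ st, E n.1 n.2 = true
  size_le : ∀ n ∈ st, encSize n ≤ m
  depth : StackDepth N st

/-- An extendable node has an extendable child, so the new first node lies exactly one level deeper.
Discarded children have no leaves, and a second child uses the level just gained, so the depth bound
survives. -/
theorem StackInv.expand {E : List β → List β → Bool} (hE : IsExtendable E) {N m : ℕ}
    {e : β} {r l : List β} {st : List (List β × List β)}
    (h : StackInv E N m ((e :: r, l) :: st)) :
    ∃ l' st', expand E ((e :: r, l) :: st) = (r, l') :: st' ∧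
      StackInv E N m ((r, l') :: st') ∧
      stackLeaves E ((r, l') :: st') = stackLeaves E ((e :: r, l) :: st) := by
  have hb := (expand_bound E h.size_le).1
  have h₁ := h.extendable _ List.mem_cons_self
  have h₂ := h.depth
  simp only [StackDepth, List.length_cons] at h₂
  have h₃ : ∀ n ∈ st, E n.1 n.2 = true := fun n hn =>
    h.extendable n (List.mem_cons_of_mem _ hn)
  rw [expand_cons] at hb ⊢
  simp only [hE e r l, Bool.or_eq_true] at h₁
  cases ha : E r (e :: l) <;> cases hb' : E r l <;>
    simp only [ha, hb', Bool.false_eq_true, or_false, or_true] at h₁ <;>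
    simp only [List.filter_cons, ha, hb', if_true, if_false, Bool.false_eq_true,
      List.filter_nil, List.cons_append, List.nil_append] at hb ⊢
  · refine ⟨_, _, rfl, ⟨?_, hb, ?_⟩, ?_⟩
    · simpa [hb'] using h₃
    · exact ⟨by simp only; omega, h₂.2⟩
    · simp [stackLeaves, leaves, leaves_eq_nil hE ha]
  · refine ⟨_, _, rfl, ⟨?_, hb, ?_⟩, ?_⟩
    · simpa [ha] using h₃
    · exact ⟨by simp only; omega, h₂.2⟩
    · simp [stackLeaves, leaves, leaves_eq_nil hE hb']
  · refine ⟨_, _, rfl, ⟨?_, hb, ?_⟩, ?_⟩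
    · simpa [ha, hb'] using h₃
    · exact ⟨by simp only [List.length_cons]; omega, by simp only; omega, h₂.2⟩
    · simp [stackLeaves, leaves]

/-- As each expansion consumes one remaining element of the first node, as many expansions as it had
elements end in a leaf. It passes the test, hence is the first leaf below the stack: no descent is
wasted. -/
theorem StackInv.descend {E : List β → List β → Bool} (hE : IsExtendable E) {N m : ℕ}
    {n : List β × List β} {st : List (List β × List β)} (h : StackInv E N m (n :: st)) :
    ∃ l st', descend E (n :: st) = ([], l) :: st' ∧ StackInv E N m (([], l) :: st') ∧
      stackLeaves E (n :: st) = l :: stackLeaves E st' := by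
  suffices key : ∀ (r' r l : List β) (st : List (List β × List β)), r'.length = r.length →
      StackInv E N m ((r, l) :: st) →
      ∃ l' st', r'.foldl (fun st _ => _root_.expand E st) ((r, l) :: st) = ([], l') :: st' ∧
        StackInv E N m (([], l') :: st') ∧
        stackLeaves E (([], l') :: st') = stackLeaves E ((r, l) :: st) by
    obtain ⟨l', st', h₁, h₂, h₃⟩ := key n.1 n.1 n.2 st rfl h
    refine ⟨l', st', h₁, h₂, ?_⟩
    have h₄ := h₂.extendable _ List.mem_cons_self
    change stackLeaves E ((n.1, n.2) :: st) = _
    rw [← h₃]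
    simp only at h₄
    simp [stackLeaves, leaves, h₄]
  intro r'
  induction r' with
  | nil =>
    intro r l st hr h
    obtain rfl := List.eq_nil_of_length_eq_zero hr.symm
    exact ⟨l, st, rfl, h, rfl⟩
  | cons e' r' ih =>
    intro r l st hr h
    cases r with
    | nil => simp at hr
    | cons e r =>
      obtain ⟨l₁, st₁, h₁, h₂, h₃⟩ := h.expand hE
      obtain ⟨l₂, st₂, h₄, h₅, h₆⟩ := ih r l₁ st₁ (by simpa using hr) h₂
      exact ⟨l₂, st₂, by rw [List.foldl_cons, h₁, h₄], h₅, h₆.trans h₃⟩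

omit [Inhabited β] in
theorem StackInv.tail {E : List β → List β → Bool} {N m : ℕ} {n : List β × List β}
    {st : List (List β × List β)} (h : StackInv E N m (n :: st)) : StackInv E N m st :=
  ⟨fun n hn => h.extendable n (List.mem_cons_of_mem _ hn),
    fun n hn => h.size_le n (List.mem_cons_of_mem _ hn), h.depth.2⟩

omit [Inhabited β] in
theorem StackInv.encSize_le {E : List β → List β → Bool} {N m : ℕ}
    {st : List (List β × List β)} (h : StackInv E N m st) :
    encSize st ≤ (N + 1) * (m + 1) + 1 := by
  have h₁ : st.length ≤ N + 1 := by
    cases st with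
    | nil => simp
    | cons n st =>
      have := h.depth.1
      simp only [List.length_cons]
      omega
  have h₂ := encSize_le_length_mul h.size_le
  have h₃ := Nat.mul_le_mul_right (m + 1) h₁
  omega

/-- One round of the enumeration, with its output. -/
theorem run_round {D T R : Prog} {x x' y z : Val} {s : ℕ} {C F : Prog} {t : Val}
    (hF : F = .seq D (.seq (.pair .skip (.seq T .emit)) R)) (ht : t ≠ Val.nil)
    (hx : x.size ≤ s) (hC : Computes C x t s) (hD : Computes D x x' s) (hT : Computes T x' y s)
    (hR : Computes R (Val.cons x' y) z s) {b : ℕ} (hb : 12 * s ≤ b) {w : List Event} {v : Val}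
    (hw : Prog.Run (.loop C F) z w v) (hw' : ∀ acc ≤ 4 * s, Event.Within b acc w) :
    ∃ w', Prog.Run (.loop C F) x w' v ∧ Event.outputs w' = y :: Event.outputs w ∧
      ∀ acc ≤ 4 * s, Event.Within b acc w' := by
  have h₁ := hD.size_le
  have h₂ := hT.size_le
  obtain ⟨wC, rC, oC, tC⟩ := hC
  obtain ⟨wD, rD, oD, tD⟩ := hD
  obtain ⟨wT, rT, oT, tT⟩ := hT
  obtain ⟨wR, rR, oR, tR⟩ := hR
  subst hF
  refine ⟨_, .loop_step rC ht (.seq rD (.seq (.pair (.skip x') (.seq rT (.emit y))) rR)) hw, ?_,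
    fun acc hacc => ?_⟩
  · simp [oC, oD, oT, oR]
  · have e : ∀ u₁ u₂ u₃ u₄ : List Event,
        Event.tick x.size :: (u₁ ++ (u₂ ++ ((Event.tick x'.size :: ([Event.tick x'.size] ++
          Event.tick x'.size :: ((u₃ ++ [Event.tick y.size, Event.out y, Event.tick y.size]) ++
            [Event.tick (x'.size + y.size)]))) ++ u₄)) ++ w) =
        (Event.tick x.size :: (u₁ ++ u₂ ++ [Event.tick x'.size, Event.tick x'.size,
          Event.tick x'.size] ++ u₃ ++ [Event.tick y.size])) ++ Event.out y ::
          (([Event.tick y.size, Event.tick (x'.size + y.size)] ++ u₄) ++ w) := by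
      intro u₁ u₂ u₃ u₄
      simp
    rw [e, Event.within_append_iff (by simp [oC, oD, oT])]
    refine ⟨?_, ?_⟩
    -- Up to the output the round takes at most `8 * s`, in addition to the `4 * s` carried over:
    -- this is the 12. After it at most `4 * s` pass, which is what the next round may start with.
    · simp only [Event.time_tick, Event.time_append, Event.time_nil]
      omega
    · rw [Event.within_append_iff (by simp [oR])]
      refine hw' _ ?_
      simp only [Event.time_tick, Event.time_append, Event.time_nil]
      omega

/-- Enumeration of leaves with polynomial delay. -/
theorem exists_prog_enumerate {c : α → γ} {atoms : α → List β}
    {E : γ → List β → List β → Bool} {f : γ → List β → δ} (hc : PolyTime c)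
    (hatoms : PolyTime atoms)
    (hE : PolyTime (fun x : γ × List β × List β => E x.1 x.2.1 x.2.2))
    (hf : PolyTime (fun x : γ × List β => f x.1 x.2)) :
    ∃ (P : Prog) (p : Polynomial ℕ), ∀ a, IsExtendable (E (c a)) →
      ∃ (w : List Event) (y : Val), P.Run (enc a) w y ∧
        Event.outputs w = (leaves (E (c a)) (atoms a) []).map (fun l => enc (f (c a) l)) ∧
        Event.DelayAtMost (p.eval (encSize a)) w := by
  obtain ⟨pc, hpc⟩ := hc.exists_encSize_le
  obtain ⟨pa, hpa⟩ := hatoms.exists_encSize_le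
  have hinit : PolyTime (fun a => (c a,
      if E (c a) (atoms a) [] then [(atoms a, ([] : List β))] else [])) :=
    hc.pair (PolyTime.ite (c := fun a => E (c a) (atoms a) [])
      (hE.comp (hc.pair (hatoms.pair (.const []))))
      ((hatoms.pair (.const [])).cons (.const [])) (.const []))
  obtain ⟨I, pI, hI⟩ := hinit
  obtain ⟨D, pD, hD⟩ := PolyTime.descend hE
  have hT : PolyTime (fun x : γ × List (List β × List β) =>
      f x.1 (x.2.headD ([], [])).2) :=
    hf.comp (.pair PolyTime.id.fst (PolyTime.id.snd.headD ([], [])).snd)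
  obtain ⟨T, pT, hT⟩ := hT
  have hR : PolyTime (fun x : (γ × List (List β × List β)) × δ => (x.1.1, x.1.2.tail)) :=
    .pair PolyTime.id.fst.fst PolyTime.id.fst.snd.tail
  obtain ⟨R, pR, hR⟩ := hR
  -- `S` bounds a loop state: at most `pa + 1` nodes of size at most `pa + 2`, together with the
  -- context `c a`. `B` bounds the cost of initialization and of each phase of a round.
  let S : Polynomial ℕ := pc + ((pa + 1) * ((pa + 2) + 1) + 1) + 1
  let B : Polynomial ℕ := S + pI + pD.comp S + pT.comp (pD.comp S) +
    pR.comp (pD.comp S + pT.comp (pD.comp S) + 1)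
  let F : Prog := .seq D (.seq (.pair .skip (.seq T .emit)) R)
  refine ⟨.seq I (.loop .tl F), 12 * B, fun a hEa => ?_⟩
  have hB : B.eval (encSize a) = S.eval (encSize a) + pI.eval (encSize a) +
      pD.eval (S.eval (encSize a)) + pT.eval (pD.eval (S.eval (encSize a))) +
      pR.eval (pD.eval (S.eval (encSize a)) + pT.eval (pD.eval (S.eval (encSize a))) + 1) := by
    simp [B]
  have hS : S.eval (encSize a) = pc.eval (encSize a) +
      ((pa.eval (encSize a) + 1) * ((pa.eval (encSize a) + 2) + 1) + 1) + 1 := by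
    simp [S]
  -- Induction on the leaves below the stack, one of which is output and removed in each round. The
  -- loop test `.tl` reads off the stack.
  have hloop : ∀ (L : List (List β)) (st : List (List β × List β)),
      StackInv (E (c a)) (pa.eval (encSize a)) (pa.eval (encSize a) + 2) st →
      stackLeaves (E (c a)) st = L →
      ∃ (w : List Event) (y : Val), Prog.Run (.loop .tl F) (enc (c a, st)) w y ∧
        Event.outputs w = L.map (fun l => enc (f (c a) l)) ∧
        ∀ acc ≤ 4 * B.eval (encSize a),
          Event.Within (12 * B.eval (encSize a)) acc w := by
    intro L
    induction L with
    | nil =>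
      intro st hst hL
      -- Every node on the stack has a leaf below it, so without leaves there are no nodes.
      obtain rfl : st = [] := by
        cases st with
        | nil => rfl
        | cons n st =>
          obtain ⟨l, st', -, -, h⟩ := hst.descend hEa
          rw [hL] at h
          cases h
      have hsz : encSize (c a, ([] : List (List β × List β))) ≤ S.eval (encSize a) := by
        have := hpc a
        simp only [encSize_pair, encSize_nil, hS]
        omega
      refine ⟨_, _, Prog.Run.loop_stop (.tl _), by simp, fun acc hacc => ?_⟩
      simp only [Event.Within, List.cons_append, List.nil_append, size_enc]
      omega
    | cons l L ih =>
      intro st hst hL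
      cases st with
      | nil => cases hL
      | cons n st =>
        have hsz : encSize (c a, n :: st) ≤ S.eval (encSize a) := by
          have h₁ := hpc a
          have h₂ := hst.encSize_le
          rw [encSize_pair, hS]
          omega
        obtain ⟨l', st', h₁, h₂, h₃⟩ := hst.descend hEa
        rw [hL, List.cons.injEq] at h₃
        obtain ⟨rfl, h₃⟩ := h₃
        obtain ⟨w, y, hw, ho, hd⟩ := ih st' h₂.tail h₃.symm
        have hD' := hD (c a, n :: st)
        simp only [h₁] at hD'
        have hT' := hT (c a, ([], l) :: st')
        simp only [List.headD_cons] at hT'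
        have hR' := hR ((c a, ([], l) :: st'), f (c a) l)
        simp only [List.tail_cons] at hR'
        have k₁ := pD.eval_le_eval_nat hsz
        have k₂ : encSize (c a, (([] : List β), l) :: st') ≤ pD.eval (S.eval (encSize a)) :=
          hD'.size_le.trans k₁
        have k₃ := pT.eval_le_eval_nat k₂
        have k₄ : encSize (f (c a) l) ≤ pT.eval (pD.eval (S.eval (encSize a))) :=
          hT'.size_le.trans k₃
        have k₅ := pR.eval_le_eval_nat (show encSize ((c a, (([] : List β), l) :: st'),
          f (c a) l) ≤ pD.eval (S.eval (encSize a)) +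
            pT.eval (pD.eval (S.eval (encSize a))) + 1 by
          rw [encSize_pair]; omega)
        obtain ⟨w', hw', ho', hd'⟩ := run_round (C := .tl) (F := F)
          (x := enc (c a, n :: st)) (s := B.eval (encSize a))
          (b := 12 * B.eval (encSize a)) (t := enc (n :: st)) rfl
          (by simp [enc, Val.ofList]) (by rw [size_enc]; omega)
          (Computes.tl.mono (by rw [size_enc]; omega)) (hD'.mono (by omega))
          (hT'.mono (by omega)) (hR'.mono (by omega)) le_rfl hw hd
        exact ⟨w', y, hw', by rw [ho', ho]; rfl, hd'⟩
  obtain ⟨wI, rI, oI, tI⟩ := hI a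
  have hst : StackInv (E (c a)) (pa.eval (encSize a)) (pa.eval (encSize a) + 2)
      (if E (c a) (atoms a) [] then [(atoms a, ([] : List β))] else []) := by
    split
    · next h =>
      have h₁ := hpa a
      have h₂ := length_lt_encSize (atoms a)
      refine ⟨by simpa using h, ?_, ?_, trivial⟩
      · simp only [List.mem_singleton, forall_eq, encSize_pair, encSize_nil]
        omega
      · simp only [List.length_nil]
        omega
    · exact ⟨by simp, by simp, trivial⟩
  obtain ⟨w, y, hw, ho, hd⟩ := hloop _ _ hst rfl
  refine ⟨_, _, .seq rI hw, ?_, ?_⟩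
  · rw [Event.outputs_append, oI, ho, List.nil_append]
    congr 1
    split
    · simp [stackLeaves]
    · next h => rw [leaves_eq_nil hEa (by simpa using h)]; rfl
  · refine Event.Within.delayAtMost (acc := 0) ?_
    rw [Event.within_append_iff oI]
    simp only [Polynomial.eval_mul, Polynomial.eval_ofNat]
    exact hd _ (by omega)

end Enumeration

/-! ### Deciding whether a set of operations extends to a run -/

instance {k : ℕ} : Inhabited (Label k) := ⟨Label.eps⟩

namespace RawVA

variable {k : ℕ}

/-- The operation `e` does not contradict the chosen operations `l` and is one of these or of the
remaining ones `r`. -/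
def allowed (r l : List (Label k × ℕ)) (e : Label k × ℕ) : Bool :=
  (decide (e ∈ l) || decide (e ∈ r)) && l.all fun f => !decide (f.1 = e.1) || decide (f.2 = e.2)

/-- Steps between configurations on a document given by its positioned letters, with allowed
operations only. -/
def move (X : RawVA k) (D : List (ℕ × Fin k × ℕ)) (r l : List (Label k × ℕ)) (x y : ℕ × ℕ) :
    Bool :=
  X.2.2.2.any fun t => decide (t.1 = x.1) && (decide (t.2.2 = y.1) &&
    if decide (t.2.1.tag = 1) then
      D.any fun z => decide (z.1 = x.2) && (decide (Label.letter z.2.1 = t.2.1) &&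
        decide (z.2.2 = y.2))
    else decide (x.2 = y.2) && (!t.2.1.isOp || allowed r l (t.2.1, x.2)))

/-- The positions of a document given by its positioned letters. -/
def positions (D : List (ℕ × Fin k × ℕ)) : List ℕ := 1 :: D.map fun z => z.2.2

/-- Whether there is an accepting run to the position `N` with the operations `l` and further
operations from `r`. -/
def hasExtension (X : RawVA k) (N : ℕ) (D : List (ℕ × Fin k × ℕ)) (r l : List (Label k × ℕ)) :
    Bool :=
  (l.all fun e => e.1.isOp && X.hasLabel e.1) &&
    (reachClosure (X.1 ×ˢ positions D) (fun x => decide (x = (X.2.1, 1))) (X.move D r l)).any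
      fun x => decide (x.1 ∈ X.2.2.1) && decide (x.2 = N)

/-- Whether some automaton in a list has such a run. -/
def someExtends (c : List (RawVA k) × ℕ × List (ℕ × Fin k × ℕ)) (r l : List (Label k × ℕ)) :
    Bool :=
  c.1.any fun X => X.hasExtension c.2.1 c.2.2 r l

/-- The operations that may occur in runs. -/
def operations (c : List (RawVA k) × ℕ × List (ℕ × Fin k × ℕ)) : List (Label k × ℕ) :=
  ((c.1.flatMap fun X => (X.2.2.2.filter fun t => t.2.1.isOp).map fun t => t.2.1) ×ˢ
    positions c.2.2).nub

/-- The table of the mapping given by a set of operations. -/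
def tableOf (l : List (Label k × ℕ)) : List (ℕ × ℕ × ℕ) :=
  (l.flatMap fun e => (l.filter fun f => decide (e.1.tag = 2) &&
    decide (f.1 = Label.cls e.1.arg)).map fun f => (e.1.arg, e.2, f.2)).nub

theorem mem_tableOf {l : List (Label k × ℕ)} {v i j : ℕ} :
    (v, i, j) ∈ tableOf l ↔ (Label.opn v, i) ∈ l ∧ (Label.cls v, j) ∈ l := by
  simp only [tableOf, (List.nub_spec _).2, List.mem_flatMap, List.mem_map, List.mem_filter,
    Bool.and_eq_true, decide_eq_true_eq, Prod.exists, Prod.mk.injEq]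
  constructor
  · rintro ⟨a, _, ha, b, _, ⟨hb, ht, rfl⟩, rfl, rfl, rfl⟩
    cases a <;> simp [Label.tag] at ht
    exact ⟨ha, hb⟩
  · rintro ⟨h₁, h₂⟩
    exact ⟨_, _, h₁, _, _, ⟨h₂, rfl, rfl⟩, rfl, rfl, rfl⟩

theorem allowed_iff {r l : List (Label k × ℕ)} {e : Label k × ℕ} :
    allowed r l e = true ↔ (e ∈ l ∨ e ∈ r) ∧ ∀ f ∈ l, f.1 = e.1 → f.2 = e.2 := by
  simp only [allowed, Bool.and_eq_true, Bool.or_eq_true, decide_eq_true_eq, List.all_eq_true,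
    Bool.not_eq_true', decide_eq_false_iff_not, imp_iff_not_or]

theorem mem_positions {d : List (Fin k)} {i : ℕ} :
    i ∈ positions (positioned d) ↔ 1 ≤ i ∧ i ≤ d.length + 1 := by
  simp only [positions, List.mem_cons, List.mem_map, Prod.exists, mem_positioned]
  constructor
  · rintro (rfl | ⟨j, b, _, ⟨h₁, h₂, rfl⟩, rfl⟩)
    · omega
    · obtain ⟨h, -⟩ := List.getElem?_eq_some_iff.1 h₂
      omega
  · rintro ⟨h₁, h₂⟩
    rcases h₁.eq_or_lt with rfl | h₁
    · exact .inl rfl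
    · exact .inr ⟨i - 1, d[i - 1 - 1], i, ⟨by omega, by simp, by omega⟩, rfl⟩

end RawVA

/-! ### The extension test in polynomial time -/

namespace PolyTime

variable {k : ℕ} {α : Type} [Enc α]

theorem letter {b : α → Fin k} (h : PolyTime b) : PolyTime (fun a => Label.letter (b a)) :=
  ((const (1 : ℕ)).pair h).of_enc_eq fun _ => rfl

theorem cls {v : α → ℕ} (h : PolyTime v) : PolyTime (fun a => (Label.cls (v a) : Label k)) :=
  ((const (3 : ℕ)).pair h).of_enc_eq fun _ => rfl

theorem allowed {r l : α → List (Label k × ℕ)} {e : α → Label k × ℕ} (hr : PolyTime r)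
    (hl : PolyTime l) (he : PolyTime e) :
    PolyTime (fun a => RawVA.allowed (r a) (l a) (e a)) := by
  refine PolyTime.of_enc_eq (((he.mem hl).or (he.mem hr)).and (hl.all
    (f := fun a (f : Label k × ℕ) => !decide (f.1 = (e a).1) || decide (f.2 = (e a).2))
    ((id.snd.fst.eq (he.comp id.fst).fst).not.or (id.snd.snd.eq (he.comp id.fst).snd))))
    fun a => ?_
  unfold RawVA.allowed
  congr!

theorem move {X : α → RawVA k} {D : α → List (ℕ × Fin k × ℕ)} {r l : α → List (Label k × ℕ)}
    {x y : α → ℕ × ℕ} (hX : PolyTime X) (hD : PolyTime D) (hr : PolyTime r) (hl : PolyTime l)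
    (hx : PolyTime x) (hy : PolyTime y) :
    PolyTime (fun a => (X a).move (D a) (r a) (l a) (x a) (y a)) := by
  refine hX.snd.snd.snd.any (f := fun a (t : ℕ × Label k × ℕ) =>
    decide (t.1 = (x a).1) && (decide (t.2.2 = (y a).1) &&
    if decide (t.2.1.tag = 1) then
      (D a).any fun z => decide (z.1 = (x a).2) && (decide (Label.letter z.2.1 = t.2.1) &&
        decide (z.2.2 = (y a).2))
    else decide ((x a).2 = (y a).2) &&
      (!t.2.1.isOp || RawVA.allowed (r a) (l a) (t.2.1, (x a).2)))) ?_
  refine (id.snd.fst.eq (hx.comp id.fst).fst).and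
    ((id.snd.snd.snd.eq (hy.comp id.fst).fst).and
      ((id.snd.snd.fst.tag.eq (const 1)).ite ?_ ?_))
  · exact (hD.comp id.fst).any (f := fun (q : α × ℕ × Label k × ℕ) (z : ℕ × Fin k × ℕ) =>
      decide (z.1 = (x q.1).2) && (decide (Label.letter z.2.1 = q.2.2.1) &&
        decide (z.2.2 = (y q.1).2)))
      ((id.snd.fst.eq (hx.comp id.fst.fst).snd).and
        ((id.snd.snd.fst.letter.eq id.fst.snd.snd.fst).and
          (id.snd.snd.snd.eq (hy.comp id.fst.fst).snd)))
  · exact ((hx.comp id.fst).snd.eq (hy.comp id.fst).snd).and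
      (id.snd.snd.fst.isOp.not.or ((hr.comp id.fst).allowed (hl.comp id.fst)
        (id.snd.snd.fst.pair (hx.comp id.fst).snd)))

theorem positions {D : α → List (ℕ × Fin k × ℕ)} (hD : PolyTime D) :
    PolyTime (fun a => RawVA.positions (D a)) :=
  (const 1).cons (hD.map (f := fun _ (z : ℕ × Fin k × ℕ) => z.2.2) id.snd.snd.snd)

theorem hasExtension {X : α → RawVA k} {N : α → ℕ} {D : α → List (ℕ × Fin k × ℕ)}
    {r l : α → List (Label k × ℕ)} (hX : PolyTime X) (hN : PolyTime N) (hD : PolyTime D)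
    (hr : PolyTime r) (hl : PolyTime l) :
    PolyTime (fun a => (X a).hasExtension (N a) (D a) (r a) (l a)) := by
  refine (hl.all (f := fun a (e : Label k × ℕ) => e.1.isOp && (X a).hasLabel e.1)
    (id.snd.fst.isOp.and ((hX.comp id.fst).hasLabel id.snd.fst))).and
    (any (f := fun a (x : ℕ × ℕ) => decide (x.1 ∈ (X a).2.2.1) && decide (x.2 = N a))
      (closure (S := fun a (x : ℕ × ℕ) => decide (x = ((X a).2.1, 1)))
        (R := fun a x y => (X a).move (D a) (r a) (l a) x y) (hX.fst.product hD.positions) ?_ ?_)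
      ((id.snd.fst.mem (hX.comp id.fst).snd.snd.fst).and (id.snd.snd.eq (hN.comp id.fst))))
  · exact id.snd.eq ((hX.comp id.fst).snd.fst.pair (const 1))
  · exact move (hX.comp id.fst) (hD.comp id.fst) (hr.comp id.fst) (hl.comp id.fst) id.snd.fst
      id.snd.snd

theorem someExtends : PolyTime (fun x : (List (RawVA k) × ℕ × List (ℕ × Fin k × ℕ)) ×
    List (Label k × ℕ) × List (Label k × ℕ) => RawVA.someExtends x.1 x.2.1 x.2.2) :=
  id.fst.fst.any (f := fun (x : (List (RawVA k) × ℕ × List (ℕ × Fin k × ℕ)) ×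
    List (Label k × ℕ) × List (Label k × ℕ)) (X : RawVA k) =>
      X.hasExtension x.1.2.1 x.1.2.2 x.2.1 x.2.2)
    (hasExtension id.snd id.fst.fst.snd.fst id.fst.fst.snd.snd id.fst.snd.fst id.fst.snd.snd)

theorem operations {c : α → List (RawVA k) × ℕ × List (ℕ × Fin k × ℕ)} (hc : PolyTime c) :
    PolyTime (fun a => RawVA.operations (c a)) :=
  nub (product (flatMap (f := fun _ (X : RawVA k) =>
      (X.2.2.2.filter fun t => t.2.1.isOp).map fun t => t.2.1) hc.fst
    (map (f := fun _ (t : ℕ × Label k × ℕ) => t.2.1)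
      (filter (f := fun _ (t : ℕ × Label k × ℕ) => t.2.1.isOp) id.snd.snd.snd.snd
        id.snd.snd.fst.isOp) id.snd.snd.fst)) hc.snd.snd.positions)

theorem tableOf {l : α → List (Label k × ℕ)} (hl : PolyTime l) :
    PolyTime (fun a => RawVA.tableOf (l a)) :=
  nub (hl.flatMap (f := fun a (e : Label k × ℕ) => ((l a).filter fun f =>
      decide (e.1.tag = 2) && decide (f.1 = Label.cls e.1.arg)).map fun f => (e.1.arg, e.2, f.2))
    (map (f := fun (x : α × Label k × ℕ) (f : Label k × ℕ) => (x.2.1.arg, x.2.2, f.2))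
      (filter (f := fun (x : α × Label k × ℕ) (f : Label k × ℕ) =>
        decide (x.2.1.tag = 2) && decide (f.1 = Label.cls x.2.1.arg)) (hl.comp id.fst)
        ((id.fst.snd.fst.tag.eq (const 2)).and (id.snd.fst.eq id.fst.snd.fst.arg.cls)))
      (id.fst.snd.fst.arg.pair (id.fst.snd.snd.pair id.snd.snd))))

end PolyTime

/-! ### Correctness of the extension test -/

namespace VA

variable {k : ℕ} {B : VA k} {C : List (VA k)} {d : List (Fin k)}

theorem move_iff {r l : List (Label k × ℕ)} {x y : ℕ × ℕ} :
    B.raw.move (positioned d) r l x y = true ↔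
      ∃ m, (x.1, m, y.1) ∈ B.trans ∧
        ((∃ a, m = Label.letter a ∧ 1 ≤ x.2 ∧ d[x.2 - 1]? = some a ∧ y.2 = x.2 + 1) ∨
          (¬ m.IsLetter ∧ y.2 = x.2 ∧ (m.IsOp → RawVA.allowed r l (m, x.2) = true))) := by
  simp only [RawVA.move, raw, List.any_eq_true, Bool.and_eq_true, decide_eq_true_eq, Prod.exists]
  constructor
  · rintro ⟨p, m, q, ht, rfl, rfl, h⟩
    refine ⟨m, ht, ?_⟩
    split at h
    · simp only [List.any_eq_true, Bool.and_eq_true, decide_eq_true_eq, Prod.exists,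
        mem_positioned] at h
      obtain ⟨i, a, j, ⟨h₁, h₂, rfl⟩, rfl, rfl, h⟩ := h
      exact .inl ⟨a, rfl, h₁, h₂, h.symm⟩
    · next hm =>
      rw [Label.tag_eq_one_iff] at hm
      simp only [Bool.and_eq_true, decide_eq_true_eq, Bool.or_eq_true, Bool.not_eq_true'] at h
      refine .inr ⟨hm, h.1.symm, fun hop => h.2.resolve_left fun hf => ?_⟩
      rw [Label.isOp_iff.2 hop] at hf
      cases hf
  · rintro ⟨m, ht, h⟩
    refine ⟨_, m, _, ht, rfl, rfl, ?_⟩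
    rcases h with ⟨a, rfl, h₁, h₂, h₃⟩ | ⟨h₁, h₂, h₃⟩
    · rw [if_pos (show (Label.letter a).tag = 1 from rfl)]
      simp only [List.any_eq_true, Bool.and_eq_true, decide_eq_true_eq, Prod.exists,
        mem_positioned]
      exact ⟨_, a, _, ⟨h₁, h₂, rfl⟩, rfl, rfl, h₃.symm⟩
    · rw [if_neg (by rwa [Label.tag_eq_one_iff])]
      simp only [Bool.and_eq_true, decide_eq_true_eq, Bool.or_eq_true, Bool.not_eq_true']
      refine ⟨h₂.symm, ?_⟩
      cases hop : m.isOp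
      · exact .inl rfl
      · exact .inr (h₃ (Label.isOp_iff.1 hop))

/-- Whether an operation is allowed depends on the current configuration and not on the history, so
runs are walks in a finite graph. The bounds on the index keep the walk among the listed positions
and exclude index 0, at which `d[i - 1]?` would also yield the first letter. -/
theorem reflTransGen_move_iff {r l : List (Label k × ℕ)} {x y : ℕ × ℕ} (hx : 1 ≤ x.2)
    (hx' : x.2 ≤ d.length + 1) :
    Relation.ReflTransGen (fun x y => B.raw.move (positioned d) r l x y = true ∧
        y ∈ B.raw.1 ×ˢ RawVA.positions (positioned d)) x y ↔
      ∃ ρ, B.Steps d x.1 x.2 ρ y.1 y.2 ∧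
        ∀ e ∈ ρ, e.1.IsOp → RawVA.allowed r l e = true := by
  constructor
  · intro h
    induction h using Relation.ReflTransGen.head_induction_on with
    | refl => exact ⟨[], .refl _ _, by simp⟩
    | head h _ ih =>
      obtain ⟨h, hU⟩ := h
      have hp := RawVA.mem_positions.1 (List.mem_sprod.1 hU).2
      obtain ⟨ρ, hs, hρ⟩ := ih hp.1 hp.2
      obtain ⟨m, ht, ⟨a, rfl, h₁, h₂, h₃⟩ | ⟨h₁, h₂, h₃⟩⟩ := move_iff.1 h
      · rw [h₃] at hs
        refine ⟨_, .letter ht h₂ hs, ?_⟩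
        simp only [List.mem_cons, forall_eq_or_imp]
        exact ⟨fun hop => absurd ⟨a, rfl⟩ hop.not_isLetter, hρ⟩
      · rw [h₂] at hs
        refine ⟨_, hs.other h₁ ht, ?_⟩
        simp only [List.mem_cons, forall_eq_or_imp]
        exact ⟨h₃, hρ⟩
  · rintro ⟨ρ, hs, hρ⟩
    obtain ⟨p, i⟩ := x
    obtain ⟨q, j⟩ := y
    simp only at hs hx hx'
    revert hx hx' hρ
    induction hs using Steps.induction with
    | refl => exact fun _ _ _ => .refl
    | @other p p' q i j m ρ hl ht h ih =>
      intro hρ hx hx'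
      simp only [List.mem_cons, forall_eq_or_imp] at hρ
      refine .head (b := (p', i)) ⟨move_iff.2 ⟨m, ht, .inr ⟨hl, rfl, hρ.1⟩⟩, ?_⟩ (ih hρ.2 hx hx')
      exact List.mem_sprod.2 ⟨B.dst_mem _ ht, RawVA.mem_positions.2 ⟨hx, hx'⟩⟩
    | @letter p p' q i j a ρ ht hd h ih =>
      intro hρ hx hx'
      simp only [List.mem_cons, forall_eq_or_imp] at hρ
      obtain ⟨hlt, -⟩ := List.getElem?_eq_some_iff.1 hd
      have hi : i + 1 ≤ d.length + 1 := by omega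
      refine .head (b := (p', i + 1)) ⟨move_iff.2 ⟨_, ht, .inl ⟨a, rfl, hx, hd, rfl⟩⟩, ?_⟩
        (ih hρ.2 (by simp) hi)
      exact List.mem_sprod.2 ⟨B.dst_mem _ ht, RawVA.mem_positions.2 ⟨by simp, hi⟩⟩

/-- An operation of an accepting run occurs at one index only. -/
theorem index_unique {ρ : List (Label k × ℕ)} (h : ValidRun ρ) {l : Label k} (hl : l.IsOp)
    {i j : ℕ} (hi : (l, i) ∈ ρ) (hj : (l, j) ∈ ρ) : i = j := by
  obtain ⟨v, hv⟩ := hl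
  have hi : (l, i) ∈ opsOf v ρ := mem_opsOf.2 ⟨hi, Label.isOpOf_iff.1 hv⟩
  have hj : (l, j) ∈ opsOf v ρ := mem_opsOf.2 ⟨hj, Label.isOpOf_iff.1 hv⟩
  rcases (validRun_iff ρ).1 h v with h | h
  · rw [List.map_eq_nil_iff.1 h] at hi
    cases hi
  · obtain ⟨a, b, e⟩ := eq_pair_of_map_eq h
    rw [e] at hi hj
    rcases Label.isOpOf_iff.1 hv with rfl | rfl <;> simp at hi hj <;> omega

/-- An accepting run of a functional automaton performs every labelled operation exactly once. If it
uses allowed pairs only, it performs each operation of `l` and cannot do so at another index. So no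
memory of the chosen pairs already met is needed. -/
theorem hasExtension_iff (hB : B.Functional) {r l : List (Label k × ℕ)} :
    B.raw.hasExtension (d.length + 1) (positioned d) r l = true ↔
      ∃ ρ, B.AcceptingRun d ρ ∧ (∀ e ∈ l, e ∈ ρ ∧ e.1.IsOp) ∧
        ∀ e ∈ ρ, e.1.IsOp → e ∈ l ∨ e ∈ r := by
  have hcl : (∃ x ∈ reachClosure (B.raw.1 ×ˢ RawVA.positions (positioned d))
        (fun x => decide (x = (B.raw.2.1, 1))) (B.raw.move (positioned d) r l),
        x.1 ∈ B.raw.2.2.1 ∧ x.2 = d.length + 1) ↔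
      ∃ ρ, B.AcceptingRun d ρ ∧ ∀ e ∈ ρ, e.1.IsOp → RawVA.allowed r l e = true := by
    simp only [mem_reachClosure, decide_eq_true_eq]
    constructor
    · rintro ⟨⟨q, j⟩, ⟨_, _, rfl, h⟩, hq, rfl⟩
      obtain ⟨ρ, hs, hρ⟩ := (reflTransGen_move_iff (by simp) (by simp)).1 h
      exact ⟨ρ, ⟨q, hq, hs⟩, hρ⟩
    · rintro ⟨ρ, ⟨q, hq, hs⟩, hρ⟩
      exact ⟨(q, d.length + 1), ⟨(B.init, 1), List.mem_sprod.2 ⟨B.init_mem,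
        RawVA.mem_positions.2 ⟨by simp, by simp⟩⟩, rfl,
        (reflTransGen_move_iff (by simp) (by simp)).2 ⟨ρ, hs, hρ⟩⟩, hq, rfl⟩
  simp only [RawVA.hasExtension, Bool.and_eq_true, List.any_eq_true, List.all_eq_true,
    decide_eq_true_eq, hcl, Label.isOp_iff]
  constructor
  · rintro ⟨hl, ρ, hρ, ha⟩
    refine ⟨ρ, hρ, fun e he => ⟨?_, (hl e he).1⟩, fun e he hop =>
      (RawVA.allowed_iff.1 (ha e he hop)).1⟩
    obtain ⟨hop, hlab⟩ := hl e he
    obtain ⟨p, q, ht⟩ := hasLabel_iff.1 hlab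
    obtain ⟨q', hq', hs⟩ := hρ
    have := hB.mem_of_mem hs.path hq' hop ht
    obtain ⟨⟨m, i⟩, hm, e'⟩ := List.mem_map.1 this
    simp only at e'
    subst e'
    -- The run has the operation somewhere, and being allowed forces the index prescribed by `l`.
    have := (RawVA.allowed_iff.1 (ha _ hm hop)).2 e he rfl
    simp only at this
    rw [← this] at hm
    exact hm
  · rintro ⟨ρ, hρ, h₁, h₂⟩
    refine ⟨fun e he => ⟨(h₁ e he).2, ?_⟩, ρ, hρ, fun e he hop =>
      RawVA.allowed_iff.2 ⟨h₂ e he hop, fun f hf hfe => ?_⟩⟩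
    · obtain ⟨q', hq', hs⟩ := hρ
      exact hasLabel_iff.2 (hs.label_mem e (h₁ e he).1)
    · have hf := (h₁ f hf).1
      obtain ⟨m, i⟩ := f
      obtain ⟨m', j⟩ := e
      simp only at hfe
      subst hfe
      exact index_unique (hB d ρ hρ).1 hop hf he

end VA

/-! ### Enumeration of the join with polynomial delay -/

section Leaves

variable {β : Type} {E : List β → List β → Bool}

theorem of_mem_leaves {r l l' : List β} (h : l' ∈ leaves E r l) : E [] l' = true := by
  induction r generalizing l with
  | nil =>
    rw [leaves] at h
    split at h
    · next hE => rwa [List.mem_singleton.1 h]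
    · cases h
  | cons e r ih => exact (List.mem_append.1 h).elim ih ih

theorem mem_of_mem_leaves {r l l' : List β} (h : l' ∈ leaves E r l) :
    (∀ e ∈ l, e ∈ l') ∧ ∀ e ∈ l', e ∈ l ∨ e ∈ r := by
  induction r generalizing l with
  | nil =>
    rw [leaves] at h
    split at h
    · rw [List.mem_singleton.1 h]
      exact ⟨fun _ h => h, fun _ h => .inl h⟩
    · cases h
  | cons e r ih =>
    simp only [List.mem_cons]
    rcases List.mem_append.1 h with h | h
    · obtain ⟨h₁, h₂⟩ := ih h
      simp only [List.mem_cons, forall_eq_or_imp] at h₁ h₂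
      exact ⟨h₁.2, fun a ha => by have := h₂ a ha; tauto⟩
    · obtain ⟨h₁, h₂⟩ := ih h
      exact ⟨h₁, fun a ha => by have := h₂ a ha; tauto⟩

/-- Choose the elements of `T` and discard the others; the resulting leaf has exactly the members of
`T`. -/
theorem exists_mem_leaves {T : Set β} {r l : List β} (hl : ∀ e ∈ l, e ∈ T)
    (hT : ∀ e ∈ T, e ∈ l ∨ e ∈ r) (hE : ∀ l', (∀ e, e ∈ l' ↔ e ∈ T) → E [] l' = true) :
    ∃ l' ∈ leaves E r l, ∀ e, e ∈ l' ↔ e ∈ T := by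
  induction r generalizing l with
  | nil =>
    have h : ∀ e, e ∈ l ↔ e ∈ T := fun e =>
      ⟨hl e, fun he => (hT e he).resolve_right List.not_mem_nil⟩
    exact ⟨l, by simp [leaves, hE l h], h⟩
  | cons e r ih =>
    by_cases he : e ∈ T
    · obtain ⟨l', h, h'⟩ := ih (l := e :: l) (by simpa [he] using hl) fun a ha => by
        have := hT a ha
        simp only [List.mem_cons] at this ⊢
        tauto
      exact ⟨l', List.mem_append_left _ h, h'⟩
    · obtain ⟨l', h, h'⟩ := ih hl fun a ha => by
        have := hT a ha
        rcases this with h | h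
        · exact .inl h
        · rcases List.mem_cons.1 h with rfl | h
          · exact absurd ha he
          · exact .inr h
      exact ⟨l', List.mem_append_right _ h, h'⟩

/-- The element decided at a node separates its two subtrees: without repetitions it belongs to all
leaves of the first and to none of the second. -/
theorem pairwise_leaves {r l : List β} (hr : r.Nodup) (hrl : ∀ e ∈ r, e ∉ l) :
    (leaves E r l).Pairwise fun a b => ∃ e, ¬ (e ∈ a ↔ e ∈ b) := by
  induction r generalizing l with
  | nil =>
    rw [leaves]
    split <;> simp
  | cons e r ih =>
    obtain ⟨her, hr⟩ := List.nodup_cons.1 hr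
    obtain ⟨hel, hrl⟩ := List.forall_mem_cons.1 hrl
    refine List.pairwise_append.2 ⟨ih hr fun a ha => ?_, ih hr hrl, fun a ha b hb => ⟨e, ?_⟩⟩
    · rw [List.mem_cons, not_or]
      exact ⟨fun h => her (h ▸ ha), hrl a ha⟩
    · have h₁ := (mem_of_mem_leaves ha).1 e List.mem_cons_self
      have h₂ : e ∉ b := fun h => ((mem_of_mem_leaves hb).2 e h).elim hel her
      exact fun h => h₂ (h.1 h₁)

end Leaves

/-! ### Leaves as sets of operations, and their tables -/

namespace VA

variable {k : ℕ} {C : List (VA k)} {CS : List (RawVA k)} {d : List (Fin k)}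
  {ρ l : List (Label k × ℕ)} {μ : Mapping}

theorem someExtends_iff (hC : ∀ B ∈ C, B.Functional) (hCS : ∀ X, X ∈ CS ↔ ∃ B ∈ C, B.raw = X)
    {r : List (Label k × ℕ)} :
    RawVA.someExtends (CS, d.length + 1, positioned d) r l = true ↔
      ∃ B ∈ C, ∃ ρ, B.AcceptingRun d ρ ∧ (∀ e ∈ l, e ∈ ρ ∧ e.1.IsOp) ∧
        ∀ e ∈ ρ, e.1.IsOp → e ∈ l ∨ e ∈ r := by
  simp only [RawVA.someExtends, List.any_eq_true, hCS]
  constructor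
  · rintro ⟨_, ⟨B, hB, rfl⟩, h⟩
    exact ⟨B, hB, (hasExtension_iff (hC B hB)).1 h⟩
  · rintro ⟨B, hB, h⟩
    exact ⟨_, ⟨B, hB, rfl⟩, (hasExtension_iff (hC B hB)).2 h⟩

/-- A witnessing run either performs `e` or does not, and accordingly witnesses one of the two
children. The same run serves the parent in the converse direction. -/
theorem isExtendable_someExtends (hC : ∀ B ∈ C, B.Functional)
    (hCS : ∀ X, X ∈ CS ↔ ∃ B ∈ C, B.raw = X) :
    IsExtendable (RawVA.someExtends (CS, d.length + 1, positioned d)) := by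
  intro e r l
  rw [Bool.eq_iff_iff, Bool.or_eq_true]
  simp only [someExtends_iff hC hCS, List.mem_cons]
  constructor
  · rintro ⟨B, hB, ρ, hρ, h₁, h₂⟩
    by_cases he : e ∈ ρ ∧ e.1.IsOp
    · refine .inl ⟨B, hB, ρ, hρ, ?_, fun f hf hop => ?_⟩
      · rintro f (rfl | hf)
        · exact he
        · exact h₁ f hf
      · have := h₂ f hf hop
        tauto
    · refine .inr ⟨B, hB, ρ, hρ, h₁, fun f hf hop => ?_⟩
      rcases h₂ f hf hop with h | rfl | h
      · exact .inl h
      · exact absurd ⟨hf, hop⟩ he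
      · exact .inr h
  · rintro (⟨B, hB, ρ, hρ, h₁, h₂⟩ | ⟨B, hB, ρ, hρ, h₁, h₂⟩)
    · refine ⟨B, hB, ρ, hρ, fun f hf => h₁ f (.inr hf), fun f hf hop => ?_⟩
      have := h₂ f hf hop
      tauto
    · refine ⟨B, hB, ρ, hρ, h₁, fun f hf hop => ?_⟩
      have := h₂ f hf hop
      tauto

theorem AcceptingRun.mem_operations {B : VA k} (hρ : B.AcceptingRun d ρ) (hB : B.raw ∈ CS) {N : ℕ}
    {e : Label k × ℕ} (he : e ∈ ρ) (hop : e.1.IsOp) :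
    e ∈ RawVA.operations (CS, N, positioned d) := by
  obtain ⟨q, hq, hs⟩ := hρ
  obtain ⟨p, p', ht⟩ := hs.label_mem e he
  rw [RawVA.operations, (List.nub_spec _).2, List.mem_sprod, List.mem_flatMap]
  refine ⟨⟨_, hB, List.mem_map.2 ⟨_, List.mem_filter.2 ⟨ht, Label.isOp_iff.2 hop⟩, rfl⟩⟩, ?_⟩
  exact RawVA.mem_positions.2 (hs.le.2 e he)

/-- The operations of a run are determined by its mapping. -/
theorem AcceptingRun.mem_iff {B : VA k} (h : B.AcceptingRun d ρ) (hρ : ValidRun ρ)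
    (hμ : IsRunMapping ρ μ) {e : Label k × ℕ} : e ∈ ρ ∧ e.1.IsOp ↔
      ∃ v s, μ v = some s ∧ (e = (Label.opn v, s.start) ∨ e = (Label.cls v, s.finish)) := by
  constructor
  · rintro ⟨he, v, hv⟩
    have he' : e ∈ opsOf v ρ := mem_opsOf.2 ⟨he, Label.isOpOf_iff.1 hv⟩
    obtain ⟨q, hq, hs⟩ := h
    rcases (validRun_iff ρ).1 hρ v with h | h
    · rw [List.map_eq_nil_iff.1 h] at he'
      cases he'
    · obtain ⟨s, e'⟩ := eq_span_of_mem hs hρ hμ h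
      refine ⟨v, s, e', ?_⟩
      rw [((isRunMapping_iff hρ).1 hμ v s).1 e'] at he'
      simpa using he'
  · rintro ⟨v, s, hs, h⟩
    have := (hμ v s).1 hs
    rcases h with rfl | rfl
    · exact ⟨this.1, v, Label.isOpOf_iff.2 (.inl rfl)⟩
    · exact ⟨this.2, v, Label.isOpOf_iff.2 (.inr rfl)⟩

theorem isRunMapping_congr (h : ∀ e, e ∈ l ↔ e ∈ ρ ∧ e.1.IsOp) :
    IsRunMapping l μ ↔ IsRunMapping ρ μ := by
  refine forall₂_congr fun v s => ?_
  have h₁ : (Label.opn v : Label k).IsOp := ⟨v, Label.isOpOf_iff.2 (.inl rfl)⟩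
  have h₂ : (Label.cls v : Label k).IsOp := ⟨v, Label.isOpOf_iff.2 (.inr rfl)⟩
  simp only [h, h₁, h₂, and_true]

/-- The triples come from an actual run, so their indices form spans. A variable occurs only once
because its span is determined by `μ` and the table has no repetitions. -/
theorem isTableOf_tableOf {B : VA k} (hρ : B.AcceptingRun d ρ) (hv : ValidRun ρ)
    (h : ∀ e, e ∈ l ↔ e ∈ ρ ∧ e.1.IsOp) (hμ : IsRunMapping l μ) :
    Val.IsTableOf (enc (RawVA.tableOf l)) μ := by
  have hμ' := (isRunMapping_congr h).1 hμ
  have key : ∀ t ∈ RawVA.tableOf l, ∃ x : ℕ × Span, (x.1, x.2.start, x.2.finish) = t := by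
    rintro ⟨v, i, j⟩ ht
    obtain ⟨h₁, h₂⟩ := RawVA.mem_tableOf.1 ht
    obtain ⟨w, s, hs, e | e⟩ := (hρ.mem_iff hv hμ').1 ((h _).1 h₁)
    · obtain ⟨e₁, rfl⟩ := Prod.mk.inj e
      obtain rfl := Label.opn.inj e₁
      refine ⟨(v, s), ?_⟩
      have h₃ := (hμ' v s).1 hs
      -- The span is known from the opening; uniqueness of the closing identifies its right end with
      -- `j`.
      rw [index_unique hv ⟨v, Label.isOpOf_iff.2 (.inr rfl)⟩ ((h _).1 h₂).1 h₃.2]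
    · cases (Prod.mk.inj e).1
  obtain ⟨L, hL⟩ : ∃ L : List (ℕ × Span),
      L.map (fun x => (x.1, x.2.start, x.2.finish)) = RawVA.tableOf l := by
    have : Nonempty (ℕ × Span) := ⟨(0, ⟨1, 1, le_rfl, le_rfl⟩)⟩
    choose! g hg using key
    refine ⟨(RawVA.tableOf l).map g, ?_⟩
    rw [List.map_map]
    exact (List.map_congr_left hg).trans (List.map_id _)
  have hmem : ∀ v s, (v, s) ∈ L ↔ μ v = some s := by
    intro v s
    rw [hμ v s, ← RawVA.mem_tableOf, ← hL, List.mem_map]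
    constructor
    · exact fun h => ⟨_, h, rfl⟩
    · rintro ⟨⟨v', s'⟩, h, e⟩
      simp only [Prod.mk.injEq] at e
      obtain ⟨rfl, e₁, e₂⟩ := e
      rwa [Span.ext e₁ e₂] at h
  refine ⟨L, ?_, fun v s => (hmem v s).symm, ?_⟩
  · have hnd : L.Nodup := List.Nodup.of_map (f := fun x : ℕ × Span => (x.1, x.2.start, x.2.finish)) (by
      rw [hL]
      exact (List.nub_spec _).1)
    refine List.pairwise_map.2 (hnd.imp_of_mem ?_)
    rintro ⟨v, s⟩ ⟨w, t⟩ hx hy hne rfl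
    have := ((hmem _ _).1 hx).symm.trans ((hmem _ _).1 hy)
    exact hne (by rw [Option.some_injective _ this])
  · rw [← hL]
    generalize L = L
    induction L with
    | nil => rfl
    | cons x L ih => exact congrArg (Val.cons (Val.ofEntry x)) ih

end VA

/-- The general enumeration is applied to all pairs of an operation and a position, with the test
ranging over all pairwise products at once. Each leaf is then the set of operations of an accepting
run, and every accepting run gives a leaf. -/
theorem exists_prog_enumerate_join (k : ℕ) : ∃ (P : Prog) (p : Polynomial ℕ), ∀ A₁ A₂ : VA k,
    A₁.DisjunctiveFunctional → A₂.DisjunctiveFunctional →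
    ∀ d : List (Fin k), ∃ (w : List Event) (y : Val),
      P.Run (Val.cons (Val.cons (Val.ofVA A₁) (Val.ofVA A₂)) (Val.ofDoc d)) w y ∧
      ListsMappings (Event.outputs w) (Spanner.join A₁.eval A₂.eval d) ∧
      Event.DelayAtMost
        (p.eval (Val.cons (Val.cons (Val.ofVA A₁) (Val.ofVA A₂)) (Val.ofDoc d)).size) w := by
  obtain ⟨P, p, hP⟩ := exists_prog_enumerate
    (c := fun a : (RawVA k × RawVA k) × List (Fin k) =>
      (a.1.1.joinComponents a.1.2, a.2.length + 1, positioned a.2))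
    (atoms := fun a => RawVA.operations
      (a.1.1.joinComponents a.1.2, a.2.length + 1, positioned a.2))
    (E := RawVA.someExtends) (f := fun _ l => RawVA.tableOf l)
    ((PolyTime.id.fst.fst.joinComponents PolyTime.id.fst.snd).pair
      PolyTime.id.snd.length_positioned)
    (((PolyTime.id.fst.fst.joinComponents PolyTime.id.fst.snd).pair
      PolyTime.id.snd.length_positioned).operations)
    PolyTime.someExtends PolyTime.id.snd.tableOf
  refine ⟨P, p, fun A₁ A₂ h₁ h₂ d => ?_⟩
  obtain ⟨C₁, h₁⟩ := h₁
  obtain ⟨C₂, h₂⟩ := h₂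
  have hC := (VA.join_hasComponents h₁ h₂).functional
  have hCS := fun X => VA.mem_joinComponents h₁ h₂ (X := X)
  obtain ⟨w, y, hr, ho, hd⟩ := hP ((A₁.raw, A₂.raw), d) (VA.isExtendable_someExtends hC hCS)
  refine ⟨w, y, hr, ?_, hd⟩
  simp only at ho
  set CS := A₁.raw.joinComponents A₂.raw
  set ops := RawVA.operations (CS, d.length + 1, positioned d) with hops
  set ls := leaves (RawVA.someExtends (CS, d.length + 1, positioned d)) ops [] with hls
  have hleaf : ∀ l ∈ ls, ∃ B ∈ VA.productComponents A₁ A₂ C₁ C₂, ∃ ρ, B.AcceptingRun d ρ ∧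
      ∀ e, e ∈ l ↔ e ∈ ρ ∧ e.1.IsOp := by
    intro l hl
    obtain ⟨B, hB, ρ, hρ, h₃, h₄⟩ := (VA.someExtends_iff hC hCS).1 (of_mem_leaves hl)
    exact ⟨B, hB, ρ, hρ, fun e => ⟨h₃ e, fun h => by simpa using h₄ e h.1 h.2⟩⟩
  have hg : ∀ l ∈ ls, ∃ μ, VA.IsRunMapping l μ := by
    intro l hl
    obtain ⟨B, hB, ρ, hρ, h⟩ := hleaf l hl
    obtain ⟨μ, hμ⟩ := VA.exists_isRunMapping (hC B hB d ρ hρ).1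
    exact ⟨μ, (VA.isRunMapping_congr h).2 hμ⟩
  choose! g hg using hg
  refine ⟨ls.map g, ?_, fun μ => ?_, ?_⟩
  · have hnd : ops.Nodup := (List.nub_spec _).1
    refine List.pairwise_map.2 ((pairwise_leaves hnd (by simp)).imp_of_mem ?_)
    -- The operations of a run are determined by its mapping, whichever component it belongs to. Two
    -- leaves with the same mapping would thus have the same members, but distinct leaves differ in
    -- some element.
    rintro l l' hl hl' ⟨e, he⟩ hgg
    obtain ⟨B, hB, ρ, hρ, h⟩ := hleaf l hl
    obtain ⟨B', hB', ρ', hρ', h'⟩ := hleaf l' hl'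
    have hm := (VA.isRunMapping_congr h).1 (hg l hl)
    have hm' := (VA.isRunMapping_congr h').1 (hg l' hl')
    rw [← hgg] at hm'
    rw [h, h', hρ.mem_iff (hC B hB d ρ hρ).1 hm, hρ'.mem_iff (hC B' hB' d ρ' hρ').1 hm'] at he
    exact he Iff.rfl
  · rw [VA.mem_eval_join h₁ h₂, List.mem_map]
    constructor
    · rintro ⟨l, hl, rfl⟩
      obtain ⟨B, hB, ρ, hρ, h⟩ := hleaf l hl
      exact ⟨B, hB, ρ, hρ, (hC B hB d ρ hρ).1, (VA.isRunMapping_congr h).1 (hg l hl)⟩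
    · rintro ⟨B, hB, ρ, hρ, hv, hμ⟩
      -- The leaf for a given run is obtained by letting its set of operations decide at every node.
      obtain ⟨l, hl, h⟩ := exists_mem_leaves
        (E := RawVA.someExtends (CS, d.length + 1, positioned d)) (T := {e | e ∈ ρ ∧ e.1.IsOp})
        (r := ops) (l := []) (by simp)
        (fun e he => .inr (hρ.mem_operations ((hCS _).2 ⟨B, hB, rfl⟩) he.1 he.2))
        (fun l h => (VA.someExtends_iff hC hCS).2
          ⟨B, hB, ρ, hρ, fun e he => (h e).1 he, fun e he hop => .inl ((h e).2 ⟨he, hop⟩)⟩)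
      exact ⟨l, hl, isRunMapping_unique ((VA.isRunMapping_congr h).1 (hg l hl)) hμ⟩
  · rw [ho, List.forall₂_map_left_iff, List.forall₂_map_right_iff, List.forall₂_same]
    intro l hl
    obtain ⟨B, hB, ρ, hρ, h⟩ := hleaf l hl
    exact VA.isTableOf_tableOf hρ (hC B hB d ρ hρ).1 h (hg l hl)

theorem mainTheorem9 (k : ℕ) :
    -- the join is compiled in polynomial time into a disjunctive functional VA
    (∃ (P : Prog) (p : Polynomial ℕ), ∀ A₁ A₂ : VA k,
      A₁.DisjunctiveFunctional → A₂.DisjunctiveFunctional →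
      ∃ (w : List Event) (A : VA k),
        P.Run (Val.cons (Val.ofVA A₁) (Val.ofVA A₂)) w (Val.ofVA A) ∧
        Event.time w ≤ p.eval (Val.cons (Val.ofVA A₁) (Val.ofVA A₂)).size ∧
        A.DisjunctiveFunctional ∧
        A.eval = Spanner.join A₁.eval A₂.eval ∧
        -- its functional components are the pairwise joins of the functional components
        ∀ C₁ C₂ : List (VA k), A₁.HasComponents C₁ → A₂.HasComponents C₂ →
          ∃ C : List (VA k), A.HasComponents C ∧
            List.Forall₂ (fun B (D : VA k × VA k) => B.eval = Spanner.join D.1.eval D.2.eval)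
              C (C₁ ×ˢ C₂)) ∧
    -- the join is enumerated with polynomial delay
    (∃ (P : Prog) (p : Polynomial ℕ), ∀ A₁ A₂ : VA k,
      A₁.DisjunctiveFunctional → A₂.DisjunctiveFunctional →
      ∀ d : List (Fin k), ∃ (w : List Event) (y : Val),
        P.Run (Val.cons (Val.cons (Val.ofVA A₁) (Val.ofVA A₂)) (Val.ofDoc d)) w y ∧
        ListsMappings (Event.outputs w) (Spanner.join A₁.eval A₂.eval d) ∧
        Event.DelayAtMost
          (p.eval (Val.cons (Val.cons (Val.ofVA A₁) (Val.ofVA A₂)) (Val.ofDoc d)).size) w) :=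
  ⟨exists_prog_join k, exists_prog_enumerate_join k⟩
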